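/- Let $m\ge 1$ be an integer and $\epsilon\in\{+1,-1\}$. **Normalized maps.** A normalized formal map of $(\mathbb C^2,0)$ is a pair $H=(F,G)$ of formal power series in $(z,w)$ of the form $$F=z+f(z,w),\qquad G=w+w\,g_0(w)+w^m g(z,w),$$ with $f(0,0)=f_z(0,0)=0$, $g_0(0)=0$, $g=O(zw)$ (i.e. $g$ is divisible by $zw$) and $g_0^{(\ell)}(0)\in\mathbb R$ for $\ell\le m-1$. Such a map is invertible, and these maps are closed under composition. **The category $\mathfrak E_m$.** Its objects are the singular ODEs $$w''=w^m\,\Phi\!\left(z,w,\frac{w'}{w^m}\right),\qquad \Phi\in\mathbb C[[z,w,\zeta]],\quad \Phi=O(\zeta^2).$$ A formal family of curves $w=\rho(z,t)$, $t=(t_1,\dots,t_k)$, $\rho(0,0)=0$, is a family of solutions if there is a formal power series $\zeta(z,t)$ with $\zeta(0,0)=0$, $\rho_z=\rho^m\zeta$ and $\rho_{zz}=\rho^m\Phi(z,\rho,\zeta)$. A morphism $\mathcal E_1\to\mathcal E_2$ is a normalized map $(F,G)$ transforming graphs of solutions of $\mathcal E_1$ into graphs of solutions of $\mathcal E_2$: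 for every $k$ and every family $\rho(z,t)$ of solutions of $\mathcal E_1$ there is a family $\rho^*(z,t)$ of solutions of $\mathcal E_2$ with $G(z,\rho(z,t))=\rho^*(F(z,\rho(z,t)),t)$. **The category $\mathfrak S^{\pm}_m$** ($+$ for $\epsilon=1$, $-$ for $\epsilon=-1$). Its objects are the $m$-admissible Segre families $\mathcal S_\varphi=\{w=\rho(z,\bar\xi,\bar\eta)\}$, $$\rho(z,\bar\xi,\bar\eta)=\bar\eta\, e^{i\bar\eta^{m-1}\varphi(z,\bar\xi,\bar\eta)},\qquad \varphi(z,\bar\xi,\bar\eta)=\epsilon z\bar\xi+\sum_{k,\ell\ge2}\varphi_{k\ell}(\bar\eta)z^k\bar\xi^{\ell},$$ with $\varphi$ a formal power series. A morphism $\mathcal S_1\to\mathcal S_2$ is a map $(F(z,w),G(z,w),\Lambda(\xi,\eta),\Omega(\xi,\eta))$ with $(F,G)$ and $(\Lambda,\Omega)$ normalized which maps $\mathcal S_1$ into $\mathcal S_2$: $$G\bigl(z,\rho_1(z,\bar\xi,\bar\eta)\bigr)=\rho_2\bigl(F(z,\rho_1(z,\bar\xi,\bar\eta)),\bar\Lambda(\bar\xi,\bar\eta),\bar\Omega(\bar\xi,\bar\eta)\bigr),$$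 where $\bar\Lambda,\bar\Omega$ have the complex conjugate coefficients. Composition in both categories is composition of maps. **Proposition.** There are functors $\mathcal E:\mathfrak S_m^\pm\to\mathfrak E_m$ and $\mathcal S^\pm:\mathfrak E_m\to\mathfrak S_m^\pm$ with $$\mathcal E\circ\mathcal S^\pm=\mathrm{id}_{\mathfrak E_m},\qquad \mathcal S^\pm\circ\mathcal E=\mathrm{id}_{\mathfrak S_m^\pm},$$ such that: 1. For every Segre family $\mathcal S_0\in\mathfrak S_m^\pm$, $\mathcal E(\mathcal S_0)$ is the one and only object of $\mathfrak E_m$ satisfied by the defining function $\rho$ of $\mathcal S_0$; for every $\mathcal E_0\in\mathfrak E_m$, $\mathcal S^\pm(\mathcal E_0)$ is the one and only object of $\mathfrak S_m^\pm$ whose defining function is a family of solutions of $\mathcal E_0$. On morphisms, $\mathcal E(F,G,\Lambda,\Omega)=(F,G)$, and $\mathcal S^\pm(F,G)$ has first two components $(F,G)$. 2. The functors preserve convergence: $\mathcal E$ takes Segre families with convergent $\varphi$ to ODEs with convergent $\Phi$, and $\mathcal S^\pm$ takes ODEs with convergent $\Phi$ to Segre families with convergent $\varphi$; and both functors take convergent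 morphisms between convergent objects (all component series of the morphism converge) to convergent morphisms. Here a power series is convergent if it converges absolutely on some polydisc about the origin. -/

import Mathlib

open CategoryTheory

noncomputable section

namespace SegreODE

/-- A formal power series in `n` complex variables is convergent if it converges absolutely on
some polydisc of positive radius about the origin. -/
def IsConvergent {n : ℕ} (f : MvPowerSeries (Fin n) ℂ) : Prop :=
  ∃ r : ℝ, 0 < r ∧
    Summable fun d : Fin n →₀ ℕ => ‖MvPowerSeries.coeff d f‖ * ∏ i, r ^ d i

/-- The normalization of the second component: `G = w + w g₀(w) + w ^ m g(z, w)` with `g₀(0) = 0`,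
`g = O(z w)` and `g₀^(ℓ)(0)` real for `ℓ ≤ m - 1`. The variables are `z = X 0` and `w = X 1`. -/
def IsNormalizedSnd (m : ℕ) (G : MvPowerSeries (Fin 2) ℂ) : Prop :=
  ∃ (g₀ : PowerSeries ℂ) (g : MvPowerSeries (Fin 2) ℂ),
    G = MvPowerSeries.X 1 + MvPowerSeries.X 1 * g₀.subst (MvPowerSeries.X 1 : MvPowerSeries (Fin 2) ℂ)
      + MvPowerSeries.X 1 ^ m * g ∧
    PowerSeries.constantCoeff g₀ = 0 ∧
    (MvPowerSeries.X 0 * MvPowerSeries.X 1 ∣ g) ∧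
    ∀ ℓ < m, (PowerSeries.coeff ℓ g₀).im = 0

/-- A normalized formal map `(z, w) ↦ (F(z, w), G(z, w))` of `(ℂ², 0)`: `F = z + f` with
`f(0, 0) = f_z(0, 0) = 0`, and `G` normalized as above. Such a map is automatically invertible
(for `m ≥ 1`), its Jacobian determinant at the origin being `1`. -/
@[ext]
structure NormalizedMap (m : ℕ) where
  F : MvPowerSeries (Fin 2) ℂ
  G : MvPowerSeries (Fin 2) ℂ
  F_zero : MvPowerSeries.constantCoeff F = 0
  F_z : MvPowerSeries.coeff (Finsupp.single 0 1) F = 1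
  G_normalized : IsNormalizedSnd m G

/-! Helper facts: normalized maps form a monoid under composition. -/

theorem coeff_aeval_X_one (r : Polynomial ℝ) (d : Fin 2 →₀ ℕ) :
    MvPowerSeries.coeff d (Polynomial.aeval (MvPowerSeries.X 1 : MvPowerSeries (Fin 2) ℂ) r) =
      if d 0 = 0 then ((r.coeff (d 1) : ℝ) : ℂ) else 0 := by
  have h : Polynomial.aeval (MvPowerSeries.X 1 : MvPowerSeries (Fin 2) ℂ) r =
      PowerSeries.subst (MvPowerSeries.X 1 : MvPowerSeries (Fin 2) ℂ)
        ((r.map (algebraMap ℝ ℂ) : Polynomial ℂ) : PowerSeries ℂ) := by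
    rw [PowerSeries.subst_coe (PowerSeries.HasSubst.X _), Polynomial.aeval_map_algebraMap]
  have hd : (d = Finsupp.single 1 (d 1)) ↔ d 0 = 0 := by
    constructor
    · intro h; rw [h]; simp
    · intro h; ext i; fin_cases i <;> simp [h]
  rw [h, PowerSeries.coeff_subst_single]
  simp [hd]

theorem isNormalizedSnd_iff {m : ℕ} (hm : m ≠ 0) (G : MvPowerSeries (Fin 2) ℂ) :
    IsNormalizedSnd m G ↔ ∃ r : Polynomial ℝ, r.coeff 0 = 0 ∧ r.coeff 1 = 1 ∧
      MvPowerSeries.X 1 ^ (m + 1) ∣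
        G - Polynomial.aeval (MvPowerSeries.X 1 : MvPowerSeries (Fin 2) ℂ) r := by
  constructor
  · rintro ⟨g₀, g, rfl, h0, ⟨k, rfl⟩, hre⟩
    let p : Polynomial ℝ := ∑ ℓ ∈ Finset.range m, Polynomial.monomial ℓ (PowerSeries.coeff ℓ g₀).re
    have hp : ∀ n, p.coeff n = if n < m then (PowerSeries.coeff n g₀).re else 0 := by
      intro n
      simp [p, Polynomial.finsetSum_coeff, Polynomial.coeff_monomial]
    refine ⟨Polynomial.X + Polynomial.X * p, by simp, ?_, ?_⟩
    · have : p.coeff 0 = 0 := by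
        rw [hp]
        simp only [PowerSeries.coeff_zero_eq_constantCoeff_apply, h0]
        simp
      simp [Polynomial.coeff_X_mul, this]
    · have key : MvPowerSeries.X 1 ^ m ∣
          g₀.subst (MvPowerSeries.X 1 : MvPowerSeries (Fin 2) ℂ) -
            Polynomial.aeval (MvPowerSeries.X 1 : MvPowerSeries (Fin 2) ℂ) p := by
        rw [MvPowerSeries.X_pow_dvd_iff]
        intro d hd
        rw [map_sub, coeff_aeval_X_one, PowerSeries.coeff_subst_single, hp, if_pos hd]
        have hd' : (d = Finsupp.single 1 (d 1)) ↔ d 0 = 0 := by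
          constructor
          · intro h; rw [h]; simp
          · intro h; ext i; fin_cases i <;> simp [h]
        simp only [hd']
        split_ifs
        · rw [sub_eq_zero]
          apply Complex.ext <;> simp [hre _ hd]
        · simp
      obtain ⟨q, hq⟩ := key
      refine ⟨q + MvPowerSeries.X 0 * k, ?_⟩
      rw [map_add, map_mul, Polynomial.aeval_X]
      linear_combination (MvPowerSeries.X 1 : MvPowerSeries (Fin 2) ℂ) * hq
  · rintro ⟨r, h0, h1, h⟩
    rw [MvPowerSeries.X_pow_dvd_iff] at h
    have hc : ∀ d : Fin 2 →₀ ℕ, d 1 < m + 1 → MvPowerSeries.coeff d G =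
        if d 0 = 0 then ((r.coeff (d 1) : ℝ) : ℂ) else 0 := by
      intro d hd
      have := h d hd
      rwa [map_sub, sub_eq_zero, coeff_aeval_X_one] at this
    let g₀ : PowerSeries ℂ := PowerSeries.mk fun n =>
      MvPowerSeries.coeff (Finsupp.single 1 (n + 1)) G - if n = 0 then 1 else 0
    have hd' : ∀ (d : Fin 2 →₀ ℕ), (d = Finsupp.single 1 (d 1)) ↔ d 0 = 0 := by
      intro d
      constructor
      · intro h; rw [h]; simp
      · intro h; ext i; fin_cases i <;> simp [h]
    let K : MvPowerSeries (Fin 2) ℂ := G - MvPowerSeries.X 1 - MvPowerSeries.X 1 *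
      g₀.subst (MvPowerSeries.X 1 : MvPowerSeries (Fin 2) ℂ)
    have hK0 : ∀ d : Fin 2 →₀ ℕ, d 0 = 0 → MvPowerSeries.coeff d K = 0 := by
      intro d hd
      have hs := (hd' d).2 hd
      rw [hs]
      simp only [K, map_sub]
      rcases hn : d 1 with _ | n
      · rw [Finsupp.single_zero, hc 0 (by simp)]
        simp [h0]
      · have e : (Finsupp.single 1 (n + 1) : Fin 2 →₀ ℕ) =
            Finsupp.single 1 1 + Finsupp.single 1 n := by
          rw [← Finsupp.single_add, add_comm]
        have e' : ∀ f : MvPowerSeries (Fin 2) ℂ,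
            MvPowerSeries.coeff (Finsupp.single 1 (n + 1)) (MvPowerSeries.X 1 * f) =
              MvPowerSeries.coeff (Finsupp.single 1 n) f := by
          intro f
          rw [e, MvPowerSeries.X, MvPowerSeries.coeff_add_monomial_mul, one_mul]
        rw [e', PowerSeries.coeff_subst_single]
        rw [MvPowerSeries.coeff_X]
        simp only [g₀, PowerSeries.coeff_mk]
        by_cases hn0 : n = 0
        · subst hn0; simp
        · have : ¬ (Finsupp.single (1 : Fin 2) (n + 1) = Finsupp.single 1 1) := by
            intro h
            have := Finsupp.single_injective _ h
            omega
          simp [hn0]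
    have hK1 : ∀ d : Fin 2 →₀ ℕ, d 1 < m + 1 → MvPowerSeries.coeff d K = 0 := by
      intro d hd
      by_cases hz : d 0 = 0
      · exact hK0 d hz
      · simp only [K, map_sub]
        rw [hc d hd, if_neg hz]
        have e1 : MvPowerSeries.coeff d (MvPowerSeries.X 1 : MvPowerSeries (Fin 2) ℂ) = 0 := by
          rw [MvPowerSeries.coeff_X, if_neg]
          rintro rfl
          simp at hz
        have e2 : MvPowerSeries.coeff d (MvPowerSeries.X 1 *
            g₀.subst (MvPowerSeries.X 1 : MvPowerSeries (Fin 2) ℂ)) = 0 := by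
          rw [MvPowerSeries.coeff_mul]
          refine Finset.sum_eq_zero ?_
          rintro ⟨a, b⟩ hab
          rw [Finset.HasAntidiagonal.mem_antidiagonal] at hab
          rw [MvPowerSeries.coeff_X, PowerSeries.coeff_subst_single]
          simp only [hd' b]
          split_ifs with ha hb
          · exfalso
            apply hz
            rw [← hab]
            simp [ha, hb]
          all_goals simp
        rw [e1, e2]; simp
    obtain ⟨L, hL⟩ := (MvPowerSeries.X_pow_dvd_iff (s := 1) (n := m + 1) (φ := K)).2 hK1
    have hL0 : (MvPowerSeries.X 0 : MvPowerSeries (Fin 2) ℂ) ∣ L := by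
      rw [MvPowerSeries.X_dvd_iff]
      intro d hd
      have := hK0 (Finsupp.single 1 (m + 1) + d) (by simp [hd])
      rw [hL, MvPowerSeries.X_pow_eq, MvPowerSeries.coeff_add_monomial_mul, one_mul] at this
      exact this
    obtain ⟨L', rfl⟩ := hL0
    refine ⟨g₀, MvPowerSeries.X 0 * MvPowerSeries.X 1 * L', ?_, ?_, ⟨L', rfl⟩, ?_⟩
    · have : G = MvPowerSeries.X 1 + MvPowerSeries.X 1 *
          g₀.subst (MvPowerSeries.X 1 : MvPowerSeries (Fin 2) ℂ) + K := by simp only [K]; ring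
      rw [this, hL]; ring
    · rw [← PowerSeries.coeff_zero_eq_constantCoeff_apply]
      simp only [g₀, PowerSeries.coeff_mk]
      rw [hc _ (by simp; omega)]
      simp [h1]
    · intro ℓ hℓ
      simp only [g₀, PowerSeries.coeff_mk]
      rw [hc _ (by simpa using hℓ)]
      simp only [Finsupp.single_eq_same, Complex.sub_im]
      split_ifs <;> simp

theorem constantCoeff_subst_eq {n k : ℕ} {a : Fin n → MvPowerSeries (Fin k) ℂ}
    (ha : ∀ i, MvPowerSeries.constantCoeff (a i) = 0) (f : MvPowerSeries (Fin n) ℂ) :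
    MvPowerSeries.constantCoeff (f.subst a) = MvPowerSeries.constantCoeff f := by
  have hs := MvPowerSeries.hasSubst_of_constantCoeff_zero ha
  have h := MvPowerSeries.constantCoeff_subst_eq_zero hs ha
    (f := f - MvPowerSeries.C (MvPowerSeries.constantCoeff f)) (by simp)
  rw [MvPowerSeries.subst_sub hs, MvPowerSeries.subst_C, map_sub, sub_eq_zero] at h
  simpa using h

theorem constantCoeff_vec_two {k : ℕ} {a b : MvPowerSeries (Fin k) ℂ}
    (ha : MvPowerSeries.constantCoeff a = 0) (hb : MvPowerSeries.constantCoeff b = 0) :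
    ∀ i, MvPowerSeries.constantCoeff ((![a, b] : Fin 2 → MvPowerSeries (Fin k) ℂ) i) = 0 := by
  intro i; fin_cases i <;> simpa

theorem constantCoeff_vec_three {k : ℕ} {a b c : MvPowerSeries (Fin k) ℂ}
    (ha : MvPowerSeries.constantCoeff a = 0) (hb : MvPowerSeries.constantCoeff b = 0)
    (hc : MvPowerSeries.constantCoeff c = 0) :
    ∀ i, MvPowerSeries.constantCoeff ((![a, b, c] : Fin 3 → MvPowerSeries (Fin k) ℂ) i) = 0 := by
  intro i; fin_cases i <;> simpa

theorem subst_subst_two {k l : ℕ} {a b : MvPowerSeries (Fin k) ℂ}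
    (ha : MvPowerSeries.constantCoeff a = 0) (hb : MvPowerSeries.constantCoeff b = 0)
    {c : Fin k → MvPowerSeries (Fin l) ℂ} (hc : ∀ i, MvPowerSeries.constantCoeff (c i) = 0)
    (f : MvPowerSeries (Fin 2) ℂ) :
    (f.subst ![a, b]).subst c = f.subst ![a.subst c, b.subst c] := by
  rw [MvPowerSeries.subst_comp_subst_apply
    (MvPowerSeries.hasSubst_of_constantCoeff_zero (constantCoeff_vec_two ha hb))
    (MvPowerSeries.hasSubst_of_constantCoeff_zero hc)]
  congr 1
  ext1 i; fin_cases i <;> rfl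

theorem subst_subst_three {k l : ℕ} {a b d : MvPowerSeries (Fin k) ℂ}
    (ha : MvPowerSeries.constantCoeff a = 0) (hb : MvPowerSeries.constantCoeff b = 0)
    (hd : MvPowerSeries.constantCoeff d = 0)
    {c : Fin k → MvPowerSeries (Fin l) ℂ} (hc : ∀ i, MvPowerSeries.constantCoeff (c i) = 0)
    (f : MvPowerSeries (Fin 3) ℂ) :
    (f.subst ![a, b, d]).subst c = f.subst ![a.subst c, b.subst c, d.subst c] := by
  rw [MvPowerSeries.subst_comp_subst_apply
    (MvPowerSeries.hasSubst_of_constantCoeff_zero (constantCoeff_vec_three ha hb hd))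
    (MvPowerSeries.hasSubst_of_constantCoeff_zero hc)]
  congr 1
  ext1 i; fin_cases i <;> rfl

theorem subst_X_eq {n k : ℕ} {a : Fin n → MvPowerSeries (Fin k) ℂ}
    (ha : ∀ i, MvPowerSeries.constantCoeff (a i) = 0) (i : Fin n) :
    (MvPowerSeries.X i : MvPowerSeries (Fin n) ℂ).subst a = a i :=
  MvPowerSeries.subst_X (MvPowerSeries.hasSubst_of_constantCoeff_zero ha) i

theorem subst_vec_X_two (f : MvPowerSeries (Fin 2) ℂ) :
    f.subst ![(MvPowerSeries.X 0 : MvPowerSeries (Fin 2) ℂ), MvPowerSeries.X 1] = f := by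
  have : ![(MvPowerSeries.X 0 : MvPowerSeries (Fin 2) ℂ), MvPowerSeries.X 1] =
      MvPowerSeries.X := by
    ext1 i; fin_cases i <;> rfl
  rw [this, MvPowerSeries.subst_self]; rfl

theorem coeff_single_zero_one (f : MvPowerSeries (Fin 2) ℂ) :
    MvPowerSeries.coeff (Finsupp.single 0 1) f =
      MvPowerSeries.constantCoeff (MvPowerSeries.pderiv ℂ 0 f) := by
  rw [← MvPowerSeries.coeff_zero_eq_constantCoeff_apply, MvPowerSeries.coeff_pderiv]
  simp

theorem exists_decomposition (f : MvPowerSeries (Fin 2) ℂ)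
    (hf : MvPowerSeries.constantCoeff f = 0) :
    ∃ A B : MvPowerSeries (Fin 2) ℂ,
      f = MvPowerSeries.X 0 * A + MvPowerSeries.X 1 * B ∧
      MvPowerSeries.constantCoeff A = MvPowerSeries.coeff (Finsupp.single 0 1) f := by
  let A : MvPowerSeries (Fin 2) ℂ := fun d => MvPowerSeries.coeff (Finsupp.single 0 1 + d) f
  have hA : ∀ d, MvPowerSeries.coeff d A = MvPowerSeries.coeff (Finsupp.single 0 1 + d) f :=
    fun d => rfl
  have h : (MvPowerSeries.X 1 : MvPowerSeries (Fin 2) ℂ) ∣ f - MvPowerSeries.X 0 * A := by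
    rw [MvPowerSeries.X_dvd_iff]
    intro d hd
    by_cases h0 : d 0 = 0
    · have : d = 0 := by ext i; fin_cases i <;> simpa
      subst this
      simp [hf]
    · have : d = Finsupp.single 0 1 + (d - Finsupp.single 0 1) := by
        ext i; fin_cases i
        · simp; omega
        · simp
      rw [this, map_sub, MvPowerSeries.X, MvPowerSeries.coeff_add_monomial_mul, hA]
      simp
  obtain ⟨B, hB⟩ := h
  refine ⟨A, B, by rw [← hB]; ring, ?_⟩
  rw [← MvPowerSeries.coeff_zero_eq_constantCoeff_apply, hA, add_zero]

namespace NormalizedMap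

variable {m : ℕ}

theorem X_dvd_G [NeZero m] (h : NormalizedMap m) : MvPowerSeries.X 1 ∣ h.G := by
  obtain ⟨g₀, g, hG, -⟩ := h.G_normalized
  rw [hG]
  exact dvd_add (dvd_add dvd_rfl (dvd_mul_right _ _))
    (Dvd.dvd.mul_right (dvd_pow_self _ (NeZero.ne m)) _)

theorem G_zero [NeZero m] (h : NormalizedMap m) : MvPowerSeries.constantCoeff h.G = 0 := by
  obtain ⟨k, hk⟩ := h.X_dvd_G
  rw [hk]; simp

theorem constantCoeff_vec [NeZero m] (h : NormalizedMap m) :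
    ∀ i, MvPowerSeries.constantCoeff
      ((![h.F, h.G] : Fin 2 → MvPowerSeries (Fin 2) ℂ) i) = 0 :=
  constantCoeff_vec_two h.F_zero h.G_zero

theorem comp_F_z [NeZero m] (h₂ h₁ : NormalizedMap m) :
    MvPowerSeries.coeff (Finsupp.single 0 1) (h₂.F.subst ![h₁.F, h₁.G]) = 1 := by
  have hs := MvPowerSeries.hasSubst_of_constantCoeff_zero h₁.constantCoeff_vec
  obtain ⟨A, B, hF, hA⟩ := exists_decomposition h₂.F h₂.F_zero
  obtain ⟨k, hk⟩ := h₁.X_dvd_G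
  rw [h₂.F_z] at hA
  have hA' := constantCoeff_subst_eq h₁.constantCoeff_vec A
  have hF1 := h₁.F_z
  have hG0 := h₁.G_zero
  have hX : MvPowerSeries.pderiv ℂ (0 : Fin 2) (MvPowerSeries.X 1) = 0 :=
    MvPowerSeries.pderiv_X_of_ne (by decide)
  have hG1 : MvPowerSeries.constantCoeff (MvPowerSeries.pderiv ℂ 0 h₁.G) = 0 := by
    simp [hk, Derivation.leibniz, hX]
  rw [hF, MvPowerSeries.subst_add hs, MvPowerSeries.subst_mul hs, MvPowerSeries.subst_mul hs,
    subst_X_eq h₁.constantCoeff_vec, subst_X_eq h₁.constantCoeff_vec]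
  rw [coeff_single_zero_one] at hF1 ⊢
  simp [Derivation.leibniz, h₁.F_zero, hA', hA, hF1, hG0, hG1]

theorem comp_G_normalized [NeZero m] (h₂ h₁ : NormalizedMap m) :
    IsNormalizedSnd m (h₂.G.subst ![h₁.F, h₁.G]) := by
  have hm : m ≠ 0 := NeZero.ne m
  have hs := MvPowerSeries.hasSubst_of_constantCoeff_zero h₁.constantCoeff_vec
  obtain ⟨r₁, h10, h11, q₁, hq₁⟩ := (isNormalizedSnd_iff hm _).1 h₁.G_normalized
  obtain ⟨r₂, h20, h21, q₂, hq₂⟩ := (isNormalizedSnd_iff hm _).1 h₂.G_normalized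
  rw [isNormalizedSnd_iff hm]
  refine ⟨r₂.comp r₁, ?_, ?_, ?_⟩
  · rw [Polynomial.coeff_zero_eq_eval_zero] at h10 h20 ⊢
    rw [Polynomial.eval_comp, h10, h20]
  · have hd : ∀ p : Polynomial ℝ, p.coeff 1 = (Polynomial.derivative p).eval 0 := by
      intro p
      rw [← Polynomial.coeff_zero_eq_eval_zero, Polynomial.coeff_derivative]
      simp
    rw [hd] at h11 h21 ⊢
    rw [Polynomial.coeff_zero_eq_eval_zero] at h10
    rw [Polynomial.derivative_comp, Polynomial.eval_mul, Polynomial.eval_comp, h10, h11, h21]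
    simp
  · have ep : (Polynomial.aeval (MvPowerSeries.X 1 : MvPowerSeries (Fin 2) ℂ) r₂).subst
        ![h₁.F, h₁.G] = Polynomial.aeval h₁.G r₂ := by
      have := Polynomial.aeval_algHom_apply
        ((MvPowerSeries.substAlgHom (R := ℂ) hs).restrictScalars ℝ)
        (MvPowerSeries.X 1 : MvPowerSeries (Fin 2) ℂ) r₂
      simp only [AlgHom.restrictScalars_apply, MvPowerSeries.coe_substAlgHom] at this
      rw [← this, subst_X_eq h₁.constantCoeff_vec]
      rfl
    have e : h₂.G.subst ![h₁.F, h₁.G] =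
        Polynomial.aeval h₁.G r₂ + h₁.G ^ (m + 1) * q₂.subst ![h₁.F, h₁.G] := by
      rw [sub_eq_iff_eq_add] at hq₂
      rw [hq₂, MvPowerSeries.subst_add hs, MvPowerSeries.subst_mul hs, MvPowerSeries.subst_pow hs,
        subst_X_eq h₁.constantCoeff_vec, ep, add_comm]
      rfl
    rw [e, Polynomial.aeval_comp, add_sub_right_comm]
    refine dvd_add ?_ (Dvd.dvd.mul_right (pow_dvd_pow_of_dvd h₁.X_dvd_G _) _)
    refine dvd_trans ⟨q₁, hq₁⟩ ?_
    simp only [Polynomial.aeval_def, Polynomial.eval₂_eq_eval_map]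
    exact Polynomial.sub_dvd_eval_sub _ _ _

/-- Composition `h₂ ∘ h₁` of normalized maps. -/
def comp [NeZero m] (h₂ h₁ : NormalizedMap m) : NormalizedMap m where
  F := h₂.F.subst ![h₁.F, h₁.G]
  G := h₂.G.subst ![h₁.F, h₁.G]
  F_zero := by rw [constantCoeff_subst_eq h₁.constantCoeff_vec, h₂.F_zero]
  F_z := comp_F_z h₂ h₁
  G_normalized := comp_G_normalized h₂ h₁

/-- The identity map. -/
def id (m : ℕ) : NormalizedMap m where
  F := MvPowerSeries.X 0
  G := MvPowerSeries.X 1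
  F_zero := by simp
  F_z := by simp [MvPowerSeries.coeff_X]
  G_normalized := ⟨0, 0, by
    rw [← PowerSeries.coe_substAlgHom (PowerSeries.HasSubst.X _)]; simp, by simp, by simp, by simp⟩

theorem comp_assoc [NeZero m] (h₃ h₂ h₁ : NormalizedMap m) :
    (h₃.comp h₂).comp h₁ = h₃.comp (h₂.comp h₁) := by
  ext1
  · exact subst_subst_two h₂.F_zero h₂.G_zero h₁.constantCoeff_vec _
  · exact subst_subst_two h₂.F_zero h₂.G_zero h₁.constantCoeff_vec _

theorem comp_id [NeZero m] (h : NormalizedMap m) : h.comp (id m) = h := by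
  ext1
  · exact subst_vec_X_two _
  · exact subst_vec_X_two _

theorem id_comp [NeZero m] (h : NormalizedMap m) : (id m).comp h = h := by
  ext1
  · exact subst_X_eq h.constantCoeff_vec 0
  · exact subst_X_eq h.constantCoeff_vec 1

/-- Convergence of a normalized map. -/
def Convergent (h : NormalizedMap m) : Prop := IsConvergent h.F ∧ IsConvergent h.G

/-- `h = (F, G)` transforms the family of graphs `w = ρ(z, t)` into the family of graphs
`w = ρ'(z, t)`, that is, `G(z, ρ(z, t)) = ρ'(F(z, ρ(z, t)), t)`. Here `z = X 0` and
`t = (X 1, …, X k)`. -/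
def TransformsGraph (h : NormalizedMap m) {k : ℕ} (ρ ρ' : MvPowerSeries (Fin (k + 1)) ℂ) : Prop :=
  h.G.subst ![MvPowerSeries.X 0, ρ] =
    ρ'.subst (Fin.cons (h.F.subst ![MvPowerSeries.X 0, ρ]) fun i => MvPowerSeries.X i.succ :
      Fin (k + 1) → MvPowerSeries (Fin (k + 1)) ℂ)

end NormalizedMap

/-! ## The category of singular ODEs -/

/-- The equation `w'' = w ^ m Φ(z, w, w' / w ^ m)` with `Φ = Φ(z, w, ζ) = O(ζ ^ 2)` a formal power
series; the variables are `z = X 0`, `w = X 1`, `ζ = X 2`. -/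
@[ext]
structure SingularODE (m : ℕ) where
  Φ : MvPowerSeries (Fin 3) ℂ
  isBigO : MvPowerSeries.X 2 ^ 2 ∣ Φ

/-- A formal family `w = ρ(z, t)` of curves, `ρ(0, 0) = 0`, with an arbitrary finite number of
parameters `t = (X 1, …, X k)` and with `z = X 0`, consists of solutions of the equation: the
quotient `ζ = w' / w ^ m` is a formal power series without constant term (so that it can be
substituted into `Φ`) and `w'' = w ^ m Φ(z, w, ζ)`. -/
def SingularODE.IsSolution {m : ℕ} (E : SingularODE m) {k : ℕ}
    (ρ : MvPowerSeries (Fin (k + 1)) ℂ) : Prop :=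
  MvPowerSeries.constantCoeff ρ = 0 ∧
  ∃ ζ : MvPowerSeries (Fin (k + 1)) ℂ,
    MvPowerSeries.constantCoeff ζ = 0 ∧
    MvPowerSeries.pderiv ℂ 0 ρ = ρ ^ m * ζ ∧
    MvPowerSeries.pderiv ℂ 0 (MvPowerSeries.pderiv ℂ 0 ρ) =
      ρ ^ m * E.Φ.subst ![MvPowerSeries.X 0, ρ, ζ]

/-- Convergence of a singular ODE. -/
def SingularODE.Convergent {m : ℕ} (E : SingularODE m) : Prop := IsConvergent E.Φ

/-- A morphism of singular ODEs: a normalized map transforming (families of) graphs of solutions of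
`E₁` into (families of) graphs of solutions of `E₂`. -/
@[ext]
structure SingularODE.Hom {m : ℕ} (E₁ E₂ : SingularODE m) where
  planar : NormalizedMap m
  transforms : ∀ (k : ℕ) (ρ : MvPowerSeries (Fin (k + 1)) ℂ), E₁.IsSolution ρ →
    ∃ ρ' : MvPowerSeries (Fin (k + 1)) ℂ, E₂.IsSolution ρ' ∧ planar.TransformsGraph ρ ρ'

theorem NormalizedMap.TransformsGraph.comp {m : ℕ} [NeZero m] {h₂ h₁ : NormalizedMap m} {k : ℕ}
    {ρ ρ' ρ'' : MvPowerSeries (Fin (k + 1)) ℂ}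
    (hρ : MvPowerSeries.constantCoeff ρ = 0) (hρ' : MvPowerSeries.constantCoeff ρ' = 0)
    (H₁ : h₁.TransformsGraph ρ ρ') (H₂ : h₂.TransformsGraph ρ' ρ'') :
    (h₂.comp h₁).TransformsGraph ρ ρ'' := by
  have hv := constantCoeff_vec_two (MvPowerSeries.constantCoeff_X (R := ℂ) (0 : Fin (k + 1))) hρ
  have hv' := constantCoeff_vec_two (MvPowerSeries.constantCoeff_X (R := ℂ) (0 : Fin (k + 1))) hρ'
  have hc : ∀ (f : MvPowerSeries (Fin (k + 1)) ℂ), MvPowerSeries.constantCoeff f = 0 → ∀ i,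
      MvPowerSeries.constantCoeff ((Fin.cons f fun i => MvPowerSeries.X i.succ :
        Fin (k + 1) → MvPowerSeries (Fin (k + 1)) ℂ) i) = 0 := by
    intro f hf i
    refine Fin.cases ?_ (fun j => ?_) i
    · simpa using hf
    · simp
  have hF₁ : MvPowerSeries.constantCoeff (h₁.F.subst ![MvPowerSeries.X 0, ρ]) = 0 := by
    rw [constantCoeff_subst_eq hv, h₁.F_zero]
  have hF₂ : MvPowerSeries.constantCoeff (h₂.F.subst ![MvPowerSeries.X 0, ρ']) = 0 := by
    rw [constantCoeff_subst_eq hv', h₂.F_zero]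
  have key : ∀ f : MvPowerSeries (Fin 2) ℂ,
      (f.subst ![h₁.F, h₁.G]).subst ![MvPowerSeries.X 0, ρ] =
        (f.subst ![MvPowerSeries.X 0, ρ']).subst
          (Fin.cons (h₁.F.subst ![MvPowerSeries.X 0, ρ]) fun i => MvPowerSeries.X i.succ :
            Fin (k + 1) → MvPowerSeries (Fin (k + 1)) ℂ) := by
    intro f
    rw [subst_subst_two h₁.F_zero h₁.G_zero hv,
      subst_subst_two (MvPowerSeries.constantCoeff_X _) hρ' (hc _ hF₁), subst_X_eq (hc _ hF₁)]
    rw [H₁]; rfl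
  unfold NormalizedMap.TransformsGraph at H₂ ⊢
  simp only [NormalizedMap.comp, key]
  rw [H₂, MvPowerSeries.subst_comp_subst_apply
    (MvPowerSeries.hasSubst_of_constantCoeff_zero (hc _ hF₂))
    (MvPowerSeries.hasSubst_of_constantCoeff_zero (hc _ hF₁))]
  congr 1
  ext1 i
  refine Fin.cases ?_ (fun j => ?_) i
  · rfl
  · simp only [Fin.cons_succ]
    rw [subst_X_eq (hc _ hF₁)]
    rfl

theorem NormalizedMap.transformsGraph_id {m : ℕ} {k : ℕ}
    (ρ : MvPowerSeries (Fin (k + 1)) ℂ) (hρ : MvPowerSeries.constantCoeff ρ = 0) :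
    (NormalizedMap.id m).TransformsGraph ρ ρ := by
  have hv := constantCoeff_vec_two (MvPowerSeries.constantCoeff_X (R := ℂ) (0 : Fin (k + 1))) hρ
  unfold NormalizedMap.TransformsGraph
  simp only [NormalizedMap.id]
  rw [subst_X_eq hv, subst_X_eq hv]
  have : (Fin.cons (![MvPowerSeries.X 0, ρ] 0) fun i => MvPowerSeries.X i.succ :
      Fin (k + 1) → MvPowerSeries (Fin (k + 1)) ℂ) = MvPowerSeries.X := by
    ext1 i
    refine Fin.cases ?_ (fun j => ?_) i <;> rfl
  rw [this, MvPowerSeries.subst_self]; rfl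

instance (m : ℕ) [NeZero m] : Category (SingularODE m) where
  Hom E₁ E₂ := SingularODE.Hom E₁ E₂
  id E := ⟨NormalizedMap.id m, fun _ ρ hρ => ⟨ρ, hρ, NormalizedMap.transformsGraph_id ρ hρ.1⟩⟩
  comp h₁ h₂ := ⟨h₂.planar.comp h₁.planar, fun k ρ hρ => by
    obtain ⟨ρ', hρ', H₁⟩ := h₁.transforms k ρ hρ
    obtain ⟨ρ'', hρ'', H₂⟩ := h₂.transforms k ρ' hρ'
    exact ⟨ρ'', hρ'', H₁.comp hρ.1 hρ'.1 H₂⟩⟩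
  id_comp _ := SingularODE.Hom.ext (NormalizedMap.comp_id _)
  comp_id _ := SingularODE.Hom.ext (NormalizedMap.id_comp _)
  assoc _ _ _ := SingularODE.Hom.ext (NormalizedMap.comp_assoc _ _ _).symm

/-! ## The category of Segre families -/

/-- An `m`-admissible Segre family of sign `ε`, given by a formal power series
`φ(z, χ, τ) = ε z χ + ∑_{k, l ≥ 2} φ_{kl}(τ) z ^ k χ ^ l`; the variables are `z = X 0`,
`χ = X 1` (standing for the conjugate of `ξ`) and `τ = X 2` (the conjugate of `η`). -/
@[ext]
structure SegreFamily (m : ℕ) (ε : ℤˣ) where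
  φ : MvPowerSeries (Fin 3) ℂ
  admissible : MvPowerSeries.X 0 ^ 2 * MvPowerSeries.X 1 ^ 2 ∣
    φ - MvPowerSeries.C ((ε : ℤ) : ℂ) * MvPowerSeries.X 0 * MvPowerSeries.X 1

/-- The right-hand side `ρ(z, χ, τ) = τ exp(i τ ^ (m - 1) φ(z, χ, τ))` of the defining equation of
the Segre family. -/
def SegreFamily.definingFunction {m : ℕ} {ε : ℤˣ} (S : SegreFamily m ε) :
    MvPowerSeries (Fin 3) ℂ :=
  MvPowerSeries.X 2 *
    (PowerSeries.exp ℂ).subst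
      (MvPowerSeries.C Complex.I * MvPowerSeries.X 2 ^ (m - 1) * S.φ)

/-- Convergence of a Segre family. -/
def SegreFamily.Convergent {m : ℕ} {ε : ℤˣ} (S : SegreFamily m ε) : Prop := IsConvergent S.φ

/-- Conjugation of the coefficients of a power series. -/
def conj {n : ℕ} (f : MvPowerSeries (Fin n) ℂ) : MvPowerSeries (Fin n) ℂ :=
  MvPowerSeries.map (starRingEnd ℂ) f

/-- A morphism of Segre families: a pair of normalized maps `planar = (F, G)` in `(z, w)` and
`param = (Λ, Ω)` in `(ξ, η)` such that the member of `S₁` with parameters `(ξ, η)` is mapped by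
`(F, G)` into the member of `S₂` with parameters `(Λ(ξ, η), Ω(ξ, η))`. With `χ` and `τ` the
conjugates of `ξ` and `η`, this reads
`G(z, ρ₁(z, χ, τ)) = ρ₂(F(z, ρ₁(z, χ, τ)), Λ̄(χ, τ), Ω̄(χ, τ))`. -/
@[ext]
structure SegreFamily.Hom {m : ℕ} {ε : ℤˣ} (S₁ S₂ : SegreFamily m ε) where
  planar : NormalizedMap m
  param : NormalizedMap m
  maps_into : planar.G.subst ![MvPowerSeries.X 0, S₁.definingFunction] =
    S₂.definingFunction.subst
      ![planar.F.subst ![MvPowerSeries.X 0, S₁.definingFunction],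
        (conj param.F).subst
          ![(MvPowerSeries.X 1 : MvPowerSeries (Fin 3) ℂ), MvPowerSeries.X 2],
        (conj param.G).subst
          ![(MvPowerSeries.X 1 : MvPowerSeries (Fin 3) ℂ), MvPowerSeries.X 2]]

theorem SegreFamily.constantCoeff_definingFunction {m : ℕ} {ε : ℤˣ} (S : SegreFamily m ε) :
    MvPowerSeries.constantCoeff S.definingFunction = 0 := by
  simp [SegreFamily.definingFunction]

theorem constantCoeff_conj {n : ℕ} {f : MvPowerSeries (Fin n) ℂ}
    (hf : MvPowerSeries.constantCoeff f = 0) : MvPowerSeries.constantCoeff (conj f) = 0 := by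
  rw [conj, MvPowerSeries.constantCoeff_map, hf, map_zero]

theorem conj_subst {m : ℕ} [NeZero m] (h : NormalizedMap m) (f : MvPowerSeries (Fin 2) ℂ) :
    conj (f.subst ![h.F, h.G]) = (conj f).subst ![conj h.F, conj h.G] := by
  unfold conj
  rw [MvPowerSeries.map_subst
    (MvPowerSeries.hasSubst_of_constantCoeff_zero h.constantCoeff_vec)]
  congr 1
  ext1 i; fin_cases i <;> rfl

/-- Composition of morphisms of Segre families. -/
def SegreFamily.Hom.comp {m : ℕ} [NeZero m] {ε : ℤˣ} {S₁ S₂ S₃ : SegreFamily m ε}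
    (h₁ : SegreFamily.Hom S₁ S₂) (h₂ : SegreFamily.Hom S₂ S₃) : SegreFamily.Hom S₁ S₃ where
  planar := h₂.planar.comp h₁.planar
  param := h₂.param.comp h₁.param
  maps_into := by
    have hX : ∀ i, MvPowerSeries.constantCoeff (MvPowerSeries.X (R := ℂ) (i : Fin 3)) = 0 :=
      MvPowerSeries.constantCoeff_X
    have h12 := constantCoeff_vec_two (hX 1) (hX 2)
    have hv₁ := constantCoeff_vec_two (hX 0) S₁.constantCoeff_definingFunction
    have hv₂ := constantCoeff_vec_two (hX 0) S₂.constantCoeff_definingFunction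
    have hF₁ : MvPowerSeries.constantCoeff
        (h₁.planar.F.subst ![MvPowerSeries.X 0, S₁.definingFunction]) = 0 := by
      rw [constantCoeff_subst_eq hv₁, h₁.planar.F_zero]
    have hF₂ : MvPowerSeries.constantCoeff
        (h₂.planar.F.subst ![MvPowerSeries.X 0, S₂.definingFunction]) = 0 := by
      rw [constantCoeff_subst_eq hv₂, h₂.planar.F_zero]
    have hp : ∀ f : MvPowerSeries (Fin 2) ℂ, MvPowerSeries.constantCoeff f = 0 →
        MvPowerSeries.constantCoeff ((conj f).subst
          ![(MvPowerSeries.X 1 : MvPowerSeries (Fin 3) ℂ), MvPowerSeries.X 2]) = 0 := by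
      intro f hf
      rw [constantCoeff_subst_eq h12, constantCoeff_conj hf]
    have hL := hp _ h₁.param.F_zero
    have hO := hp _ h₁.param.G_zero
    have hc := constantCoeff_vec_three hF₁ hL hO
    have key : ∀ f : MvPowerSeries (Fin 2) ℂ,
        (f.subst ![h₁.planar.F, h₁.planar.G]).subst ![MvPowerSeries.X 0, S₁.definingFunction] =
          (f.subst ![MvPowerSeries.X 0, S₂.definingFunction]).subst
            ![h₁.planar.F.subst ![MvPowerSeries.X 0, S₁.definingFunction],
              (conj h₁.param.F).subst
                ![(MvPowerSeries.X 1 : MvPowerSeries (Fin 3) ℂ), MvPowerSeries.X 2],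
              (conj h₁.param.G).subst
                ![(MvPowerSeries.X 1 : MvPowerSeries (Fin 3) ℂ), MvPowerSeries.X 2]] := by
      intro f
      rw [subst_subst_two h₁.planar.F_zero h₁.planar.G_zero hv₁,
        subst_subst_two (hX 0) S₂.constantCoeff_definingFunction hc, subst_X_eq hc,
        h₁.maps_into]
      rfl
    have key' : ∀ f : MvPowerSeries (Fin 2) ℂ,
        ((conj f).subst ![(MvPowerSeries.X 1 : MvPowerSeries (Fin 3) ℂ), MvPowerSeries.X 2]).subst
            ![h₁.planar.F.subst ![MvPowerSeries.X 0, S₁.definingFunction],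
              (conj h₁.param.F).subst
                ![(MvPowerSeries.X 1 : MvPowerSeries (Fin 3) ℂ), MvPowerSeries.X 2],
              (conj h₁.param.G).subst
                ![(MvPowerSeries.X 1 : MvPowerSeries (Fin 3) ℂ), MvPowerSeries.X 2]] =
          (conj (f.subst ![h₁.param.F, h₁.param.G])).subst
            ![(MvPowerSeries.X 1 : MvPowerSeries (Fin 3) ℂ), MvPowerSeries.X 2] := by
      intro f
      rw [subst_subst_two (hX 1) (hX 2) hc, subst_X_eq hc, subst_X_eq hc, conj_subst,
        subst_subst_two (constantCoeff_conj h₁.param.F_zero)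
          (constantCoeff_conj h₁.param.G_zero) h12]
      rfl
    simp only [NormalizedMap.comp]
    rw [key, key, h₂.maps_into, subst_subst_three hF₂ (hp _ h₂.param.F_zero)
      (hp _ h₂.param.G_zero) hc, key', key']

/-- The identity morphism of a Segre family. -/
def SegreFamily.Hom.id {m : ℕ} {ε : ℤˣ} (S : SegreFamily m ε) : SegreFamily.Hom S S where
  planar := NormalizedMap.id m
  param := NormalizedMap.id m
  maps_into := by
    have hX : ∀ i, MvPowerSeries.constantCoeff (MvPowerSeries.X (R := ℂ) (i : Fin 3)) = 0 :=
      MvPowerSeries.constantCoeff_X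
    have h12 := constantCoeff_vec_two (hX 1) (hX 2)
    have hv := constantCoeff_vec_two (hX 0) S.constantCoeff_definingFunction
    simp only [NormalizedMap.id, conj, MvPowerSeries.map_X]
    rw [subst_X_eq hv, subst_X_eq hv, subst_X_eq h12, subst_X_eq h12]
    have : ![(![MvPowerSeries.X 0, S.definingFunction] : Fin 2 → MvPowerSeries (Fin 3) ℂ) 0,
        ![(MvPowerSeries.X 1 : MvPowerSeries (Fin 3) ℂ), MvPowerSeries.X 2] 0,
        ![(MvPowerSeries.X 1 : MvPowerSeries (Fin 3) ℂ), MvPowerSeries.X 2] 1] =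
        MvPowerSeries.X := by
      ext1 i; fin_cases i <;> rfl
    rw [this, MvPowerSeries.subst_self]; rfl

instance (m : ℕ) [NeZero m] (ε : ℤˣ) : Category (SegreFamily m ε) where
  Hom S₁ S₂ := SegreFamily.Hom S₁ S₂
  id S := SegreFamily.Hom.id S
  comp h₁ h₂ := h₁.comp h₂
  id_comp _ := SegreFamily.Hom.ext (NormalizedMap.comp_id _) (NormalizedMap.comp_id _)
  comp_id _ := SegreFamily.Hom.ext (NormalizedMap.id_comp _) (NormalizedMap.id_comp _)
  assoc _ _ _ := SegreFamily.Hom.ext (NormalizedMap.comp_assoc _ _ _).symm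
    (NormalizedMap.comp_assoc _ _ _).symm

end SegreODE

end

/-! Everything rests on the quotient `ζ = ρ_z / ρ^m`. In the pair `(ρ, ζ)` the singular equation
becomes a regular first-order system, `ρ_z = ρ^m ζ` and `ζ_z = Φ(z, ρ, ζ) - m ρ^(m-1) ζ²`, whose
solutions are determined by their values at `z = 0`. For the defining function of a Segre family
these values are `ρ = τ` and `ζ = i ε χ`, so `χ` and `τ` are, up to the constant `i ε`, arbitrary
initial data: every family of solutions arises from the Segre family by substituting `χ = -i ε ζ(0,
t)`, `τ = ρ(0, t)` (`SegreFamily.eq_subst_of_isSystemSolution`).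

Objects. The map `(z, χ, τ) ↦ (z, ρ, ζ)` has an invertible linear part, and being a solution
prescribes `Φ` along it; so `Φ` exists and is unique, and it is `O(ζ²)` because the coefficient of
`χ` in `ζ` does not depend on `z` (`SegreFamily.exists_ode`). Conversely the system is solved with
the above initial values, with the phase `φ` as unknown in place of `ρ`, and `Φ = O(ζ²)` forces `φ -
ε z χ` to be divisible by `z² χ²` (`SingularODE.exists_segre`). Uniqueness is that of the initial
value problem.

Morphisms. A morphism of Segre families sends the member with parameters `(a, b)` to the one with
parameters `(Λ̄(a, b), Ω̄(a, b))`, and all solutions are such members, so `(F, G)` is a morphism of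
equations. Conversely, a morphism of equations is applied to the universal family `ρ₁(z, χ, τ)`; the
initial values of the image family give `Λ̄` and `Ω̄`, which have to be shown normalized
(`NormalizedMap.coeff_param_fst`, `NormalizedMap.isNormalizedSnd_param_snd`). Restricting the
mapping identity to the zero set of `F` along the family shows that `(F, G)` determines `(Λ, Ω)`, so
identities between morphisms need only be checked on `(F, G)`.

Convergence. Inverses and solutions are fixed points of operators that raise the order of
differences. Where such an operator preserves a ball for a weighted `ℓ¹` norm, the fixed point lies
in that ball, so existence and convergence come from one argument (`exists_fixedPoint`). -/

noncomputable section

set_option linter.unusedSectionVars false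

namespace SegreODE

open MvPowerSeries Filter Topology
open scoped ENNReal

/-! ### Weighted `ℓ¹` norms and the permanence properties of convergent series. -/

section Norm

variable {σ τ : Type*} [Fintype σ] [Fintype τ]

/-- The weighted `ℓ¹` norm of a power series on the polydisc with radii `s`. -/
def wnorm (s : σ → ℝ≥0∞) (f : MvPowerSeries σ ℂ) : ℝ≥0∞ :=
  ∑' d : σ →₀ ℕ, ‖coeff d f‖ₑ * ∏ i, s i ^ d i

theorem wnorm_mono {s t : σ → ℝ≥0∞} (h : ∀ i, s i ≤ t i) (f : MvPowerSeries σ ℂ) :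
    wnorm s f ≤ wnorm t f :=
  ENNReal.tsum_le_tsum fun _ =>
    mul_le_mul_right (Finset.prod_le_prod' fun i _ => pow_le_pow_left' (h i) _) _

theorem wnorm_add_le (s : σ → ℝ≥0∞) (f g : MvPowerSeries σ ℂ) :
    wnorm s (f + g) ≤ wnorm s f + wnorm s g := by
  rw [wnorm, wnorm, wnorm, ← ENNReal.tsum_add]
  refine ENNReal.tsum_le_tsum fun d => ?_
  rw [← add_mul, map_add]
  exact mul_le_mul_left (enorm_add_le _ _) _

theorem wnorm_neg (s : σ → ℝ≥0∞) (f : MvPowerSeries σ ℂ) : wnorm s (-f) = wnorm s f := by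
  simp [wnorm]

theorem wnorm_sub_le (s : σ → ℝ≥0∞) (f g : MvPowerSeries σ ℂ) :
    wnorm s (f - g) ≤ wnorm s f + wnorm s g := by
  rw [sub_eq_add_neg, ← wnorm_neg s g]
  exact wnorm_add_le s f (-g)

theorem wnorm_monomial (s : σ → ℝ≥0∞) (e : σ →₀ ℕ) (a : ℂ) :
    wnorm s (monomial e a) = ‖a‖ₑ * ∏ i, s i ^ e i := by
  classical
  rw [wnorm, tsum_eq_single e]
  · simp
  · intro d hd
    rw [coeff_monomial_ne hd]
    simp

theorem wnorm_C (s : σ → ℝ≥0∞) (a : ℂ) : wnorm s (C a) = ‖a‖ₑ := by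
  have := wnorm_monomial s 0 a
  rw [monomial_zero_eq_C_apply] at this
  simpa using this

theorem wnorm_one (s : σ → ℝ≥0∞) : wnorm s 1 = 1 := by
  have := wnorm_C s 1
  simpa using this

theorem wnorm_X (s : σ → ℝ≥0∞) (i : σ) : wnorm s (X i) = s i := by
  classical
  rw [X, wnorm_monomial, Finset.prod_eq_single i]
  · simp
  · intro j _ hj
    simp [Finsupp.single_eq_of_ne hj]
  · simp

/-- Triangle inequality in each coefficient of the Cauchy product; with values in `ℝ≥0∞` the double
sum may be regrouped along antidiagonals without any summability condition. -/
theorem wnorm_mul_le (s : σ → ℝ≥0∞) (f g : MvPowerSeries σ ℂ) :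
    wnorm s (f * g) ≤ wnorm s f * wnorm s g := by
  classical
  let F : (σ →₀ ℕ) → ℝ≥0∞ := fun d => ‖coeff d f‖ₑ * ∏ i, s i ^ d i
  let G : (σ →₀ ℕ) → ℝ≥0∞ := fun d => ‖coeff d g‖ₑ * ∏ i, s i ^ d i
  have h1 : wnorm s f * wnorm s g = ∑' p : (σ →₀ ℕ) × (σ →₀ ℕ), F p.1 * G p.2 := by
    rw [ENNReal.tsum_prod (f := fun a b => F a * G b)]
    simp_rw [ENNReal.tsum_mul_left, ENNReal.tsum_mul_right]
    rfl
  rw [h1, ← (Finset.HasAntidiagonal.sigmaAntidiagonalEquivProd (A := σ →₀ ℕ)).tsum_eq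
    (fun p : (σ →₀ ℕ) × (σ →₀ ℕ) => F p.1 * G p.2), ENNReal.tsum_sigma']
  refine ENNReal.tsum_le_tsum fun d => ?_
  simp only [Finset.HasAntidiagonal.sigmaAntidiagonalEquivProd_apply]
  rw [Finset.tsum_subtype (Finset.HasAntidiagonal.antidiagonal d) (fun p => F p.1 * G p.2),
    coeff_mul]
  refine (mul_le_mul_left (enorm_sum_le _ _) _).trans ?_
  rw [Finset.sum_mul]
  refine Finset.sum_le_sum fun p hp => ?_
  rw [Finset.HasAntidiagonal.mem_antidiagonal] at hp
  rw [enorm_mul, ← hp]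
  simp only [F, G, Finsupp.add_apply, pow_add, Finset.prod_mul_distrib]
  exact le_of_eq (by ring)

theorem wnorm_pow_le (s : σ → ℝ≥0∞) (f : MvPowerSeries σ ℂ) (n : ℕ) :
    wnorm s (f ^ n) ≤ wnorm s f ^ n := by
  induction n with
  | zero => simp [wnorm_one]
  | succ n ih =>
    rw [pow_succ, pow_succ]
    exact (wnorm_mul_le _ _ _).trans (mul_le_mul_left ih _)

theorem wnorm_prod_le {ι : Type*} (s : σ → ℝ≥0∞) (f : ι → MvPowerSeries σ ℂ) (t : Finset ι) :
    wnorm s (∏ i ∈ t, f i) ≤ ∏ i ∈ t, wnorm s (f i) := by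
  classical
  induction t using Finset.induction_on with
  | empty => simp [wnorm_one]
  | insert a t ha ih =>
    rw [Finset.prod_insert ha, Finset.prod_insert ha]
    exact (wnorm_mul_le _ _ _).trans (mul_le_mul_right ih _)

/-- The majorant principle: expand `f(a)` into monomials in the `a i`, exchange the two sums and use
submultiplicativity. All later estimates of compositions come from it, with the norms of the inner
series playing the role of radii. -/
theorem wnorm_subst_le (s : τ → ℝ≥0∞) {a : σ → MvPowerSeries τ ℂ} (ha : HasSubst a)
    (f : MvPowerSeries σ ℂ) : wnorm s (f.subst a) ≤ wnorm (fun i => wnorm s (a i)) f := by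
  have h1 : ∀ e : τ →₀ ℕ, ‖coeff e (f.subst a)‖ₑ ≤
      ∑' d : σ →₀ ℕ, ‖coeff d f‖ₑ * ‖coeff e (∏ i, a i ^ d i)‖ₑ := by
    intro e
    have hfin := coeff_subst_finite ha f e
    rw [coeff_subst ha, finsum_eq_sum_of_support_subset _
      (s := (show (Function.support _).Finite from hfin).toFinset) (by simp)]
    refine (enorm_sum_le _ _).trans ?_
    refine le_trans (Finset.sum_le_sum fun d _ => ?_) (ENNReal.sum_le_tsum _)
    rw [smul_eq_mul, enorm_mul, Finsupp.prod_fintype _ _ (by simp)]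
  calc wnorm s (f.subst a)
      ≤ ∑' e : τ →₀ ℕ, (∑' d : σ →₀ ℕ, ‖coeff d f‖ₑ * ‖coeff e (∏ i, a i ^ d i)‖ₑ)
          * ∏ i, s i ^ e i := ENNReal.tsum_le_tsum fun e => mul_le_mul_left (h1 e) _
    _ = ∑' d : σ →₀ ℕ, ‖coeff d f‖ₑ * wnorm s (∏ i, a i ^ d i) := by
      simp_rw [← ENNReal.tsum_mul_right]
      rw [ENNReal.tsum_comm]
      simp_rw [wnorm, ← ENNReal.tsum_mul_left, mul_assoc]
    _ ≤ _ := ENNReal.tsum_le_tsum fun d => by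
      refine mul_le_mul_right ((wnorm_prod_le _ _ _).trans ?_) _
      exact Finset.prod_le_prod' fun i _ => wnorm_pow_le _ _ _

/-- Shrinking the radius by `l` multiplies a term of degree `n` by `l ^ n`, and only degrees `n ≥ k`
occur. This is the source of all smallness. -/
theorem wnorm_smul_le_of_le_order {l s : ℝ≥0∞} (hl : l ≤ 1) {f : MvPowerSeries σ ℂ} {k : ℕ}
    (hk : (k : ℕ∞) ≤ f.order) :
    wnorm (fun _ => l * s) f ≤ l ^ k * wnorm (fun _ => s) f := by
  rw [wnorm, wnorm, ← ENNReal.tsum_mul_left]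
  refine ENNReal.tsum_le_tsum fun d => ?_
  by_cases hd : coeff d f = 0
  · simp [hd]
  have hkd : k ≤ d.degree := by
    by_contra h
    exact hd (coeff_of_lt_order (lt_of_lt_of_le (by exact_mod_cast not_le.1 h) hk))
  have e : ∀ r : ℝ≥0∞, ∏ i, r ^ d i = r ^ d.degree := by
    intro r
    rw [Finset.prod_pow_eq_pow_sum, Finsupp.degree_eq_sum]
  rw [e, e, mul_pow]
  calc _ = l ^ d.degree * (‖coeff d f‖ₑ * s ^ d.degree) := by ring
    _ ≤ _ := mul_le_mul_left (pow_le_pow_right_of_le_one' hl hkd) _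

/-- Convergence of a power series on some polydisc of positive radius. -/
def IsConv (f : MvPowerSeries σ ℂ) : Prop :=
  ∀ᶠ t : ℝ≥0∞ in 𝓝[>] 0, wnorm (fun _ => t) f ≠ ∞

theorem isConv_of_wnorm {f : MvPowerSeries σ ℂ} {s : ℝ≥0∞} (hs : s ≠ 0)
    (h : wnorm (fun _ => s) f ≠ ∞) : IsConv f := by
  filter_upwards [Ioo_mem_nhdsGT (pos_iff_ne_zero.2 hs)] with t ht
  exact ne_top_of_le_ne_top h (wnorm_mono (fun _ => ht.2.le) f)

theorem IsConv.exists_radius {f : MvPowerSeries σ ℂ} (hf : IsConv f) :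
    ∃ s : ℝ≥0∞, s ≠ 0 ∧ s ≠ ∞ ∧ wnorm (fun _ => s) f ≠ ∞ := by
  obtain ⟨s, h1, h2, h3⟩ := (hf.and (Ioo_mem_nhdsGT (show (0 : ℝ≥0∞) < 1 by simp))).exists
  exact ⟨s, h2.ne', (h3.trans ENNReal.one_lt_top).ne, h1⟩

/-- The norm is monotone in the radius, so one good radius yields all smaller ones; the "eventually"
form of `IsConv` lets several series share a radius. -/
theorem isConvergent_iff_isConv {n : ℕ} (f : MvPowerSeries (Fin n) ℂ) :
    IsConvergent f ↔ IsConv f := by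
  have key : ∀ r : ℝ, 0 ≤ r → (wnorm (fun _ => ENNReal.ofReal r) f ≠ ∞ ↔
      Summable fun d : Fin n →₀ ℕ => ‖coeff d f‖ * ∏ i, r ^ d i) := by
    intro r hr
    have : wnorm (fun _ => ENNReal.ofReal r) f =
        ∑' d : Fin n →₀ ℕ, ENNReal.ofReal (‖coeff d f‖ * ∏ i, r ^ d i) := by
      refine tsum_congr fun d => ?_
      rw [ENNReal.ofReal_mul (norm_nonneg _), ofReal_norm,
        ENNReal.ofReal_prod_of_nonneg fun i _ => pow_nonneg hr _]
      simp_rw [ENNReal.ofReal_pow hr]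
    rw [this]
    constructor
    · intro h
      have := ENNReal.summable_toReal h
      refine this.congr fun d => ?_
      rw [ENNReal.toReal_ofReal (by positivity)]
    · intro h
      exact h.tsum_ofReal_ne_top
  constructor
  · rintro ⟨r, hr, h⟩
    exact isConv_of_wnorm (by simpa using hr) ((key r hr.le).2 h)
  · intro h
    obtain ⟨s, h1, h2, h3⟩ := h.exists_radius
    refine ⟨s.toReal, ENNReal.toReal_pos h1 h2, (key _ ENNReal.toReal_nonneg).1 ?_⟩
    rwa [ENNReal.ofReal_toReal h2]

theorem tendsto_div_nhdsGT {s : ℝ≥0∞} (hs : s ≠ 0) :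
    Tendsto (fun t : ℝ≥0∞ => t / s) (𝓝[>] 0) (𝓝 0) := by
  have := ENNReal.Tendsto.div_const (b := s) (tendsto_id (α := ℝ≥0∞) (x := 𝓝 0)) (Or.inr hs)
  rw [ENNReal.zero_div] at this
  exact this.mono_left nhdsWithin_le_nhds

theorem IsConv.eventually_wnorm_le {f : MvPowerSeries σ ℂ} (hf : IsConv f)
    (h0 : constantCoeff f = 0) {δ : ℝ≥0∞} (hδ : δ ≠ 0) :
    ∀ᶠ t : ℝ≥0∞ in 𝓝[>] 0, wnorm (fun _ => t) f ≤ δ := by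
  obtain ⟨s, h1, h2, h3⟩ := hf.exists_radius
  have ht := tendsto_div_nhdsGT h1
  have ht' := ENNReal.Tendsto.mul_const (b := wnorm (fun _ => s) f) ht (Or.inr h3)
  rw [zero_mul] at ht'
  filter_upwards [ht'.eventually_lt_const (pos_iff_ne_zero.2 hδ),
    ht.eventually_lt_const one_pos] with t h4 h5
  have h6 := wnorm_smul_le_of_le_order (s := s) h5.le
    (show ((1 : ℕ) : ℕ∞) ≤ f.order by exact_mod_cast one_le_order_iff_constCoeff_eq_zero.2 h0)
  rw [ENNReal.div_mul_cancel h1 h2, pow_one] at h6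
  exact h6.trans h4.le

/-- A series of order two has norm `O(t²)`, hence below any fixed multiple of `t`. This is the
contraction estimate for inverting maps tangent to the identity. -/
theorem IsConv.eventually_wnorm_le_mul {f : MvPowerSeries σ ℂ} (hf : IsConv f)
    (h0 : 2 ≤ f.order) {c : ℝ≥0∞} (hc : c ≠ 0) :
    ∀ᶠ t : ℝ≥0∞ in 𝓝[>] 0, wnorm (fun _ => t) f ≤ c * t := by
  obtain ⟨s, h1, h2, h3⟩ := hf.exists_radius
  have ht := tendsto_div_nhdsGT h1
  have ht' := ENNReal.Tendsto.mul_const (b := wnorm (fun _ => s) f / s) ht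
    (Or.inr (ENNReal.div_ne_top h3 h1))
  rw [zero_mul] at ht'
  filter_upwards [ht'.eventually_lt_const (pos_iff_ne_zero.2 hc),
    ht.eventually_lt_const one_pos] with t h4 h5
  have h6 := wnorm_smul_le_of_le_order (s := s) h5.le
    (show ((2 : ℕ) : ℕ∞) ≤ f.order by exact_mod_cast h0)
  rw [ENNReal.div_mul_cancel h1 h2] at h6
  refine h6.trans ?_
  calc (t / s) ^ 2 * wnorm (fun _ => s) f
      = (t / s * (wnorm (fun _ => s) f / s)) * t := by
        simp only [div_eq_mul_inv]; ring
    _ ≤ c * t := mul_le_mul_left h4.le _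

theorem isConv_monomial (e : σ →₀ ℕ) (a : ℂ) : IsConv (monomial e a) :=
  isConv_of_wnorm one_ne_zero (by rw [wnorm_monomial]; simp)

theorem isConv_C (a : ℂ) : IsConv (C a : MvPowerSeries σ ℂ) :=
  isConv_monomial 0 a

theorem isConv_X (i : σ) : IsConv (X i : MvPowerSeries σ ℂ) := isConv_monomial _ _

theorem isConv_zero : IsConv (0 : MvPowerSeries σ ℂ) := by simpa using isConv_C (σ := σ) 0

theorem isConv_one : IsConv (1 : MvPowerSeries σ ℂ) := by simpa using isConv_C (σ := σ) 1

theorem IsConv.add {f g : MvPowerSeries σ ℂ} (hf : IsConv f) (hg : IsConv g) : IsConv (f + g) := by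
  filter_upwards [hf, hg] with t h1 h2
  exact ne_top_of_le_ne_top (ENNReal.add_ne_top.2 ⟨h1, h2⟩) (wnorm_add_le _ _ _)

theorem IsConv.neg {f : MvPowerSeries σ ℂ} (hf : IsConv f) : IsConv (-f) := by
  filter_upwards [hf] with t h1
  rwa [wnorm_neg]

theorem IsConv.sub {f g : MvPowerSeries σ ℂ} (hf : IsConv f) (hg : IsConv g) : IsConv (f - g) := by
  rw [sub_eq_add_neg]; exact hf.add hg.neg

theorem IsConv.mul {f g : MvPowerSeries σ ℂ} (hf : IsConv f) (hg : IsConv g) : IsConv (f * g) := by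
  filter_upwards [hf, hg] with t h1 h2
  exact ne_top_of_le_ne_top (ENNReal.mul_ne_top h1 h2) (wnorm_mul_le _ _ _)

theorem IsConv.pow {f : MvPowerSeries σ ℂ} (hf : IsConv f) (n : ℕ) : IsConv (f ^ n) := by
  filter_upwards [hf] with t h1
  exact ne_top_of_le_ne_top (ENNReal.pow_ne_top h1) (wnorm_pow_le _ _ _)

theorem IsConv.subst {f : MvPowerSeries σ ℂ} (hf : IsConv f) {a : σ → MvPowerSeries τ ℂ}
    (h0 : ∀ i, constantCoeff (a i) = 0) (ha : ∀ i, IsConv (a i)) : IsConv (f.subst a) := by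
  obtain ⟨s, h1, h2, h3⟩ := hf.exists_radius
  have := eventually_all.2 fun i => (ha i).eventually_wnorm_le (h0 i) h1
  filter_upwards [this] with t ht
  exact ne_top_of_le_ne_top h3
    ((wnorm_subst_le _ (hasSubst_of_constantCoeff_zero h0) f).trans (wnorm_mono ht f))

/-- Dividing a convergent series by a monomial (shifting its coefficients). -/
theorem IsConv.of_monomial_mul {f : MvPowerSeries σ ℂ} {e : σ →₀ ℕ}
    (hf : IsConv (monomial e 1 * f)) : IsConv f := by
  obtain ⟨s, h1, h2, h3⟩ := hf.exists_radius
  refine isConv_of_wnorm h1 ?_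
  have h4 : wnorm (fun _ => s) f * (∏ i, s ^ e i) ≤ wnorm (fun _ => s) (monomial e 1 * f) := by
    rw [wnorm, wnorm, ← ENNReal.tsum_mul_right]
    have := ENNReal.tsum_comp_le_tsum_of_injective (add_right_injective e)
      (fun d : σ →₀ ℕ => ‖coeff d (monomial e 1 * f)‖ₑ * ∏ i, s ^ d i)
    refine le_trans (ENNReal.tsum_le_tsum fun d => ?_) this
    rw [coeff_add_monomial_mul, one_mul]
    simp only [Finsupp.add_apply, pow_add, Finset.prod_mul_distrib]
    exact le_of_eq (by ring)
  have h5 : (∏ i, s ^ e i) ≠ 0 := by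
    rw [Finset.prod_ne_zero_iff]
    exact fun i _ => pow_ne_zero _ h1
  intro h
  rw [h, ENNReal.top_mul h5, top_le_iff] at h4
  exact h3 h4

theorem IsConv.of_X_pow_mul {f : MvPowerSeries σ ℂ} {i : σ} {n : ℕ}
    (hf : IsConv (X i ^ n * f)) : IsConv f := by
  rw [X_pow_eq] at hf
  exact hf.of_monomial_mul

/-- Halving the radius gains `2 ^ (-degree)`, which absorbs the factor `d i + 1 ≤ 2 ^ degree`
produced by differentiation. -/
theorem IsConv.pderiv {f : MvPowerSeries σ ℂ} (hf : IsConv f) (i : σ) :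
    IsConv (pderiv ℂ i f) := by
  obtain ⟨s, h1, h2, h3⟩ := hf.exists_radius
  have hs2 : s / 2 ≠ 0 := by simp [h1]
  refine isConv_of_wnorm hs2 ?_
  have h4 : wnorm (fun _ => s / 2) (MvPowerSeries.pderiv ℂ i f) * s ≤ wnorm (fun _ => s) f := by
    rw [wnorm, wnorm, ← ENNReal.tsum_mul_right]
    have := ENNReal.tsum_comp_le_tsum_of_injective
      (add_left_injective (Finsupp.single i 1 : σ →₀ ℕ))
      (fun d : σ →₀ ℕ => ‖coeff d f‖ₑ * ∏ i, s ^ d i)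
    refine le_trans (ENNReal.tsum_le_tsum fun d => ?_) this
    classical
    have e : ∀ (r : ℝ≥0∞) (d : σ →₀ ℕ), ∏ i, r ^ d i = r ^ d.degree := by
      intro r d
      rw [Finset.prod_pow_eq_pow_sum, Finsupp.degree_eq_sum]
    rw [coeff_pderiv, enorm_mul, e, e, map_add, Finsupp.degree_single, pow_succ, ← mul_assoc]
    refine mul_le_mul_left ?_ _
    rw [mul_assoc]
    refine mul_le_mul_right ?_ _
    have h5 : ‖((d i : ℂ) + 1)‖ₑ ≤ 2 ^ d.degree := by
      have : ((d i : ℂ) + 1) = ((d i + 1 : ℕ) : ℂ) := by push_cast; rfl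
      rw [this, ← ofReal_norm, Complex.norm_natCast, ENNReal.ofReal_natCast]
      have h6 : d i + 1 ≤ 2 ^ d.degree :=
        (Nat.lt_two_pow_self).trans_le
          (Nat.pow_le_pow_right (by norm_num) (Finsupp.le_degree i d))
      exact_mod_cast h6
    calc _ ≤ 2 ^ d.degree * (s / 2) ^ d.degree := mul_le_mul_left h5 _
      _ = s ^ d.degree := by
        rw [← mul_pow, ENNReal.mul_div_cancel (by norm_num) (by norm_num)]
  intro h
  rw [h, ENNReal.top_mul h1, top_le_iff] at h4
  exact h3 h4

theorem isConv_conj_iff {n : ℕ} {f : MvPowerSeries (Fin n) ℂ} : IsConv (conj f) ↔ IsConv f := by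
  have : ∀ t, wnorm t (conj f) = wnorm t f := by
    intro t
    refine tsum_congr fun d => ?_
    rw [conj, coeff_map]
    simp [← ofReal_norm]
  simp [IsConv, this]

theorem isConv_exp : IsConv (PowerSeries.exp ℂ : MvPowerSeries Unit ℂ) := by
  refine isConv_of_wnorm one_ne_zero ?_
  rw [wnorm, ← (Finsupp.uniqueEquiv (M := ℕ) ()).symm.tsum_eq]
  have : Summable fun n : ℕ => (1 : ℝ) ^ n / (n.factorial : ℝ) := Real.summable_pow_div_factorial 1
  refine ne_of_eq_of_ne (tsum_congr fun n => ?_) this.tsum_ofReal_ne_top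
  have e : coeff ((Finsupp.uniqueEquiv (M := ℕ) ()).symm n) (PowerSeries.exp ℂ) =
      PowerSeries.coeff n (PowerSeries.exp ℂ) := by
    rw [PowerSeries.coeff]
    congr 2
  rw [e, PowerSeries.coeff_exp, ← ofReal_norm]
  simp

theorem isConv_geom : IsConv (PowerSeries.mk 1 : MvPowerSeries Unit ℂ) := by
  refine isConv_of_wnorm (s := ENNReal.ofReal (1 / 2)) (by simp) ?_
  rw [wnorm, ← (Finsupp.uniqueEquiv (M := ℕ) ()).symm.tsum_eq]
  have : Summable fun n : ℕ => ((1 : ℝ) / 2) ^ n := summable_geometric_two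
  refine ne_of_eq_of_ne (tsum_congr fun n => ?_) this.tsum_ofReal_ne_top
  have e : coeff ((Finsupp.uniqueEquiv (M := ℕ) ()).symm n) (PowerSeries.mk 1 : PowerSeries ℂ) =
      PowerSeries.coeff n (PowerSeries.mk 1) := by
    rw [PowerSeries.coeff]
    congr 2
  rw [e, PowerSeries.coeff_mk, ENNReal.ofReal_pow (by norm_num)]
  simp

/-- After normalizing the constant term to one, the inverse is the geometric series evaluated at a
series without constant term. -/
theorem IsConv.inv {f : MvPowerSeries σ ℂ} (hf : IsConv f) (h0 : constantCoeff f ≠ 0) :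
    IsConv f⁻¹ := by
  let g : MvPowerSeries σ ℂ := 1 - C (constantCoeff f)⁻¹ * f
  have hg0 : constantCoeff g = 0 := by simp [g, h0]
  have hg : IsConv g := isConv_one.sub ((isConv_C _).mul hf)
  have hs := PowerSeries.HasSubst.of_constantCoeff_zero hg0
  have h1 : IsConv ((PowerSeries.mk 1 : PowerSeries ℂ).subst g) :=
    isConv_geom.subst (fun _ => hg0) fun _ => hg
  have h2 : (PowerSeries.mk 1 : PowerSeries ℂ).subst g * (1 - g) = 1 := by
    have := congrArg (PowerSeries.subst g) (PowerSeries.mk_one_mul_one_sub_eq_one ℂ)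
    rw [PowerSeries.subst_mul hs, ← PowerSeries.coe_substAlgHom hs, map_sub, map_one,
      PowerSeries.substAlgHom_X] at this
    rwa [PowerSeries.coe_substAlgHom hs] at this
  have h3 : f⁻¹ = (PowerSeries.mk 1 : PowerSeries ℂ).subst g * C (constantCoeff f)⁻¹ := by
    rw [MvPowerSeries.inv_eq_iff_mul_eq_one h0]
    rw [← h2]
    simp only [g]
    ring
  rw [h3]
  exact h1.mul (isConv_C _)

end Norm

end SegreODE

namespace SegreODE

open MvPowerSeries Filter Topology
open scoped ENNReal

/-! ### Formal calculus: orders, chain rule, fixed points, differential equations and inverse maps.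
-/

section Formal

variable {σ τ ι : Type*} [Fintype σ] [Fintype τ]

theorem nat_le_order_iff {f : MvPowerSeries σ ℂ} {k : ℕ} :
    (k : ℕ∞) ≤ f.order ↔ ∀ d : σ →₀ ℕ, d.degree < k → coeff d f = 0 :=
  ⟨fun h _ hd => coeff_of_lt_order (lt_of_lt_of_le (by exact_mod_cast hd) h), nat_le_order⟩

theorem eq_of_forall_le_order {f g : MvPowerSeries σ ℂ} (h : ∀ k : ℕ, (k : ℕ∞) ≤ (f - g).order) :
    f = g := by
  ext d
  have := nat_le_order_iff.1 (h (d.degree + 1)) d (Nat.lt_succ_self _)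
  rwa [map_sub, sub_eq_zero] at this

theorem nat_le_order_add {f g : MvPowerSeries σ ℂ} {k : ℕ} (hf : (k : ℕ∞) ≤ f.order)
    (hg : (k : ℕ∞) ≤ g.order) : (k : ℕ∞) ≤ (f + g).order :=
  (le_min hf hg).trans min_order_le_add

theorem nat_le_order_sub {f g : MvPowerSeries σ ℂ} {k : ℕ} (hf : (k : ℕ∞) ≤ f.order)
    (hg : (k : ℕ∞) ≤ g.order) : (k : ℕ∞) ≤ (f - g).order := by
  rw [sub_eq_add_neg]
  exact nat_le_order_add hf (by rwa [order_neg])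

theorem nat_le_order_mul {f g : MvPowerSeries σ ℂ} {k l n : ℕ} (hf : (k : ℕ∞) ≤ f.order)
    (hg : (l : ℕ∞) ≤ g.order) (hn : n ≤ k + l) : (n : ℕ∞) ≤ (f * g).order :=
  le_trans (by exact_mod_cast hn) ((add_le_add hf hg).trans le_order_mul)

theorem one_le_order {f : MvPowerSeries σ ℂ} (h : constantCoeff f = 0) :
    ((1 : ℕ) : ℕ∞) ≤ f.order := by
  exact_mod_cast one_le_order_iff_constCoeff_eq_zero.2 h

theorem nat_le_order_subst {f : MvPowerSeries σ ℂ} {k : ℕ} (hf : (k : ℕ∞) ≤ f.order)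
    {a : σ → MvPowerSeries τ ℂ} (ha : ∀ i, constantCoeff (a i) = 0) :
    (k : ℕ∞) ≤ (f.subst a).order := by
  refine hf.trans (le_trans ?_ (le_order_subst (hasSubst_of_constantCoeff_zero ha) f))
  refine le_mul_of_one_le_left' (le_iInf fun i => ?_)
  exact one_le_order_iff_constCoeff_eq_zero.2 (ha i)

theorem nat_le_order_pderiv {f : MvPowerSeries σ ℂ} {k : ℕ} (hf : ((k + 1 : ℕ) : ℕ∞) ≤ f.order)
    (i : σ) : (k : ℕ∞) ≤ (pderiv ℂ i f).order := by
  rw [nat_le_order_iff] at hf ⊢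
  intro d hd
  rw [coeff_pderiv, hf _ (by rw [map_add, Finsupp.degree_single]; omega), zero_mul]

theorem exists_eq_add_single {d : σ →₀ ℕ} (h : d ≠ 0) : ∃ e i, d = e + Finsupp.single i 1 := by
  obtain ⟨i, hi⟩ := Finsupp.ne_iff.1 h
  refine ⟨d - Finsupp.single i 1, i, ?_⟩
  rw [tsub_add_cancel_of_le]
  rw [Finsupp.single_le_iff]
  exact Nat.one_le_iff_ne_zero.2 hi

theorem prod_pow_add_single (a : σ → MvPowerSeries τ ℂ) (e : σ →₀ ℕ) (i : σ) :
    ∏ j, a j ^ (e + Finsupp.single i 1 : σ →₀ ℕ) j = (∏ j, a j ^ e j) * a i := by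
  classical
  simp only [Finsupp.add_apply, pow_add, Finset.prod_mul_distrib]
  congr 1
  rw [Finset.prod_eq_single i]
  · simp
  · intro j _ hj
    simp [Finsupp.single_eq_of_ne hj]
  · simp

theorem degree_le_order_prod {a : σ → MvPowerSeries τ ℂ} (ha : ∀ i, constantCoeff (a i) = 0)
    (n : ℕ) (d : σ →₀ ℕ) (hd : d.degree = n) : (n : ℕ∞) ≤ (∏ i, a i ^ d i).order := by
  induction n generalizing d with
  | zero => simp
  | succ n ih =>
    obtain ⟨e, i, rfl⟩ := exists_eq_add_single (d := d) (by rintro rfl; simp at hd)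
    rw [map_add, Finsupp.degree_single] at hd
    rw [prod_pow_add_single]
    exact nat_le_order_mul (ih e (by omega)) (one_le_order (ha i)) le_rfl

/-- Telescoping: one factor of each summand is a difference of order at least `k`, and the remaining
`n` factors have order at least one. -/
theorem le_order_prod_sub {a b : σ → MvPowerSeries τ ℂ} (ha : ∀ i, constantCoeff (a i) = 0)
    (hb : ∀ i, constantCoeff (b i) = 0) {k : ℕ} (hab : ∀ i, (k : ℕ∞) ≤ (a i - b i).order)
    (n : ℕ) (d : σ →₀ ℕ) (hd : d.degree = n + 1) :
    ((k + n : ℕ) : ℕ∞) ≤ (∏ i, a i ^ d i - ∏ i, b i ^ d i).order := by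
  induction n generalizing d with
  | zero =>
    obtain ⟨e, i, rfl⟩ := exists_eq_add_single (d := d) (by rintro rfl; simp at hd)
    rw [map_add, Finsupp.degree_single] at hd
    have he : e = 0 := by rw [← Finsupp.degree_eq_zero_iff]; omega
    rw [prod_pow_add_single, prod_pow_add_single, he]
    simpa using hab i
  | succ n ih =>
    obtain ⟨e, i, rfl⟩ := exists_eq_add_single (d := d) (by rintro rfl; simp at hd)
    rw [map_add, Finsupp.degree_single] at hd
    rw [prod_pow_add_single, prod_pow_add_single]
    have : (∏ j, a j ^ e j) * a i - (∏ j, b j ^ e j) * b i =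
        (∏ j, a j ^ e j - ∏ j, b j ^ e j) * a i + (∏ j, b j ^ e j) * (a i - b i) := by ring
    rw [this]
    refine nat_le_order_add ?_ ?_
    · exact nat_le_order_mul (ih e (by omega)) (one_le_order (ha i)) (by omega)
    · exact nat_le_order_mul (degree_le_order_prod hb (n + 1) e (by omega)) (hab i) (by omega)

/-- Substitution of congruent series; the congruence improves when `f` has no linear terms. -/
theorem le_order_subst_sub {a b : σ → MvPowerSeries τ ℂ} (ha : ∀ i, constantCoeff (a i) = 0)
    (hb : ∀ i, constantCoeff (b i) = 0) {k : ℕ} (hab : ∀ i, (k : ℕ∞) ≤ (a i - b i).order)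
    {f : MvPowerSeries σ ℂ} {q : ℕ} (hf : ∀ d : σ →₀ ℕ, coeff d f ≠ 0 → d = 0 ∨ q + 1 ≤ d.degree) :
    ((k + q : ℕ) : ℕ∞) ≤ (f.subst a - f.subst b).order := by
  rw [nat_le_order_iff]
  intro e he
  rw [map_sub, coeff_subst (hasSubst_of_constantCoeff_zero ha),
    coeff_subst (hasSubst_of_constantCoeff_zero hb), sub_eq_zero]
  refine finsum_congr fun d => ?_
  by_cases h0 : coeff d f = 0
  · simp [h0]
  rw [Finsupp.prod_fintype _ _ (by simp), Finsupp.prod_fintype _ _ (by simp)]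
  rcases hf d h0 with rfl | hd
  · simp
  · have h := le_order_prod_sub ha hb hab (d.degree - 1) d (by omega)
    have := nat_le_order_iff.1 h e (by omega)
    rw [map_sub, sub_eq_zero] at this
    rw [this]

theorem le_order_subst_sub' {a b : σ → MvPowerSeries τ ℂ} (ha : ∀ i, constantCoeff (a i) = 0)
    (hb : ∀ i, constantCoeff (b i) = 0) {k : ℕ} (hab : ∀ i, (k : ℕ∞) ≤ (a i - b i).order)
    (f : MvPowerSeries σ ℂ) : (k : ℕ∞) ≤ (f.subst a - f.subst b).order := by
  refine le_order_subst_sub (q := 0) ha hb hab fun d _ => ?_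
  by_cases h : d = 0
  · exact Or.inl h
  · right
    rw [← Finsupp.degree_eq_zero_iff] at h
    omega

/-- The chain rule for formal power series. -/
theorem pderiv_subst {a : σ → MvPowerSeries τ ℂ} (ha : ∀ i, constantCoeff (a i) = 0) (j : τ)
    (f : MvPowerSeries σ ℂ) :
    pderiv ℂ j (f.subst a) = ∑ i, (pderiv ℂ i f).subst a * pderiv ℂ j (a i) := by
  classical
  have hs := hasSubst_of_constantCoeff_zero ha
  -- For polynomials the rule follows by induction from the Leibniz rule. A general series is
  -- handled modulo order `k` by truncation.
  have hpoly : ∀ p : MvPolynomial σ ℂ, pderiv ℂ j ((p : MvPowerSeries σ ℂ).subst a) =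
      ∑ i, (pderiv ℂ i (p : MvPowerSeries σ ℂ)).subst a * pderiv ℂ j (a i) := by
    intro p
    induction p using MvPolynomial.induction_on with
    | C c =>
      have h0 : (0 : MvPowerSeries σ ℂ).subst a = 0 := by rw [← coe_substAlgHom hs, map_zero]
      simp only [MvPolynomial.coe_C, subst_C, pderiv_C, h0, zero_mul, Finset.sum_const_zero]
    | add p q hp hq =>
      simp only [MvPolynomial.coe_add, subst_add hs, map_add, hp, hq, add_mul,
        Finset.sum_add_distrib]
    | mul_X p i hp =>
      simp only [MvPolynomial.coe_mul, MvPolynomial.coe_X, subst_mul hs, subst_X hs,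
        Derivation.leibniz, hp, smul_eq_mul, subst_add hs, add_mul, Finset.sum_add_distrib]
      congr 1
      · rw [Finset.sum_eq_single i]
        · rw [pderiv_X_self, ← coe_substAlgHom hs, map_one]
          ring
        · intro l _ hl
          rw [pderiv_X_of_ne (Ne.symm hl), ← coe_substAlgHom hs, map_zero]
          ring
        · simp
      · rw [Finset.mul_sum]
        exact Finset.sum_congr rfl fun l _ => by ring
  refine eq_of_forall_le_order fun k => ?_
  -- Truncating at `k + 1` and not at `k`: differentiation lowers the order of the tail by one.
  let p : MvPolynomial σ ℂ := truncTotal (k + 1) f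
  let g : MvPowerSeries σ ℂ := f - p
  have hg : ((k + 1 : ℕ) : ℕ∞) ≤ g.order := by
    rw [nat_le_order_iff]
    intro d hd
    simp only [g, p, map_sub, MvPolynomial.coeff_coe]
    rw [coeff_truncTotal _ hd, sub_self]
  have hf : f = p + g := by simp [g]
  have e : pderiv ℂ j (f.subst a) - ∑ i, (pderiv ℂ i f).subst a * pderiv ℂ j (a i) =
      pderiv ℂ j (g.subst a) - ∑ i, (pderiv ℂ i g).subst a * pderiv ℂ j (a i) := by
    rw [hf]
    simp only [subst_add hs, map_add, hpoly, add_mul, Finset.sum_add_distrib]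
    ring
  rw [e]
  refine nat_le_order_sub (nat_le_order_pderiv (nat_le_order_subst hg ha) j) ?_
  refine Finset.sum_induction _ (fun h : MvPowerSeries τ ℂ => (k : ℕ∞) ≤ h.order)
    (fun _ _ => nat_le_order_add) (by simp) fun i _ => ?_
  exact nat_le_order_mul (l := 0) (nat_le_order_subst (nat_le_order_pderiv hg i) ha) (by simp)
    le_rfl

/-- A map on tuples of power series which improves congruences has a fixed point, and the fixed
point lies in every polydisc-norm ball preserved by the map. -/
theorem exists_fixedPoint (T : (ι → MvPowerSeries σ ℂ) → ι → MvPowerSeries σ ℂ)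
    (h0 : ∀ y, (∀ i, constantCoeff (y i) = 0) → ∀ i, constantCoeff (T y i) = 0)
    (hT : ∀ (k : ℕ) (y y'), (∀ i, constantCoeff (y i) = 0) → (∀ i, constantCoeff (y' i) = 0) →
      (∀ i, (k : ℕ∞) ≤ (y i - y' i).order) → ∀ i, ((k + 1 : ℕ) : ℕ∞) ≤ (T y i - T y' i).order) :
    ∃ y, (∀ i, constantCoeff (y i) = 0) ∧ T y = y ∧ ∀ (s : σ → ℝ≥0∞) (δ : ι → ℝ≥0∞),
      (∀ y, (∀ i, constantCoeff (y i) = 0) → (∀ i, wnorm s (y i) ≤ δ i) →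
        ∀ i, wnorm s (T y i) ≤ δ i) → ∀ i, wnorm s (y i) ≤ δ i := by
  let u : ℕ → ι → MvPowerSeries σ ℂ := fun n => T^[n] 0
  have hu : ∀ n, u (n + 1) = T (u n) := fun n => Function.iterate_succ_apply' T n 0
  have hu0 : ∀ n i, constantCoeff (u n i) = 0 := by
    intro n
    induction n with
    | zero => intro i; simp [u]
    | succ n ih => rw [hu]; exact h0 _ ih
  have h1 : ∀ (n : ℕ) i, (n : ℕ∞) ≤ (u (n + 1) i - u n i).order := by
    intro n
    induction n with
    | zero => intro i; simp
    | succ n ih =>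
      intro i
      rw [hu (n + 1), hu n]
      refine hT n _ _ (by rw [← hu]; exact hu0 _) (hu0 _) ?_ i
      rw [← hu]; exact ih
  have h2 : ∀ (n l : ℕ) i, (n : ℕ∞) ≤ (u (n + l) i - u n i).order := by
    intro n l i
    induction l with
    | zero => simp
    | succ l ih =>
      have : u (n + (l + 1)) i - u n i =
          (u (n + l + 1) i - u (n + l) i) + (u (n + l) i - u n i) := by
        rw [add_assoc]; ring
      rw [this]
      refine nat_le_order_add (le_trans ?_ (h1 (n + l) i)) ih
      exact_mod_cast Nat.le_add_right n l
  -- By `h2` the coefficients of degree `n` no longer change from the iterate `n + 1` on, so the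
  -- limit reads each coefficient off at that stage.
  let y : ι → MvPowerSeries σ ℂ := fun i d => coeff d (u (d.degree + 1) i)
  have hy : ∀ i d, coeff d (y i) = coeff d (u (d.degree + 1) i) := fun _ _ => rfl
  have hyu : ∀ i d n, d.degree < n → coeff d (y i) = coeff d (u n i) := by
    intro i d n hd
    obtain ⟨l, rfl⟩ := Nat.exists_eq_add_of_lt hd
    have := nat_le_order_iff.1 (h2 (d.degree + 1) l i) d (Nat.lt_succ_self _)
    rw [map_sub, sub_eq_zero] at this
    rw [hy, ← this, add_right_comm]
  have hyo : ∀ (n : ℕ) i, (n : ℕ∞) ≤ (y i - u n i).order := by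
    intro n i
    rw [nat_le_order_iff]
    intro d hd
    rw [map_sub, hyu i d n hd, sub_self]
  have hy0 : ∀ i, constantCoeff (y i) = 0 := by
    intro i
    rw [← coeff_zero_eq_constantCoeff_apply, hy, coeff_zero_eq_constantCoeff_apply, hu0]
  refine ⟨y, hy0, ?_, ?_⟩
  · funext i
    refine eq_of_forall_le_order fun n => ?_
    have h3 := hT n y (u n) hy0 (hu0 n) (hyo n) i
    rw [← hu] at h3
    have h4 := nat_le_order_sub h3 (hyo (n + 1) i)
    rw [sub_sub_sub_cancel_right] at h4
    refine le_trans ?_ h4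
    exact_mod_cast Nat.le_succ n
  · intro s δ hδ i
    have h5 : ∀ n i, wnorm s (u n i) ≤ δ i := by
      intro n
      induction n with
      | zero => intro i; simp [u, wnorm]
      | succ n ih => rw [hu]; exact hδ _ (hu0 n) ih
    -- A finite partial sum of the norm of the limit is one of a far iterate, and all iterates stay
    -- in the ball since they start from zero.
    rw [wnorm, ENNReal.tsum_eq_iSup_sum]
    refine iSup_le fun S => ?_
    refine le_trans (le_of_eq ?_) ((ENNReal.sum_le_tsum S).trans (h5 (S.sup Finsupp.degree + 1) i))
    refine Finset.sum_congr rfl fun d hd => ?_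
    rw [hyu i d _ (Nat.lt_succ_of_le (Finset.le_sup (f := Finsupp.degree) hd))]

/-- The primitive of `f` with respect to the variable `X j` that vanishes for `X j = 0`. -/
def primitive (j : σ) (f : MvPowerSeries σ ℂ) : MvPowerSeries σ ℂ :=
  fun d => if d j = 0 then 0 else coeff (d - Finsupp.single j 1) f / d j

theorem coeff_primitive (j : σ) (f : MvPowerSeries σ ℂ) (d : σ →₀ ℕ) :
    coeff d (primitive j f) = if d j = 0 then 0 else coeff (d - Finsupp.single j 1) f / d j := rfl

theorem pderiv_primitive (j : σ) (f : MvPowerSeries σ ℂ) : pderiv ℂ j (primitive j f) = f := by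
  ext d
  have : (d j : ℂ) + 1 ≠ 0 := Nat.cast_add_one_ne_zero _
  rw [coeff_pderiv, coeff_primitive, if_neg (by simp)]
  simp [this]

theorem X_dvd_primitive (j : σ) (f : MvPowerSeries σ ℂ) : X j ∣ primitive j f := by
  rw [X_dvd_iff]
  intro d hd
  rw [coeff_primitive, if_pos hd]

theorem primitive_sub (j : σ) (f g : MvPowerSeries σ ℂ) :
    primitive j (f - g) = primitive j f - primitive j g := by
  ext d
  rw [map_sub, coeff_primitive, coeff_primitive, coeff_primitive]
  split_ifs
  · simp
  · rw [map_sub, sub_div]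

theorem nat_le_order_primitive {f : MvPowerSeries σ ℂ} {k : ℕ} (hf : (k : ℕ∞) ≤ f.order) (j : σ) :
    ((k + 1 : ℕ) : ℕ∞) ≤ (primitive j f).order := by
  rw [nat_le_order_iff] at hf ⊢
  intro d hd
  rw [coeff_primitive]
  split_ifs with h
  · rfl
  · rw [hf, zero_div]
    have hle : Finsupp.single j 1 ≤ d := by
      rw [Finsupp.single_le_iff]; omega
    have := congrArg Finsupp.degree (tsub_add_cancel_of_le hle)
    rw [map_add, Finsupp.degree_single] at this
    omega

/-- Integration multiplies by `X j` and divides coefficients by integers that are at least one. The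
factor `s j` is what makes the Picard operator preserve a ball on a small polydisc. -/
theorem wnorm_primitive_le (s : σ → ℝ≥0∞) (j : σ) (f : MvPowerSeries σ ℂ) :
    wnorm s (primitive j f) ≤ s j * wnorm s f := by
  let g : MvPowerSeries σ ℂ := fun d => coeff d f / (d j + 1)
  have h : primitive j f = X j * g := by
    ext d
    by_cases hd : d j = 0
    · rw [X_dvd_iff.1 (X_dvd_primitive j f) d hd, X_dvd_iff.1 (dvd_mul_right (X j) _) d hd]
    · have hle : Finsupp.single j 1 ≤ d := by
        rw [Finsupp.single_le_iff]; omega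
      obtain ⟨e, rfl⟩ := exists_add_of_le hle
      rw [coeff_primitive, if_neg hd, X, coeff_add_monomial_mul, one_mul, add_tsub_cancel_left]
      change _ = coeff e f / (e j + 1)
      simp [add_comm]
  rw [h]
  refine (wnorm_mul_le _ _ _).trans ?_
  rw [wnorm_X]
  refine mul_le_mul_right (ENNReal.tsum_le_tsum fun d => mul_le_mul_left ?_ _) _
  change ‖coeff d f / (d j + 1)‖ₑ ≤ _
  rw [← ofReal_norm, ← ofReal_norm]
  refine ENNReal.ofReal_le_ofReal ?_
  rw [norm_div]
  refine div_le_self (norm_nonneg _) ?_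
  have : ((d j : ℂ) + 1) = ((d j + 1 : ℕ) : ℂ) := by push_cast; rfl
  rw [this, Complex.norm_natCast]
  exact_mod_cast Nat.succ_le_succ (Nat.zero_le _)

theorem eq_zero_of_pderiv_eq_zero {j : σ} {f : MvPowerSeries σ ℂ} (h : pderiv ℂ j f = 0)
    (h0 : X j ∣ f) : f = 0 := by
  ext d
  by_cases hd : d j = 0
  · rw [X_dvd_iff.1 h0 d hd, map_zero]
  · have hle : Finsupp.single j 1 ≤ d := by
      rw [Finsupp.single_le_iff]; omega
    have h1 := congrArg (coeff (d - Finsupp.single j 1)) h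
    rw [coeff_pderiv, tsub_add_cancel_of_le hle, map_zero] at h1
    rw [map_zero]
    exact (mul_eq_zero.1 h1).resolve_right (Nat.cast_add_one_ne_zero _)

theorem primitive_pderiv {j : σ} {f : MvPowerSeries σ ℂ} (h : X j ∣ f) :
    primitive j (pderiv ℂ j f) = f := by
  rw [← sub_eq_zero]
  refine eq_zero_of_pderiv_eq_zero (j := j) ?_ (dvd_sub (X_dvd_primitive _ _) h)
  rw [map_sub, pderiv_primitive, sub_self]

theorem nat_le_order_of_pderiv {j : σ} {f : MvPowerSeries σ ℂ} (h : X j ∣ f) {k : ℕ}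
    (hf : (k : ℕ∞) ≤ (pderiv ℂ j f).order) : ((k + 1 : ℕ) : ℕ∞) ≤ f.order := by
  rw [← primitive_pderiv h]
  exact nat_le_order_primitive hf j

theorem constantCoeff_eq_zero_of_X_dvd {j : σ} {f : MvPowerSeries σ ℂ} (h : X j ∣ f) :
    constantCoeff f = 0 := by
  obtain ⟨g, rfl⟩ := h
  simp

theorem constantCoeff_sumElim {y : ι → MvPowerSeries τ ℂ} (hy : ∀ i, constantCoeff (y i) = 0) :
    ∀ i, constantCoeff ((Sum.elim X y : τ ⊕ ι → MvPowerSeries τ ℂ) i) = 0 := by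
  rintro (i | i)
  · simp
  · exact hy i

/-- Existence of formal solutions of first-order systems of ordinary differential equations with
parameters, and their convergence. -/
theorem exists_ode [Fintype ι] (j : τ) (P : ι → MvPowerSeries (τ ⊕ ι) ℂ)
    (y₀ : ι → MvPowerSeries τ ℂ) (h₀ : ∀ i, constantCoeff (y₀ i) = 0) :
    ∃ y : ι → MvPowerSeries τ ℂ, (∀ i, constantCoeff (y i) = 0) ∧
      (∀ i, pderiv ℂ j (y i) = pderiv ℂ j (y₀ i) + (P i).subst (Sum.elim X y)) ∧
      (∀ i, X j ∣ y i - y₀ i) ∧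
      ((∀ i, IsConv (P i)) → (∀ i, IsConv (y₀ i)) → ∀ i, IsConv (y i)) := by
  -- The Picard operator. Substitution preserves congruences and integration improves them by one
  -- order.
  obtain ⟨y, hy0, hy, hN⟩ := exists_fixedPoint
    (fun (y : ι → MvPowerSeries τ ℂ) i => y₀ i + primitive j ((P i).subst (Sum.elim X y)))
    (fun y _ i => by
      simp only [map_add, h₀, constantCoeff_eq_zero_of_X_dvd (X_dvd_primitive j _), add_zero])
    (fun k y y' hy hy' h i => by
      rw [add_sub_add_left_eq_sub, ← primitive_sub]
      refine nat_le_order_primitive (le_order_subst_sub' (constantCoeff_sumElim hy)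
        (constantCoeff_sumElim hy') ?_ _) j
      rintro (i | i)
      · simp
      · exact h i)
  have hy' : ∀ i, y i = y₀ i + primitive j ((P i).subst (Sum.elim X y)) := fun i =>
    (congrFun hy i).symm
  refine ⟨y, hy0, fun i => ?_, fun i => ?_, fun hP h₀' i => ?_⟩
  · conv_lhs => rw [hy' i]
    rw [map_add, pderiv_primitive]
  · conv_rhs => rw [hy' i]
    rw [add_sub_cancel_left]
    exact X_dvd_primitive _ _
  -- Fix `s` with all `P i` finite at radius `s`, then `t < s` so small that the initial values and
  -- `t` times the norms of the `P i` are at most `s / 2`. The ball of radius `s` for the norm with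
  -- weight `t` is then preserved.
  · obtain ⟨s, hs, hsp, hst⟩ := ((eventually_all.2 hP).and
      (Ioo_mem_nhdsGT (show (0 : ℝ≥0∞) < 1 by simp))).exists
    have hs2 : s / 2 ≠ 0 := by simpa using hsp.ne'
    have h1 : ∀ i, ∀ᶠ t : ℝ≥0∞ in 𝓝[>] 0, t * wnorm (fun _ => s) (P i) ≤ s / 2 := by
      intro i
      have : Tendsto (fun t : ℝ≥0∞ => t * wnorm (fun _ => s) (P i)) (𝓝[>] 0)
          (𝓝 (0 * wnorm (fun _ => s) (P i))) :=
        ENNReal.Tendsto.mul_const (tendsto_id.mono_left nhdsWithin_le_nhds) (Or.inr (hs i))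
      rw [zero_mul] at this
      filter_upwards [this.eventually_lt_const (pos_iff_ne_zero.2 hs2)] with t ht using ht.le
    have h2 := eventually_all.2 fun i => (h₀' i).eventually_wnorm_le (h₀ i) hs2
    obtain ⟨t, h1, h2, h3⟩ := ((eventually_all.2 h1).and (h2.and (Ioo_mem_nhdsGT hsp))).exists
    refine isConv_of_wnorm h3.1.ne' (ne_top_of_le_ne_top (hst.trans ENNReal.one_lt_top).ne
      (hN (fun _ => t) (fun _ => s) ?_ i))
    intro y hy hys i
    calc wnorm (fun _ => t) (y₀ i + primitive j ((P i).subst (Sum.elim X y)))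
        ≤ s / 2 + s / 2 := by
          refine (wnorm_add_le _ _ _).trans (add_le_add (h2 i) ?_)
          refine (wnorm_primitive_le _ _ _).trans (le_trans (mul_le_mul_right ?_ _) (h1 i))
          refine (wnorm_subst_le _ (hasSubst_of_constantCoeff_zero (constantCoeff_sumElim hy))
            _).trans (wnorm_mono ?_ _)
          rintro (i | i)
          · simpa [wnorm_X] using h3.2.le
          · exact hys i
      _ = s := ENNReal.add_halves s

/-- The inverse of a formal map with linear part the identity, and its convergence. -/
theorem exists_right_inverse (A : σ → MvPowerSeries σ ℂ) (hA : ∀ i, 2 ≤ (A i - X i).order) :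
    ∃ B : σ → MvPowerSeries σ ℂ, (∀ i, constantCoeff (B i) = 0) ∧
      (∀ i, 2 ≤ (B i - X i).order) ∧ (∀ i, (A i).subst B = X i) ∧
      ((∀ i, IsConv (A i)) → ∀ i, IsConv (B i)) := by
  have hc : ∀ i, constantCoeff (A i - X i) = 0 := fun i =>
    one_le_order_iff_constCoeff_eq_zero.1 (le_trans (by norm_num) (hA i))
  -- The equation `A ∘ B = X` is rewritten as `B = X - (A - X) ∘ B`. Since `A - X` has no linear
  -- part, the composition raises the order of differences by one (`q = 1` below).
  obtain ⟨B, hB0, hB, hN⟩ := exists_fixedPoint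
    (fun (y : σ → MvPowerSeries σ ℂ) i => X i - (A i - X i).subst y)
    (fun y hy i => by
      rw [map_sub, constantCoeff_X,
        constantCoeff_subst_eq_zero (hasSubst_of_constantCoeff_zero hy) hy (hc i), sub_zero])
    (fun k y y' hy hy' h i => by
      rw [sub_sub_sub_cancel_left]
      refine le_order_subst_sub (q := 1) hy' hy (fun i => ?_) fun d hd => Or.inr ?_
      · rw [← order_neg, neg_sub]; exact h i
      · by_contra h'
        refine hd (coeff_of_lt_order (lt_of_lt_of_le ?_ (hA i)))
        exact_mod_cast not_le.1 h')
  have hs := hasSubst_of_constantCoeff_zero hB0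
  have hB' : ∀ i, B i = X i - (A i - X i).subst B := fun i => (congrFun hB i).symm
  refine ⟨B, hB0, fun i => ?_, fun i => ?_, fun hconv i => ?_⟩
  · conv_rhs => rw [hB' i]
    rw [sub_sub_cancel_left, order_neg]
    exact_mod_cast nat_le_order_subst (k := 2) (by exact_mod_cast hA i) hB0
  · have := hB' i
    rw [subst_sub hs, subst_X hs] at this
    linear_combination this
  -- The ball has weight `t / 2` and radius `t`: the identity contributes `t / 2`, and `A - X` at
  -- radius `t` contributes at most another `t / 2`.
  · have h1 := eventually_all.2 fun i => ((hconv i).sub (isConv_X i)).eventually_wnorm_le_mul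
      (hA i) (c := 1 / 2) (by simp)
    obtain ⟨t, h1, h2⟩ := (h1.and (Ioo_mem_nhdsGT (show (0 : ℝ≥0∞) < 1 by simp))).exists
    have ht : t / 2 ≠ 0 := by simpa using h2.1.ne'
    refine isConv_of_wnorm ht (ne_top_of_le_ne_top (h2.2.trans ENNReal.one_lt_top).ne
      (hN (fun _ => t / 2) (fun _ => t) ?_ i))
    intro y hy hys i
    have h3 : wnorm (fun _ => t / 2) ((A i - X i).subst y) ≤ t / 2 := by
      refine (wnorm_subst_le _ (hasSubst_of_constantCoeff_zero hy) _).trans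
        ((wnorm_mono hys _).trans ((h1 i).trans (le_of_eq ?_)))
      rw [one_div, mul_comm, div_eq_mul_inv]
    have h4 := wnorm_sub_le (fun _ => t / 2) (X i) ((A i - X i).subst y)
    rw [wnorm_X] at h4
    exact h4.trans ((add_le_add le_rfl h3).trans (ENNReal.add_halves t).le)

/-- The right inverse `B` is again tangent to the identity, so it has a right inverse `D`;
associativity gives `A = A ∘ B ∘ D = D`, and `B` is two-sided. -/
theorem exists_inverse (A : σ → MvPowerSeries σ ℂ) (hA : ∀ i, 2 ≤ (A i - X i).order) :
    ∃ B : σ → MvPowerSeries σ ℂ, (∀ i, constantCoeff (B i) = 0) ∧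
      (∀ i, (A i).subst B = X i) ∧ (∀ i, (B i).subst A = X i) ∧
      ((∀ i, IsConv (A i)) → ∀ i, IsConv (B i)) := by
  obtain ⟨B, hB0, hB2, hAB, hconv⟩ := exists_right_inverse A hA
  obtain ⟨D, hD0, -, hBD, -⟩ := exists_right_inverse B hB2
  have hAD : A = D := by
    funext i
    have h1 : ((A i).subst B).subst D = D i := by
      rw [hAB, subst_X (hasSubst_of_constantCoeff_zero hD0)]
    rw [subst_comp_subst_apply (hasSubst_of_constantCoeff_zero hB0)
      (hasSubst_of_constantCoeff_zero hD0)] at h1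
    have h2 : (fun i => (B i).subst D) = X := funext hBD
    rw [h2, subst_self] at h1
    exact h1
  exact ⟨B, hB0, hAB, fun i => by rw [hAD, hBD], hconv⟩

end Formal

end SegreODE

namespace SegreODE

open MvPowerSeries Filter Topology
open scoped ENNReal

/-! ### Divisibility by powers of a variable and its behaviour under integration. -/

section Divisibility

variable {σ : Type*} [Fintype σ]

theorem X_ne_zero (i : σ) : (X i : MvPowerSeries σ ℂ) ≠ 0 := by
  intro h
  have := pderiv_X_self (R := ℂ) (i := i)
  rw [h, map_zero] at this
  exact zero_ne_one this

/-- As `X i` divides `f`, it is the primitive of its derivative, and integrating in `X i` leaves the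
exponents of `X j` unchanged. Together with `X_pow_succ_dvd_of_pderiv` this yields admissibility of
a phase from its `z`-derivative. -/
theorem X_pow_dvd_of_pderiv {i j : σ} (h : j ≠ i) {n : ℕ} {f : MvPowerSeries σ ℂ} (h0 : X i ∣ f)
    (hf : X j ^ n ∣ pderiv ℂ i f) : X j ^ n ∣ f := by
  rw [X_pow_dvd_iff] at hf ⊢
  intro d hd
  rw [← primitive_pderiv h0, coeff_primitive]
  split_ifs
  · rfl
  · rw [hf, zero_div]
    simpa [Finsupp.single_eq_of_ne h] using hd

theorem X_pow_succ_dvd_of_pderiv {i : σ} {n : ℕ} {f : MvPowerSeries σ ℂ} (h0 : X i ∣ f)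
    (hf : X i ^ n ∣ pderiv ℂ i f) : X i ^ (n + 1) ∣ f := by
  rw [X_pow_dvd_iff] at hf ⊢
  intro d hd
  rw [← primitive_pderiv h0, coeff_primitive]
  split_ifs
  · rfl
  · rw [hf, zero_div]
    simp only [Finsupp.coe_tsub, Pi.sub_apply, Finsupp.single_eq_same]
    omega

theorem X_pow_mul_X_pow_dvd {i j : σ} (h : i ≠ j) {k l : ℕ} {f : MvPowerSeries σ ℂ}
    (h1 : X i ^ k ∣ f) (h2 : X j ^ l ∣ f) : X i ^ k * X j ^ l ∣ f := by
  obtain ⟨g, rfl⟩ := h1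
  refine mul_dvd_mul_left _ ?_
  rw [X_pow_dvd_iff] at h2 ⊢
  intro d hd
  have := h2 (Finsupp.single i k + d) (by simpa [Finsupp.single_eq_of_ne h.symm] using hd)
  rwa [X_pow_eq, coeff_add_monomial_mul, one_mul] at this

theorem nat_le_order_of_dvd {f g : MvPowerSeries σ ℂ} {k : ℕ} (hf : (k : ℕ∞) ≤ f.order)
    (h : f ∣ g) : (k : ℕ∞) ≤ g.order := by
  obtain ⟨q, rfl⟩ := h
  exact nat_le_order_mul (l := 0) hf (by simp) le_rfl

/-- The solution of a linear homogeneous equation vanishes where its initial value does. -/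
theorem X_dvd_of_pderiv_eq_mul {i j : σ} (h : j ≠ i) {f p : MvPowerSeries σ ℂ}
    (hf : pderiv ℂ i f = f * p) (h0 : ∀ d : σ →₀ ℕ, d i = 0 → d j = 0 → coeff d f = 0) :
    X j ∣ f := by
  classical
  rw [X_dvd_iff]
  intro d hd
  -- The equation expresses a coefficient of `f` through coefficients with smaller exponent of `X i`
  -- and still with exponent zero of `X j`.
  induction hn : d i using Nat.strong_induction_on generalizing d with
  | _ n ih =>
    by_cases hi : d i = 0
    · exact h0 d hi hd
    have hle : Finsupp.single i 1 ≤ d := by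
      rw [Finsupp.single_le_iff]; omega
    have h1 := congrArg (coeff (d - Finsupp.single i 1)) hf
    rw [coeff_pderiv, tsub_add_cancel_of_le hle, coeff_mul, Finset.sum_eq_zero] at h1
    · exact (mul_eq_zero.1 h1).resolve_right (Nat.cast_add_one_ne_zero _)
    · intro q hq
      rw [Finset.HasAntidiagonal.mem_antidiagonal] at hq
      have hqj := DFunLike.congr_fun hq j
      have hqi := DFunLike.congr_fun hq i
      simp only [Finsupp.add_apply, Finsupp.coe_tsub, Pi.sub_apply, Finsupp.single_eq_same,
        Finsupp.single_eq_of_ne h] at hqj hqi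
      rw [ih (q.1 i) (by omega) q.1 (by omega) rfl, zero_mul]

end Divisibility

/-! ### The exponential of a series without constant term. -/

section Exp

variable {σ τ : Type*} [Fintype σ] [Fintype τ] {a : MvPowerSeries σ ℂ}

theorem constantCoeff_exp_subst (ha : constantCoeff a = 0) :
    constantCoeff ((PowerSeries.exp ℂ).subst a) = 1 := by
  have h := PowerSeries.constantCoeff_subst_eq_zero ha (PowerSeries.exp ℂ - 1) (by simp)
  have hs := PowerSeries.HasSubst.of_constantCoeff_zero ha
  rw [PowerSeries.subst_sub hs, ← PowerSeries.coe_substAlgHom hs, map_one] at h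
  rw [← PowerSeries.coe_substAlgHom hs]
  have h2 := (map_sub (constantCoeff (R := ℂ) (σ := σ)) _ _).symm.trans h
  rw [map_one, sub_eq_zero] at h2
  exact h2

theorem pderiv_exp_subst (ha : constantCoeff a = 0) (i : σ) :
    pderiv ℂ i ((PowerSeries.exp ℂ).subst a) =
      (PowerSeries.exp ℂ).subst a * pderiv ℂ i a := by
  have h := pderiv_subst (σ := Unit) (a := fun _ => a) (fun _ => ha) i (PowerSeries.exp ℂ)
  rw [Fintype.sum_unique] at h
  have h2 : pderiv ℂ () (PowerSeries.exp ℂ) = PowerSeries.exp ℂ := PowerSeries.derivative_exp ℂ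
  exact h.trans (congrArg (fun f => MvPowerSeries.subst (fun _ : Unit => a) f * pderiv ℂ i a) h2)

theorem dvd_exp_subst_sub_one (ha : constantCoeff a = 0) :
    a ∣ (PowerSeries.exp ℂ).subst a - 1 := by
  have hs := PowerSeries.HasSubst.of_constantCoeff_zero ha
  have h : (PowerSeries.X : PowerSeries ℂ) ∣ PowerSeries.exp ℂ - 1 := by
    rw [PowerSeries.X_dvd_iff]; simp
  obtain ⟨q, hq⟩ := h
  refine ⟨q.subst a, ?_⟩
  have := congrArg (PowerSeries.subst a) hq
  rw [PowerSeries.subst_sub hs, PowerSeries.subst_mul hs, PowerSeries.subst_X hs] at this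
  rw [← this, ← PowerSeries.coe_substAlgHom hs, map_one]

theorem exp_subst_subst (ha : constantCoeff a = 0) {c : σ → MvPowerSeries τ ℂ}
    (hc : ∀ i, constantCoeff (c i) = 0) :
    ((PowerSeries.exp ℂ).subst a).subst c = (PowerSeries.exp ℂ).subst (a.subst c) :=
  MvPowerSeries.subst_comp_subst_apply (PowerSeries.HasSubst.of_constantCoeff_zero ha).const
    (hasSubst_of_constantCoeff_zero hc) _

theorem IsConv.exp_subst (h : IsConv a) (ha : constantCoeff a = 0) :
    IsConv ((PowerSeries.exp ℂ).subst a) :=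
  isConv_exp.subst (fun _ => ha) fun _ => h

end Exp

theorem forall_fin_three {P : Fin 3 → Prop} (h0 : P 0) (h1 : P 1) (h2 : P 2) : ∀ i, P i := by
  intro i; fin_cases i <;> assumption

/-! ### The regular first-order system for `(ρ, ζ)` and its unique solvability. -/

section System

variable {m : ℕ} {k : ℕ}

/-- The first-order system in `(ρ, ζ)` equivalent to a singular ordinary differential equation. -/
structure SingularODE.IsSystemSolution (E : SingularODE m) (ρ ζ : MvPowerSeries (Fin (k + 1)) ℂ) :
    Prop where
  constantCoeff_fst : constantCoeff ρ = 0
  constantCoeff_snd : constantCoeff ζ = 0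
  pderiv_fst : pderiv ℂ 0 ρ = ρ ^ m * ζ
  pderiv_snd : pderiv ℂ 0 ζ = E.Φ.subst ![X 0, ρ, ζ] - m * ρ ^ (m - 1) * ζ ^ 2

theorem pderiv_pderiv_of_pderiv_eq {ρ ζ : MvPowerSeries (Fin (k + 1)) ℂ}
    (h : pderiv ℂ 0 ρ = ρ ^ m * ζ) : pderiv ℂ 0 (pderiv ℂ 0 ρ) =
      ρ ^ m * (pderiv ℂ 0 ζ + m * ρ ^ (m - 1) * ζ ^ 2) := by
  conv_lhs => rw [h]
  rw [Derivation.leibniz, pderiv_pow, h]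
  simp only [smul_eq_mul]
  ring

theorem SingularODE.IsSystemSolution.isSolution {E : SingularODE m}
    {ρ ζ : MvPowerSeries (Fin (k + 1)) ℂ} (h : E.IsSystemSolution ρ ζ) : E.IsSolution ρ := by
  refine ⟨h.constantCoeff_fst, ζ, h.constantCoeff_snd, h.pderiv_fst, ?_⟩
  rw [pderiv_pderiv_of_pderiv_eq h.pderiv_fst, h.pderiv_snd]
  ring

/-- Power series form a domain, so for `ρ ≠ 0` the factor `ρ ^ m` cancels: it identifies `ζ` with
the quotient in the definition of a solution, and it desingularizes the equation. -/
theorem SingularODE.IsSolution.isSystemSolution {E : SingularODE m}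
    {ρ ζ : MvPowerSeries (Fin (k + 1)) ℂ} (h : E.IsSolution ρ) (hρ : ρ ≠ 0)
    (hζ : pderiv ℂ 0 ρ = ρ ^ m * ζ) : E.IsSystemSolution ρ ζ := by
  obtain ⟨h0, ζ', h1, h2, h3⟩ := h
  have hm : ρ ^ m ≠ 0 := pow_ne_zero _ hρ
  obtain rfl : ζ = ζ' := mul_left_cancel₀ hm (hζ.symm.trans h2)
  refine ⟨h0, h1, h2, ?_⟩
  rw [pderiv_pderiv_of_pderiv_eq h2] at h3
  rw [← mul_left_cancel₀ hm h3]
  ring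

theorem SingularODE.subst_eq_zero (E : SingularODE m) {ρ : MvPowerSeries (Fin (k + 1)) ℂ}
    (hρ : constantCoeff ρ = 0) : E.Φ.subst ![X 0, ρ, 0] = 0 := by
  obtain ⟨q, hq⟩ := E.isBigO
  have hc := constantCoeff_vec_three (constantCoeff_X (R := ℂ) (0 : Fin (k + 1))) hρ (map_zero _)
  have hs := hasSubst_of_constantCoeff_zero hc
  rw [hq, subst_mul hs, subst_pow hs, subst_X hs]
  simp

theorem SingularODE.IsSolution.exists_isSystemSolution [NeZero m] {E : SingularODE m}
    {ρ : MvPowerSeries (Fin (k + 1)) ℂ} (h : E.IsSolution ρ) : ∃ ζ, E.IsSystemSolution ρ ζ := by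
  by_cases hρ : ρ = 0
  -- For `ρ = 0` the quotient `ζ` is not determined by the equation and need not solve the system;
  -- `ζ = 0` does, because `Φ = O(ζ²)`.
  · refine ⟨0, h.1, map_zero _, ?_, ?_⟩
    · rw [hρ]; simp
    · rw [E.subst_eq_zero h.1]; simp
  · obtain ⟨h0, ζ, h1, h2, h3⟩ := h
    exact ⟨ζ, SingularODE.IsSolution.isSystemSolution ⟨h0, ζ, h1, h2, h3⟩ hρ h2⟩

/-- Uniqueness for the initial value problem: if the two solutions agree to order `n`, so do the
right-hand sides, and integrating in `z` from equal initial values gives agreement to order `n + 1`.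
-/
theorem SingularODE.IsSystemSolution.eq {E : SingularODE m}
    {ρ ζ ρ' ζ' : MvPowerSeries (Fin (k + 1)) ℂ} (h : E.IsSystemSolution ρ ζ)
    (h' : E.IsSystemSolution ρ' ζ') (hρ : X 0 ∣ ρ - ρ') (hζ : X 0 ∣ ζ - ζ') :
    ρ = ρ' ∧ ζ = ζ' := by
  have key : ∀ n : ℕ, (n : ℕ∞) ≤ (ρ - ρ').order ∧ (n : ℕ∞) ≤ (ζ - ζ').order := by
    intro n
    induction n with
    | zero => simp
    | succ n ih =>
      obtain ⟨h1, h2⟩ := ih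
      have hpow : ∀ l, (n : ℕ∞) ≤ (ρ ^ l - ρ' ^ l).order := fun l =>
        nat_le_order_of_dvd h1 (sub_dvd_pow_sub_pow _ _ _)
      constructor
      · refine nat_le_order_of_pderiv hρ ?_
        rw [map_sub, h.pderiv_fst, h'.pderiv_fst]
        have : ρ ^ m * ζ - ρ' ^ m * ζ' = (ρ ^ m - ρ' ^ m) * ζ + (ζ - ζ') * ρ' ^ m := by ring
        rw [this]
        exact nat_le_order_add (nat_le_order_of_dvd (hpow m) (dvd_mul_right _ _))
          (nat_le_order_of_dvd h2 (dvd_mul_right _ _))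
      · refine nat_le_order_of_pderiv hζ ?_
        rw [map_sub, h.pderiv_snd, h'.pderiv_snd]
        have : E.Φ.subst ![X 0, ρ, ζ] - m * ρ ^ (m - 1) * ζ ^ 2 -
            (E.Φ.subst ![X 0, ρ', ζ'] - m * ρ' ^ (m - 1) * ζ' ^ 2) =
            (E.Φ.subst ![X 0, ρ, ζ] - E.Φ.subst ![X 0, ρ', ζ']) -
              ((ρ ^ (m - 1) - ρ' ^ (m - 1)) * (m * ζ ^ 2) +
                (ζ - ζ') * (m * ρ' ^ (m - 1) * (ζ + ζ'))) := by ring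
        rw [this]
        refine nat_le_order_sub ?_ (nat_le_order_add
          (nat_le_order_of_dvd (hpow _) (dvd_mul_right _ _))
          (nat_le_order_of_dvd h2 (dvd_mul_right _ _)))
        refine le_order_subst_sub'
          (constantCoeff_vec_three (constantCoeff_X _) h.constantCoeff_fst h.constantCoeff_snd)
          (constantCoeff_vec_three (constantCoeff_X _) h'.constantCoeff_fst h'.constantCoeff_snd)
          (forall_fin_three ?_ ?_ ?_) _
        · simp
        · simpa using h1
        · simpa using h2
  exact ⟨eq_of_forall_le_order fun n => (key n).1, eq_of_forall_le_order fun n => (key n).2⟩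

/-- Substituting for the parameters of a family of solutions. -/
theorem SingularODE.IsSystemSolution.subst {E : SingularODE m}
    {ρ ζ : MvPowerSeries (Fin (2 + 1)) ℂ} (h : E.IsSystemSolution ρ ζ)
    {a b : MvPowerSeries (Fin (k + 1)) ℂ} (ha : constantCoeff a = 0) (hb : constantCoeff b = 0)
    (ha' : pderiv ℂ 0 a = 0) (hb' : pderiv ℂ 0 b = 0) :
    E.IsSystemSolution (ρ.subst ![X 0, a, b]) (ζ.subst ![X 0, a, b]) := by
  have hc := constantCoeff_vec_three (constantCoeff_X (R := ℂ) (0 : Fin (k + 1))) ha hb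
  have hs := hasSubst_of_constantCoeff_zero hc
  have hd : ∀ f : MvPowerSeries (Fin 3) ℂ,
      pderiv ℂ 0 (f.subst ![X 0, a, b]) = (pderiv ℂ 0 f).subst ![X 0, a, b] := by
    intro f
    rw [pderiv_subst hc, Fin.sum_univ_three]
    simp [ha', hb']
  refine ⟨?_, ?_, ?_, ?_⟩
  · rw [constantCoeff_subst_eq hc, h.constantCoeff_fst]
  · rw [constantCoeff_subst_eq hc, h.constantCoeff_snd]
  · rw [hd, h.pderiv_fst, subst_mul hs, subst_pow hs]
  · rw [hd, h.pderiv_snd, subst_sub hs, subst_subst_three (constantCoeff_X _)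
      h.constantCoeff_fst h.constantCoeff_snd hc]
    rw [subst_X hs, subst_mul hs, subst_mul hs, subst_pow hs, subst_pow hs]
    have : (m : MvPowerSeries (Fin 3) ℂ).subst ![X 0, a, b] =
        (m : MvPowerSeries (Fin (k + 1)) ℂ) := by
      rw [← coe_substAlgHom hs, map_natCast]
    rw [this]
    rfl

end System

/-! ### The slope of a Segre family and the equation it satisfies. -/

section Segre

variable {m : ℕ} {ε : ℤˣ}

theorem sign_mul_self (ε : ℤˣ) : (((ε : ℤ) : ℂ)) * ((ε : ℤ) : ℂ) = 1 := by
  rcases Int.units_eq_one_or ε with rfl | rfl <;> simp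

namespace SegreFamily

variable (S : SegreFamily m ε)

/-- The exponent `i τ ^ (m - 1) φ` in the definition of a Segre family. -/
def exponent : MvPowerSeries (Fin 3) ℂ := C Complex.I * X 2 ^ (m - 1) * S.φ

/-- The unit `exp (i τ ^ (m - 1) φ)`. -/
def expUnit : MvPowerSeries (Fin 3) ℂ := (PowerSeries.exp ℂ).subst S.exponent

/-- The quotient `ρ_z / ρ ^ m`. -/
def slope : MvPowerSeries (Fin 3) ℂ := C Complex.I * pderiv ℂ 0 S.φ * (S.expUnit⁻¹) ^ (m - 1)

theorem definingFunction_eq : S.definingFunction = X 2 * S.expUnit := rfl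

theorem exists_φ_eq : ∃ g, S.φ = C ((ε : ℤ) : ℂ) * X 0 * X 1 + X 0 ^ 2 * X 1 ^ 2 * g := by
  obtain ⟨g, hg⟩ := S.admissible
  exact ⟨g, by rw [← hg]; ring⟩

theorem X_dvd_φ (S : SegreFamily m ε) : X 0 * X 1 ∣ S.φ := by
  obtain ⟨g, hg⟩ := S.exists_φ_eq
  exact ⟨C ((ε : ℤ) : ℂ) + X 0 * X 1 * g, by rw [hg]; ring⟩

theorem φ_dvd_exponent : S.φ ∣ S.exponent := dvd_mul_left _ _

theorem constantCoeff_exponent : constantCoeff S.exponent = 0 :=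
  constantCoeff_eq_zero_of_X_dvd
    (((dvd_mul_right (X 0) (X 1)).trans S.X_dvd_φ).trans S.φ_dvd_exponent)

theorem constantCoeff_expUnit : constantCoeff S.expUnit = 1 :=
  constantCoeff_exp_subst S.constantCoeff_exponent

theorem expUnit_mul_inv : S.expUnit * S.expUnit⁻¹ = 1 :=
  MvPowerSeries.mul_inv_cancel _ (by rw [S.constantCoeff_expUnit]; exact one_ne_zero)

theorem φ_dvd_expUnit_sub_one : S.φ ∣ S.expUnit - 1 :=
  S.φ_dvd_exponent.trans (dvd_exp_subst_sub_one S.constantCoeff_exponent)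

theorem φ_dvd_inv_pow_sub_one (n : ℕ) : S.φ ∣ (S.expUnit⁻¹) ^ n - 1 := by
  have h : S.φ ∣ S.expUnit⁻¹ - 1 := by
    have : S.expUnit⁻¹ - 1 = (S.expUnit - 1) * (-S.expUnit⁻¹) := by
      linear_combination S.expUnit_mul_inv
    rw [this]
    exact S.φ_dvd_expUnit_sub_one.mul_right _
  have h2 := sub_dvd_pow_sub_pow (S.expUnit⁻¹) 1 n
  rw [one_pow] at h2
  exact h.trans h2

theorem pderiv_φ {g : MvPowerSeries (Fin 3) ℂ}
    (hg : S.φ = C ((ε : ℤ) : ℂ) * X 0 * X 1 + X 0 ^ 2 * X 1 ^ 2 * g) :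
    pderiv ℂ 0 S.φ = C ((ε : ℤ) : ℂ) * X 1 + X 1 ^ 2 * (X 0 * (2 * g + X 0 * pderiv ℂ 0 g)) := by
  have h1 : pderiv ℂ (0 : Fin 3) (X 1) = 0 := pderiv_X_of_ne (by decide)
  rw [hg]
  simp only [map_add, Derivation.leibniz, pderiv_pow, h1, pderiv_C, pderiv_X_self, smul_eq_mul]
  simp only [Nat.cast_ofNat, Nat.add_one_sub_one, pow_one]
  ring

/-- `ρ_z / ρ ^ m` is `i ε χ` up to a unit which is one for `z = 0` and for `χ = 0`. -/
theorem exists_slope_eq : ∃ U, S.slope = C (Complex.I * ((ε : ℤ) : ℂ)) * X 1 * U ∧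
    X 0 ∣ U - 1 ∧ X 1 ∣ U - 1 := by
  obtain ⟨g, hg⟩ := S.exists_φ_eq
  obtain ⟨q, hq⟩ := S.X_dvd_φ.trans (S.φ_dvd_inv_pow_sub_one (m - 1))
  have h2 : (C ((ε : ℤ) : ℂ) * C ((ε : ℤ) : ℂ) : MvPowerSeries (Fin 3) ℂ) = 1 := by
    rw [← map_mul, sign_mul_self, map_one]
  rw [sub_eq_iff_eq_add] at hq
  refine ⟨(1 + C ((ε : ℤ) : ℂ) * X 1 * (X 0 * (2 * g + X 0 * pderiv ℂ 0 g))) *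
    (S.expUnit⁻¹) ^ (m - 1), ?_, ?_, ?_⟩
  · rw [slope, S.pderiv_φ hg, map_mul]
    linear_combination (-(C Complex.I * (X 1 ^ 2 * (X 0 * (2 * g + X 0 * pderiv ℂ 0 g)))) *
      (S.expUnit⁻¹) ^ (m - 1)) * h2
  · rw [hq]
    exact ⟨C ((ε : ℤ) : ℂ) * X 1 * (2 * g + X 0 * pderiv ℂ 0 g) * (X 0 * X 1 * q + 1) +
      X 1 * q, by ring⟩
  · rw [hq]
    exact ⟨C ((ε : ℤ) : ℂ) * (X 0 * (2 * g + X 0 * pderiv ℂ 0 g)) * (X 0 * X 1 * q + 1) +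
      X 0 * q, by ring⟩

theorem constantCoeff_slope : constantCoeff S.slope = 0 := by
  obtain ⟨U, hU, -⟩ := S.exists_slope_eq
  rw [hU]; simp

/-- With `X_dvd_definingFunction_sub` this gives the initial values `(τ, i ε χ)` at `z = 0`, which
single out the Segre family among all families of solutions. -/
theorem X_dvd_slope_sub : X 0 ∣ S.slope - C (Complex.I * ((ε : ℤ) : ℂ)) * X 1 := by
  obtain ⟨U, hU, ⟨q, hq⟩, -⟩ := S.exists_slope_eq
  exact ⟨C (Complex.I * ((ε : ℤ) : ℂ)) * X 1 * q, by
    rw [hU]; linear_combination C (Complex.I * ((ε : ℤ) : ℂ)) * X 1 * hq⟩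

theorem X_dvd_definingFunction_sub : X 0 ∣ S.definingFunction - X 2 := by
  have : S.definingFunction - X 2 = X 2 * (S.expUnit - 1) := by
    rw [S.definingFunction_eq]; ring
  rw [this]
  exact (((dvd_mul_right _ _).trans S.X_dvd_φ).trans S.φ_dvd_expUnit_sub_one).mul_left _

theorem definingFunction_ne_zero : S.definingFunction ≠ 0 := by
  rw [S.definingFunction_eq]
  refine mul_ne_zero (X_ne_zero 2) fun h => ?_
  have := S.constantCoeff_expUnit
  rw [h, map_zero] at this
  exact zero_ne_one this

theorem pderiv_expUnit : pderiv ℂ 0 S.expUnit =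
    S.expUnit * (C Complex.I * X 2 ^ (m - 1) * pderiv ℂ 0 S.φ) := by
  have h2 : pderiv ℂ (0 : Fin 3) (X 2) = 0 := pderiv_X_of_ne (by decide)
  rw [expUnit, pderiv_exp_subst S.constantCoeff_exponent]
  congr 1
  simp only [exponent, Derivation.leibniz, pderiv_pow, pderiv_C, h2]
  simp

/-- With `v = exp(i τ^(m-1) φ)` one has `ρ_z = ρ · i τ^(m-1) φ_z` and `ρ^(m-1) = τ^(m-1) v^(m-1)`:
the powers of `τ` match, so the quotient by `ρ^m` is a power series. This is why the exponent
carries `τ^(m-1)`. -/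
theorem pderiv_definingFunction [NeZero m] :
    pderiv ℂ 0 S.definingFunction = S.definingFunction ^ m * S.slope := by
  have h2 : pderiv ℂ (0 : Fin 3) (X 2) = 0 := pderiv_X_of_ne (by decide)
  obtain ⟨n, rfl⟩ := Nat.exists_eq_succ_of_ne_zero (NeZero.ne m)
  rw [S.definingFunction_eq, Derivation.leibniz, h2, S.pderiv_expUnit, slope]
  simp only [Nat.succ_eq_add_one, Nat.add_sub_cancel, smul_eq_mul, mul_zero, add_zero]
  have h3 : S.expUnit ^ n * S.expUnit⁻¹ ^ n = 1 := by
    rw [← mul_pow, S.expUnit_mul_inv, one_pow]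
  rw [mul_pow, pow_succ S.expUnit]
  linear_combination (-X 2 ^ (n + 1) * S.expUnit * C Complex.I * pderiv ℂ 0 S.φ) * h3

/-- As `ρ ≠ 0`, the quotient can only be `slope`. Being a solution thus prescribes the values of `Φ`
along `(z, ρ, ζ)`, from which `Φ` is recovered by inverting that map. -/
theorem isSolution_iff [NeZero m] (E : SingularODE m) :
    E.IsSolution (k := 2) S.definingFunction ↔
      E.Φ.subst ![X 0, S.definingFunction, S.slope] =
        pderiv ℂ 0 S.slope + m * S.definingFunction ^ (m - 1) * S.slope ^ 2 := by
  constructor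
  · intro h
    have := (h.isSystemSolution S.definingFunction_ne_zero S.pderiv_definingFunction).pderiv_snd
    rw [this]; ring
  · intro h
    refine SingularODE.IsSystemSolution.isSolution (ζ := S.slope)
      ⟨S.constantCoeff_definingFunction, S.constantCoeff_slope, S.pderiv_definingFunction, ?_⟩
    rw [h]; ring

theorem isSystemSolution [NeZero m] {E : SingularODE m}
    (h : E.IsSolution (k := 2) S.definingFunction) :
    E.IsSystemSolution (k := 2) S.definingFunction S.slope :=
  h.isSystemSolution S.definingFunction_ne_zero S.pderiv_definingFunction

theorem isConv_expUnit (h : IsConv S.φ) : IsConv S.expUnit :=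
  ((((isConv_C _).mul ((isConv_X _).pow _)).mul h)).exp_subst S.constantCoeff_exponent

theorem isConv_definingFunction (h : IsConv S.φ) : IsConv S.definingFunction :=
  (isConv_X _).mul (S.isConv_expUnit h)

theorem isConv_slope (h : IsConv S.φ) : IsConv S.slope := by
  refine ((isConv_C _).mul (h.pderiv _)).mul (((S.isConv_expUnit h).inv ?_).pow _)
  rw [S.constantCoeff_expUnit]; exact one_ne_zero

end SegreFamily

end Segre

end SegreODE

namespace SegreODE

open MvPowerSeries Filter Topology
open scoped ENNReal

/-! ### The correspondence between Segre families and equations on objects. -/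

section Objects

variable {m : ℕ} {ε : ℤˣ}

theorem C_mul_C_sign (ε : ℤˣ) {σ : Type*} :
    (C (Complex.I * ((ε : ℤ) : ℂ)) * C (-(Complex.I * ((ε : ℤ) : ℂ))) : MvPowerSeries σ ℂ) = 1 := by
  rw [← map_mul]
  have : Complex.I * ((ε : ℤ) : ℂ) * -(Complex.I * ((ε : ℤ) : ℂ)) = 1 := by
    linear_combination (-(((ε : ℤ) : ℂ)) * ((ε : ℤ) : ℂ)) * Complex.I_mul_I + sign_mul_self ε
  rw [this, map_one]

namespace SegreFamily

variable (S : SegreFamily m ε)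

theorem constantCoeff_jet :
    ∀ i, constantCoeff ((![X 0, S.definingFunction, S.slope] : Fin 3 → MvPowerSeries (Fin 3) ℂ) i)
      = 0 :=
  constantCoeff_vec_three (constantCoeff_X _) S.constantCoeff_definingFunction
    S.constantCoeff_slope

/-- The map `(z, χ, τ) ↦ (z, ρ, ρ_z / ρ ^ m)` is invertible. -/
theorem exists_jet_inverse : ∃ B : Fin 3 → MvPowerSeries (Fin 3) ℂ,
    (∀ i, constantCoeff (B i) = 0) ∧
    (∀ i, (B i).subst ![X 0, S.definingFunction, S.slope] = X i) ∧
    (∀ i, ((![X 0, S.definingFunction, S.slope] : Fin 3 → MvPowerSeries (Fin 3) ℂ) i).subst B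
      = X i) ∧
    X 2 ∣ B 1 ∧ (IsConv S.φ → ∀ i, IsConv (B i)) := by
  obtain ⟨U, hU, hU0, hU1⟩ := S.exists_slope_eq
  have hUc : constantCoeff U = 1 := by
    have := constantCoeff_eq_zero_of_X_dvd hU0
    rwa [map_sub, map_one, sub_eq_zero] at this
  have hC := C_mul_C_sign ε (σ := Fin 3)
  set c : MvPowerSeries (Fin 3) ℂ := C (Complex.I * ((ε : ℤ) : ℂ)) with hc
  set c' : MvPowerSeries (Fin 3) ℂ := C (-(Complex.I * ((ε : ℤ) : ℂ))) with hc'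
  -- Interchanging `ρ` and `ζ` and rescaling `ζ ≈ i ε χ` by `-i ε = (i ε)⁻¹` makes the map tangent
  -- to the identity; `L` below undoes this linear change.
  let A : Fin 3 → MvPowerSeries (Fin 3) ℂ := ![X 0, c' * S.slope, S.definingFunction]
  have two : ∀ {f g h : MvPowerSeries (Fin 3) ℂ}, constantCoeff f = 0 → constantCoeff g = 0 →
      h = f * g → 2 ≤ h.order := by
    rintro f g _ hf hg rfl
    exact_mod_cast nat_le_order_mul (n := 2) (one_le_order hf) (one_le_order hg) le_rfl
  have hA : ∀ i, 2 ≤ (A i - X i).order := by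
    refine forall_fin_three ?_ ?_ ?_
    · simp [A]
    · refine two (f := X 1) (g := U - 1) (by simp) (by simp [hUc]) ?_
      simp only [A, Matrix.cons_val_one, Matrix.cons_val_zero]
      rw [hU]
      linear_combination X 1 * U * hC
    · refine two (f := X 2) (g := S.expUnit - 1) (by simp)
        (by simp [S.constantCoeff_expUnit]) ?_
      simp only [A, Matrix.cons_val]
      rw [S.definingFunction_eq]
      ring
  obtain ⟨B₀, hB0, hAB, hBA, hconv⟩ := exists_inverse A hA
  let L : Fin 3 → MvPowerSeries (Fin 3) ℂ := ![X 0, c' * X 2, X 1]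
  have hL : ∀ i, constantCoeff (L i) = 0 := forall_fin_three (by simp [L]) (by simp [L])
    (by simp [L])
  have hLs := hasSubst_of_constantCoeff_zero hL
  have hVs := hasSubst_of_constantCoeff_zero S.constantCoeff_jet
  have hBs := hasSubst_of_constantCoeff_zero hB0
  let B : Fin 3 → MvPowerSeries (Fin 3) ℂ := fun i => (B₀ i).subst L
  have hBc : ∀ i, constantCoeff (B i) = 0 := fun i => by
    rw [constantCoeff_subst_eq hL, hB0]
  have hBcs := hasSubst_of_constantCoeff_zero hBc
  have hsC : ∀ (v : Fin 3 → MvPowerSeries (Fin 3) ℂ) (a : ℂ), (C a).subst v = C a :=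
    fun v a => subst_C _
  have hAL : ∀ i, (A i).subst B = L i := by
    intro i
    have : ((A i).subst B₀).subst L = L i := by rw [hAB, subst_X hLs]
    rwa [subst_comp_subst_apply hBs hLs] at this
  have hVB : ∀ i, ((![X 0, S.definingFunction, S.slope] :
      Fin 3 → MvPowerSeries (Fin 3) ℂ) i).subst B = X i := by
    refine forall_fin_three ?_ ?_ ?_
    · exact hAL 0
    · exact hAL 2
    · have h1 := hAL 1
      simp only [A, L, Matrix.cons_val_one, Matrix.cons_val_zero] at h1
      rw [subst_mul hBcs, hc', hsC, ← hc'] at h1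
      simp only [Matrix.cons_val]
      linear_combination c * h1 + (X 2 - S.slope.subst B) * hC
  refine ⟨B, hBc, fun i => ?_, hVB, ?_, fun h i => ?_⟩
  · simp only [B]
    rw [subst_comp_subst_apply hLs hVs, ← hBA i]
    congr 1
    funext j
    revert j
    refine forall_fin_three ?_ ?_ ?_
    · simp only [L, A, Matrix.cons_val_zero]
      rw [subst_X hVs]; rfl
    · simp only [L, A, Matrix.cons_val_one, Matrix.cons_val_zero]
      rw [subst_mul hVs, subst_X hVs, hc', hsC]; rfl
    · simp only [L, A, Matrix.cons_val]
      rw [subst_X hVs]; rfl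
  -- Along the inverse, `ζ = i ε · B 1 · U(B)` with `U(B)` a unit; so `χ = B 1` is a multiple of
  -- `ζ`.
  · have h1 := hVB 2
    simp only [Matrix.cons_val] at h1
    rw [hU, subst_mul hBcs, subst_mul hBcs, subst_X hBcs, hc, hsC, ← hc] at h1
    have h2 : U.subst B * (U.subst B)⁻¹ = 1 := MvPowerSeries.mul_inv_cancel _ (by
      rw [constantCoeff_subst_eq hBc, hUc]; exact one_ne_zero)
    refine ⟨c' * (U.subst B)⁻¹, ?_⟩
    linear_combination c' * (U.subst B)⁻¹ * h1 - B 1 * h2 - B 1 * U.subst B * (U.subst B)⁻¹ * hC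
  · refine (hconv (forall_fin_three ?_ ?_ ?_) i).subst hL (forall_fin_three ?_ ?_ ?_)
    · exact isConv_X _
    · exact (isConv_C _).mul (S.isConv_slope h)
    · exact S.isConv_definingFunction h
    · exact isConv_X _
    · exact (isConv_C _).mul (isConv_X _)
    · exact isConv_X _

/-- The coefficient of `χ` in the slope is the constant `i ε`. This uses that `φ` has no term linear
in `χ` other than `ε z χ`, and it is the reason why `Φ = O(ζ²)`. -/
theorem X_sq_dvd_pderiv_slope : X 1 ^ 2 ∣ pderiv ℂ 0 S.slope := by
  obtain ⟨U, hU, -, q, hq⟩ := S.exists_slope_eq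
  rw [sub_eq_iff_eq_add] at hq
  have h1 : pderiv ℂ (0 : Fin 3) (X 1) = 0 := pderiv_X_of_ne (by decide)
  refine ⟨C (Complex.I * ((ε : ℤ) : ℂ)) * pderiv ℂ 0 q, ?_⟩
  rw [hU, hq]
  simp only [map_add, Derivation.leibniz, h1, pderiv_C, pderiv_one, smul_eq_mul]
  ring

/-- Every Segre family satisfies a unique singular ordinary differential equation. -/
theorem exists_ode [NeZero m] : ∃ E : SingularODE m,
    E.IsSolution (k := 2) S.definingFunction ∧
    (∀ E' : SingularODE m, E'.IsSolution (k := 2) S.definingFunction → E = E') ∧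
    (IsConv S.φ → IsConv E.Φ) := by
  obtain ⟨B, hB0, hBV, hVB, hX, hconv⟩ := S.exists_jet_inverse
  have hBs := hasSubst_of_constantCoeff_zero hB0
  have hVs := hasSubst_of_constantCoeff_zero S.constantCoeff_jet
  -- The value that `Φ` must take along `(z, ρ, ζ)`; hence `Φ = h ∘ B` is the only candidate. It is
  -- `O(ζ²)` because `χ²` divides `h` and `ζ` divides `B 1`.
  set h : MvPowerSeries (Fin 3) ℂ :=
    pderiv ℂ 0 S.slope + m * S.definingFunction ^ (m - 1) * S.slope ^ 2 with hh
  have hdvd : X 1 ^ 2 ∣ h := by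
    refine dvd_add S.X_sq_dvd_pderiv_slope (Dvd.dvd.mul_left (pow_dvd_pow_of_dvd ?_ 2) _)
    obtain ⟨U, hU, -⟩ := S.exists_slope_eq
    exact ⟨C (Complex.I * ((ε : ℤ) : ℂ)) * U, by rw [hU]; ring⟩
  have hsol : (h.subst B).subst ![X 0, S.definingFunction, S.slope] = h := by
    rw [subst_comp_subst_apply hBs hVs]
    have : (fun i => (B i).subst ![X 0, S.definingFunction, S.slope]) = X := funext hBV
    rw [this, subst_self]; rfl
  have hinv : ∀ f : MvPowerSeries (Fin 3) ℂ,
      (f.subst ![X 0, S.definingFunction, S.slope]).subst B = f := by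
    intro f
    rw [subst_comp_subst_apply hVs hBs]
    have : (fun i => ((![X 0, S.definingFunction, S.slope] :
      Fin 3 → MvPowerSeries (Fin 3) ℂ) i).subst B) = X := funext hVB
    rw [this, subst_self]; rfl
  have hO : X 2 ^ 2 ∣ h.subst B := by
    obtain ⟨q, hq⟩ := hdvd
    rw [hq, subst_mul hBs, subst_pow hBs, subst_X hBs]
    exact Dvd.dvd.mul_right (pow_dvd_pow_of_dvd hX 2) _
  refine ⟨⟨h.subst B, hO⟩, (S.isSolution_iff _).2 hsol, fun E' hE' => ?_, fun hS => ?_⟩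
  · have := (S.isSolution_iff _).1 hE'
    ext1
    simp only
    rw [← hinv E'.Φ, this]
  · refine IsConv.subst ?_ hB0 (hconv hS)
    have hm : IsConv (m : MvPowerSeries (Fin 3) ℂ) := by
      simpa using isConv_C (σ := Fin 3) (m : ℂ)
    exact ((S.isConv_slope hS).pderiv _).add
      ((hm.mul ((S.isConv_definingFunction hS).pow _)).mul ((S.isConv_slope hS).pow _))

/-- Equal initial values give equal `ρ` and equal slopes. The phase is then recovered without a
logarithm: `φ_z = -i v^(m-1) ζ` with `v = exp(i τ^(m-1) φ)`, and `φ` vanishes for `z = 0`. -/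
theorem eq_of_isSolution [NeZero m] {S S' : SegreFamily m ε} {E : SingularODE m}
    (h : E.IsSolution (k := 2) S.definingFunction)
    (h' : E.IsSolution (k := 2) S'.definingFunction) : S = S' := by
  obtain ⟨h1, h2⟩ := (S.isSystemSolution h).eq (S'.isSystemSolution h')
    (by have := dvd_sub S.X_dvd_definingFunction_sub S'.X_dvd_definingFunction_sub
        rwa [sub_sub_sub_cancel_right] at this)
    (by have := dvd_sub S.X_dvd_slope_sub S'.X_dvd_slope_sub
        rwa [sub_sub_sub_cancel_right] at this)
  have hu : S.expUnit = S'.expUnit := mul_left_cancel₀ (X_ne_zero 2) h1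
  have hI : (C Complex.I * C (-Complex.I) : MvPowerSeries (Fin 3) ℂ) = 1 := by
    rw [← map_mul]; simp
  have hφ : pderiv ℂ 0 S.φ = pderiv ℂ 0 S'.φ := by
    have h3 : S.expUnit ^ (m - 1) * S.expUnit⁻¹ ^ (m - 1) = 1 := by
      rw [← mul_pow, S.expUnit_mul_inv, one_pow]
    rw [slope, slope, ← hu] at h2
    linear_combination C (-Complex.I) * S.expUnit ^ (m - 1) * h2 -
      (pderiv ℂ 0 S.φ - pderiv ℂ 0 S'.φ) * h3 -
      (pderiv ℂ 0 S.φ - pderiv ℂ 0 S'.φ) * S.expUnit ^ (m - 1) * S.expUnit⁻¹ ^ (m - 1) * hI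
  ext1
  rw [← sub_eq_zero]
  refine eq_zero_of_pderiv_eq_zero (j := 0) (by rw [map_sub, hφ, sub_self]) (dvd_sub ?_ ?_)
  · exact (dvd_mul_right _ _).trans S.X_dvd_φ
  · exact (dvd_mul_right _ _).trans S'.X_dvd_φ

end SegreFamily

/-- The first-order system for `(φ, ζ)`, solved with the initial values `φ = 0`, `ζ = i ε χ`. -/
theorem SingularODE.exists_phase (ε : ℤˣ) (E : SingularODE m) :
    ∃ φ ζ : MvPowerSeries (Fin 3) ℂ, constantCoeff ζ = 0 ∧ X 0 ∣ φ ∧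
      X 0 ∣ ζ - C (Complex.I * ((ε : ℤ) : ℂ)) * X 1 ∧
      pderiv ℂ 0 φ = C (-Complex.I) *
        (PowerSeries.exp ℂ).subst (C Complex.I * X 2 ^ (m - 1) * φ) ^ (m - 1) * ζ ∧
      pderiv ℂ 0 ζ = E.Φ.subst ![X 0,
          X 2 * (PowerSeries.exp ℂ).subst (C Complex.I * X 2 ^ (m - 1) * φ), ζ] -
        (m : MvPowerSeries (Fin 3) ℂ) * (X 2 * (PowerSeries.exp ℂ).subst (C Complex.I * X 2 ^ (m - 1) * φ)) ^ (m - 1) * ζ ^ 2 ∧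
      (IsConv E.Φ → IsConv φ) := by
  -- `Sum.inl` carries the variables `(z, χ, τ)`, `Sum.inr` the unknowns `(φ, ζ)`. Taking `φ` as
  -- unknown builds in the form `ρ = τ exp(i τ^(m-1) φ)`; in `ρ_z = ρ^m ζ` the powers of `τ` cancel
  -- and leave the regular equation `φ_z = -i v^(m-1) ζ`.
  let a : MvPowerSeries (Fin 3 ⊕ Fin 2) ℂ :=
    C Complex.I * X (Sum.inl 2) ^ (m - 1) * X (Sum.inr 0)
  have ha : constantCoeff a = 0 := by simp [a]
  let v : MvPowerSeries (Fin 3 ⊕ Fin 2) ℂ := (PowerSeries.exp ℂ).subst a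
  let w : Fin 3 → MvPowerSeries (Fin 3 ⊕ Fin 2) ℂ :=
    ![X (Sum.inl 0), X (Sum.inl 2) * v, X (Sum.inr 1)]
  have hw : ∀ i, constantCoeff (w i) = 0 := forall_fin_three (by simp [w]) (by simp [w])
    (by simp [w])
  let P : Fin 2 → MvPowerSeries (Fin 3 ⊕ Fin 2) ℂ :=
    ![C (-Complex.I) * v ^ (m - 1) * X (Sum.inr 1),
      E.Φ.subst w - C (m : ℂ) * (X (Sum.inl 2) * v) ^ (m - 1) * X (Sum.inr 1) ^ 2]
  let y₀ : Fin 2 → MvPowerSeries (Fin 3) ℂ := ![0, C (Complex.I * ((ε : ℤ) : ℂ)) * X 1]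
  have hy₀ : ∀ i, constantCoeff (y₀ i) = 0 := by
    intro i; fin_cases i <;> simp [y₀]
  obtain ⟨y, hy0, hy1, hy2, hconv⟩ := SegreODE.exists_ode (0 : Fin 3) P y₀ hy₀
  have hd : ∀ i, pderiv ℂ 0 (y₀ i) = 0 := by
    have h1 : pderiv ℂ (0 : Fin 3) (X 1) = 0 := pderiv_X_of_ne (by decide)
    intro i; fin_cases i
    · simp [y₀]
    · simp [y₀, Derivation.leibniz, h1]
  have hc := constantCoeff_sumElim hy0
  have hs := hasSubst_of_constantCoeff_zero hc
  have hsC : ∀ b : ℂ, (C b : MvPowerSeries (Fin 3 ⊕ Fin 2) ℂ).subst (Sum.elim X y) = C b :=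
    fun b => subst_C _
  have hsl : ∀ i, (X (Sum.inl i) : MvPowerSeries (Fin 3 ⊕ Fin 2) ℂ).subst (Sum.elim X y) = X i :=
    fun i => subst_X hs _
  have hsr : ∀ i, (X (Sum.inr i) : MvPowerSeries (Fin 3 ⊕ Fin 2) ℂ).subst (Sum.elim X y) = y i :=
    fun i => subst_X hs _
  have hsv : v.subst (Sum.elim X y) =
      (PowerSeries.exp ℂ).subst (C Complex.I * X 2 ^ (m - 1) * y 0) := by
    simp only [v]
    rw [exp_subst_subst ha hc]
    simp only [a]
    rw [subst_mul hs, subst_mul hs, subst_pow hs, hsC, hsl, hsr]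
  refine ⟨y 0, y 1, hy0 1, ?_, hy2 1, ?_, ?_, fun hE => ?_⟩
  · simpa [y₀] using hy2 0
  · have := hy1 0
    rw [hd, zero_add] at this
    rw [this]
    simp only [P, Matrix.cons_val_zero]
    rw [subst_mul hs, subst_mul hs, subst_pow hs, hsC, hsr, hsv]
  · have := hy1 1
    rw [hd, zero_add] at this
    rw [this]
    simp only [P, Matrix.cons_val_one, Matrix.cons_val_zero]
    have hm : (m : MvPowerSeries (Fin 3) ℂ) = C (m : ℂ) := by simp
    rw [subst_sub hs, subst_mul hs, subst_mul hs, subst_pow hs, subst_pow hs, subst_mul hs, hsC,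
      hsl, hsr, hsv, hm, subst_comp_subst_apply (hasSubst_of_constantCoeff_zero hw) hs]
    congr 2
    funext i
    revert i
    refine forall_fin_three ?_ ?_ ?_
    · exact hsl 0
    · simp only [w, Matrix.cons_val_one, Matrix.cons_val_zero]
      rw [subst_mul hs, hsl, hsv]
    · exact hsr 1
  · have hv : IsConv v := ((((isConv_C _).mul ((isConv_X _).pow _)).mul (isConv_X _))).exp_subst ha
    refine hconv ?_ ?_ 0
    · intro i; fin_cases i
      · exact ((isConv_C _).mul (hv.pow _)).mul (isConv_X _)
      · refine (IsConv.subst hE hw (forall_fin_three ?_ ?_ ?_)).sub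
          (((isConv_C _).mul (((isConv_X _).mul hv).pow _)).mul ((isConv_X _).pow _))
        · exact isConv_X _
        · exact (isConv_X _).mul hv
        · exact isConv_X _
    · intro i; fin_cases i
      · exact isConv_zero
      · exact (isConv_C _).mul (isConv_X _)

/-- Every singular ordinary differential equation is satisfied by a Segre family. -/
theorem SingularODE.exists_segre [NeZero m] (ε : ℤˣ) (E : SingularODE m) :
    ∃ S : SegreFamily m ε, E.IsSolution (k := 2) S.definingFunction ∧
      (IsConv E.Φ → IsConv S.φ) := by
  obtain ⟨φ, ζ, hζ0, hφ, hζ, hφ', hζ', hconv⟩ := E.exists_phase ε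
  set a : MvPowerSeries (Fin 3) ℂ := C Complex.I * X 2 ^ (m - 1) * φ with ha
  set v : MvPowerSeries (Fin 3) ℂ := (PowerSeries.exp ℂ).subst a with hv
  have hac : constantCoeff a = 0 := constantCoeff_eq_zero_of_X_dvd (hφ.mul_left _)
  have hv1 : φ ∣ v - 1 := (dvd_mul_left _ _).trans (dvd_exp_subst_sub_one hac)
  have hvc : constantCoeff v = 1 := constantCoeff_exp_subst hac
  have hvm : φ ∣ v ^ (m - 1) - 1 := by
    have := sub_dvd_pow_sub_pow v 1 (m - 1)
    rw [one_pow] at this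
    exact hv1.trans this
  have h10 : (1 : Fin 3) ≠ 0 := by decide
  have hX1 : pderiv ℂ (0 : Fin 3) (X 1) = 0 := pderiv_X_of_ne h10
  have hI : (C Complex.I * C (-Complex.I) : MvPowerSeries (Fin 3) ℂ) = 1 := by
    rw [← map_mul]; simp
  -- Both terms of `ζ_z` are quadratic in `ζ`. Read as a linear homogeneous equation, this
  -- propagates `χ ∣ ζ` from `z = 0`; then `ζ_z` is divisible by `χ²`, so `ζ - i ε χ` is too.
  have hζsq : ∃ p, pderiv ℂ 0 ζ = ζ ^ 2 * p := by
    obtain ⟨q, hq⟩ := E.isBigO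
    have hcs := constantCoeff_vec_three (constantCoeff_X (R := ℂ) (0 : Fin 3))
      (show constantCoeff (X 2 * v) = 0 by simp) hζ0
    have hs := hasSubst_of_constantCoeff_zero hcs
    rw [hζ', hq, subst_mul hs, subst_pow hs, subst_X hs]
    exact ⟨q.subst ![X 0, X 2 * v, ζ] - (m : MvPowerSeries (Fin 3) ℂ) * (X 2 * v) ^ (m - 1), by
      simp only [Matrix.cons_val]; ring⟩
  obtain ⟨p, hp⟩ := hζsq
  have hχ : X 1 ∣ ζ := by
    refine X_dvd_of_pderiv_eq_mul h10 (p := ζ * p) (by rw [hp]; ring) fun d h0 h1 => ?_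
    have := X_dvd_iff.1 hζ d h0
    rw [map_sub, X_dvd_iff.1 (dvd_mul_left (X 1) (C (Complex.I * ((ε : ℤ) : ℂ)))) d h1,
      sub_zero] at this
    exact this
  have hχ2 : X 1 ^ 2 ∣ ζ - C (Complex.I * ((ε : ℤ) : ℂ)) * X 1 := by
    refine X_pow_dvd_of_pderiv h10 hζ ?_
    rw [map_sub, hp, Derivation.leibniz, hX1, pderiv_C]
    simp only [smul_zero, add_zero, sub_zero]
    exact (pow_dvd_pow_of_dvd hχ 2).mul_right _
  have hχφ : X 1 ∣ φ := by
    have := X_pow_dvd_of_pderiv (n := 1) h10 hφ (by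
      rw [hφ', pow_one]; exact hχ.mul_left _)
    rwa [pow_one] at this
  have hC : (C (-Complex.I) * C (Complex.I * ((ε : ℤ) : ℂ)) : MvPowerSeries (Fin 3) ℂ) =
      C ((ε : ℤ) : ℂ) := by
    rw [← map_mul]
    congr 1
    linear_combination (-((ε : ℤ) : ℂ)) * Complex.I_mul_I
  have hdiff : pderiv ℂ 0 (φ - C ((ε : ℤ) : ℂ) * X 0 * X 1) =
      C (-Complex.I) * (v ^ (m - 1) - 1) * ζ +
        C (-Complex.I) * (ζ - C (Complex.I * ((ε : ℤ) : ℂ)) * X 1) := by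
    rw [map_sub, hφ']
    simp only [Derivation.leibniz, hX1, pderiv_C, pderiv_X_self, smul_eq_mul]
    linear_combination X 1 * hC
  have h0 : X 0 ∣ φ - C ((ε : ℤ) : ℂ) * X 0 * X 1 :=
    dvd_sub hφ ((dvd_mul_left _ _).mul_right _)
  -- In the `z`-derivative given by `hdiff`, `v^(m-1) - 1` is a multiple of `φ`, hence of `z` and of
  -- `χ`, while `ζ` brings another `χ`; and `ζ - i ε χ` is divisible by `z` and by `χ²`. Integration
  -- in `z` adds the second factor `z`.
  have hadm : X 0 ^ 2 * X 1 ^ 2 ∣ φ - C ((ε : ℤ) : ℂ) * X 0 * X 1 := by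
    refine X_pow_mul_X_pow_dvd (by decide) ?_ ?_
    · refine X_pow_succ_dvd_of_pderiv (n := 1) h0 ?_
      rw [pow_one, hdiff]
      exact dvd_add (((hφ.trans hvm).mul_left _).mul_right _) (hζ.mul_left _)
    · refine X_pow_dvd_of_pderiv h10 h0 ?_
      rw [hdiff]
      refine dvd_add ?_ (hχ2.mul_left _)
      rw [pow_two]
      exact mul_dvd_mul ((hχφ.trans hvm).mul_left _) hχ
  let S : SegreFamily m ε := ⟨φ, hadm⟩
  have hslope : S.slope = ζ := by
    have h3 : v ^ (m - 1) * v⁻¹ ^ (m - 1) = 1 := by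
      rw [← mul_pow, MvPowerSeries.mul_inv_cancel _ (by rw [hvc]; exact one_ne_zero), one_pow]
    change C Complex.I * pderiv ℂ 0 φ * v⁻¹ ^ (m - 1) = ζ
    rw [hφ']
    linear_combination ζ * v ^ (m - 1) * v⁻¹ ^ (m - 1) * hI + ζ * h3
  refine ⟨S, (S.isSolution_iff E).2 ?_, hconv⟩
  rw [hslope, hζ']
  change E.Φ.subst ![X 0, X 2 * v, ζ] = E.Φ.subst ![X 0, X 2 * v, ζ] -
    (m : MvPowerSeries (Fin 3) ℂ) * (X 2 * v) ^ (m - 1) * ζ ^ 2 + (m : MvPowerSeries (Fin 3) ℂ) * (X 2 * v) ^ (m - 1) * ζ ^ 2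
  ring

end Objects

end SegreODE

namespace SegreODE

open MvPowerSeries Filter Topology
open scoped ENNReal

/-! ### Restriction of a family to `z = 0`. -/

section Restriction

theorem subst_congr_of_coeff {σ τ : Type*} [Fintype σ] [Fintype τ] {a b : σ → MvPowerSeries τ ℂ}
    (ha : ∀ i, constantCoeff (a i) = 0) (hb : ∀ i, constantCoeff (b i) = 0)
    {f : MvPowerSeries σ ℂ} (h : ∀ d, coeff d f ≠ 0 → ∀ i, a i ≠ b i → d i = 0) :
    f.subst a = f.subst b := by
  ext e
  rw [coeff_subst (hasSubst_of_constantCoeff_zero ha),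
    coeff_subst (hasSubst_of_constantCoeff_zero hb)]
  refine finsum_congr fun d => ?_
  by_cases h0 : coeff d f = 0
  · simp [h0]
  rw [Finsupp.prod_fintype _ _ (by simp), Finsupp.prod_fintype _ _ (by simp)]
  congr 2
  refine Finset.prod_congr rfl fun i _ => ?_
  by_cases hi : a i = b i
  · rw [hi]
  · rw [h d h0 i hi, pow_zero, pow_zero]

theorem constantCoeff_cons {k n : ℕ} {g : MvPowerSeries (Fin n) ℂ} (hg : constantCoeff g = 0)
    {v : Fin k → MvPowerSeries (Fin n) ℂ} (hv : ∀ i, constantCoeff (v i) = 0) :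
    ∀ i, constantCoeff ((Fin.cons g v : Fin (k + 1) → MvPowerSeries (Fin n) ℂ) i) = 0 := by
  intro i
  refine Fin.cases ?_ (fun j => ?_) i
  · simpa using hg
  · simpa using hv j

variable {k : ℕ}

/-- The value of a power series for `X 0 = 0`. -/
def initialValue (f : MvPowerSeries (Fin (k + 1)) ℂ) : MvPowerSeries (Fin (k + 1)) ℂ :=
  f.subst (Fin.cons 0 fun i => X i.succ : Fin (k + 1) → MvPowerSeries (Fin (k + 1)) ℂ)

theorem constantCoeff_cons_X {g : MvPowerSeries (Fin (k + 1)) ℂ} (hg : constantCoeff g = 0) :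
    ∀ i, constantCoeff ((Fin.cons g fun i => X i.succ :
      Fin (k + 1) → MvPowerSeries (Fin (k + 1)) ℂ) i) = 0 :=
  constantCoeff_cons hg fun _ => constantCoeff_X _

theorem constantCoeff_initialValue (f : MvPowerSeries (Fin (k + 1)) ℂ) :
    constantCoeff (initialValue f) = constantCoeff f :=
  constantCoeff_subst_eq (constantCoeff_cons_X (map_zero _)) f

theorem pderiv_initialValue (f : MvPowerSeries (Fin (k + 1)) ℂ) :
    pderiv ℂ 0 (initialValue f) = 0 := by
  rw [initialValue, pderiv_subst (constantCoeff_cons_X (map_zero _))]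
  refine Finset.sum_eq_zero fun i _ => ?_
  refine Fin.cases ?_ (fun j => ?_) i
  · simp
  · rw [Fin.cons_succ, pderiv_X_of_ne (Fin.succ_ne_zero j), mul_zero]

/-- Initial values do not involve `z`, so replacing `z` by `F(z, ρ)` in a transformed graph leaves
the parameters of a solution alone. -/
theorem initialValue_subst_cons (f : MvPowerSeries (Fin (k + 1)) ℂ)
    {g : MvPowerSeries (Fin (k + 1)) ℂ} (hg : constantCoeff g = 0) :
    (initialValue f).subst (Fin.cons g fun i => X i.succ :
      Fin (k + 1) → MvPowerSeries (Fin (k + 1)) ℂ) = initialValue f := by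
  have hs := hasSubst_of_constantCoeff_zero (constantCoeff_cons_X hg)
  rw [initialValue, subst_comp_subst_apply (hasSubst_of_constantCoeff_zero
    (constantCoeff_cons_X (map_zero _))) hs]
  congr 1
  funext i
  refine Fin.cases ?_ (fun j => ?_) i
  · rw [Fin.cons_zero, ← coe_substAlgHom hs, map_zero]
  · rw [Fin.cons_succ, subst_X hs]; rfl

theorem X_dvd_sub_initialValue (f : MvPowerSeries (Fin (k + 1)) ℂ) :
    X 0 ∣ f - initialValue f := by
  let f₀ : MvPowerSeries (Fin (k + 1)) ℂ := fun d => if d 0 = 0 then coeff d f else 0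
  have hf₀ : ∀ d, coeff d f₀ = if d 0 = 0 then coeff d f else 0 := fun _ => rfl
  have h1 : X 0 ∣ f - f₀ := by
    rw [X_dvd_iff]
    intro d hd
    rw [map_sub, hf₀, if_pos hd, sub_self]
  have hc := constantCoeff_cons_X (k := k) (map_zero _)
  have hs := hasSubst_of_constantCoeff_zero hc
  have h2 : initialValue f₀ = f₀ := by
    have := subst_congr_of_coeff hc (b := X) (by simp) (f := f₀) fun d hd i => by
      rw [hf₀] at hd
      have hd0 : d 0 = 0 := by
        by_contra h
        rw [if_neg h] at hd
        exact hd rfl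
      refine Fin.cases (fun _ => hd0) (fun j h => ?_) i
      exact absurd rfl h
    rw [subst_self] at this
    exact this
  have h3 : initialValue f = f₀ := by
    obtain ⟨q, hq⟩ := h1
    rw [sub_eq_iff_eq_add] at hq
    rw [← h2, hq, initialValue, subst_add hs, subst_mul hs, subst_X hs, Fin.cons_zero, zero_mul,
      zero_add]
    rfl
  rwa [h3]

theorem cons_X_eq (g : MvPowerSeries (Fin 3) ℂ) :
    (Fin.cons g fun i : Fin 2 => X i.succ : Fin 3 → MvPowerSeries (Fin 3) ℂ) = ![g, X 1, X 2] := by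
  funext i
  fin_cases i <;> rfl

end Restriction

/-! ### Transformation of solutions and slopes under normalized maps. -/

section Morphisms

variable {m : ℕ} {ε : ℤˣ} {k : ℕ}

/-- The members of the Segre family of an equation are all its solutions. -/
theorem SegreFamily.eq_subst_of_isSystemSolution [NeZero m] (S : SegreFamily m ε)
    {E : SingularODE m} (hS : E.IsSolution (k := 2) S.definingFunction)
    {ρ ζ : MvPowerSeries (Fin (k + 1)) ℂ} (h : E.IsSystemSolution ρ ζ) :
    ρ = S.definingFunction.subst
      ![X 0, C (-(Complex.I * ((ε : ℤ) : ℂ))) * initialValue ζ, initialValue ρ] ∧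
    ζ = S.slope.subst
      ![X 0, C (-(Complex.I * ((ε : ℤ) : ℂ))) * initialValue ζ, initialValue ρ] := by
  -- Chosen so that the member with parameters `(a, b)` starts at `z = 0` with value `b = ρ(0, t)`
  -- and slope `i ε a = ζ(0, t)`; uniqueness does the rest.
  set a := C (-(Complex.I * ((ε : ℤ) : ℂ))) * initialValue ζ with ha
  set b := initialValue ρ with hb
  have ha0 : constantCoeff a = 0 := by
    rw [ha, map_mul, constantCoeff_initialValue, h.constantCoeff_snd, mul_zero]
  have hb0 : constantCoeff b = 0 := by
    rw [hb, constantCoeff_initialValue, h.constantCoeff_fst]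
  have hc := constantCoeff_vec_three (constantCoeff_X (R := ℂ) (0 : Fin (k + 1))) ha0 hb0
  have hs := hasSubst_of_constantCoeff_zero hc
  refine h.eq ((S.isSystemSolution hS).subst ha0 hb0 ?_ (pderiv_initialValue _)) ?_ ?_
  · rw [ha, Derivation.leibniz, pderiv_initialValue, pderiv_C]; simp
  · obtain ⟨q, hq⟩ := S.X_dvd_definingFunction_sub
    rw [sub_eq_iff_eq_add] at hq
    rw [hq, subst_add hs, subst_mul hs, subst_X hs, subst_X hs]
    have : ρ - (![X 0, a, b] 0 * q.subst ![X 0, a, b] + ![X 0, a, b] 2) =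
        (ρ - initialValue ρ) - X 0 * q.subst ![X 0, a, b] := by
      simp only [Matrix.cons_val, hb]; ring
    rw [this]
    exact dvd_sub (X_dvd_sub_initialValue ρ) (dvd_mul_right _ _)
  · obtain ⟨q, hq⟩ := S.X_dvd_slope_sub
    rw [sub_eq_iff_eq_add] at hq
    have hC : (C (Complex.I * ((ε : ℤ) : ℂ)) : MvPowerSeries (Fin 3) ℂ).subst ![X 0, a, b] =
      C (Complex.I * ((ε : ℤ) : ℂ)) := subst_C _
    rw [hq, subst_add hs, subst_mul hs, subst_mul hs, subst_X hs, subst_X hs, hC]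
    have : ζ - (![X 0, a, b] 0 * q.subst ![X 0, a, b] +
        C (Complex.I * ((ε : ℤ) : ℂ)) * ![X 0, a, b] 1) =
        (ζ - initialValue ζ) - X 0 * q.subst ![X 0, a, b] := by
      simp only [Matrix.cons_val, ha]
      linear_combination -initialValue ζ * C_mul_C_sign ε (σ := Fin (k + 1))
    rw [this]
    exact dvd_sub (X_dvd_sub_initialValue ζ) (dvd_mul_right _ _)

/-- A morphism of Segre families transforms the solutions of the associated equations. -/
theorem SegreFamily.Hom.transforms [NeZero m] {S₁ S₂ : SegreFamily m ε} (h : S₁.Hom S₂)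
    {E₁ E₂ : SingularODE m} (h₁ : E₁.IsSolution (k := 2) S₁.definingFunction)
    (h₂ : E₂.IsSolution (k := 2) S₂.definingFunction) (ρ : MvPowerSeries (Fin (k + 1)) ℂ)
    (hρ : E₁.IsSolution ρ) : ∃ ρ', E₂.IsSolution ρ' ∧ h.planar.TransformsGraph ρ ρ' := by
  obtain ⟨ζ, hsys⟩ := hρ.exists_isSystemSolution
  obtain ⟨hρ', -⟩ := S₁.eq_subst_of_isSystemSolution h₁ hsys
  set a := C (-(Complex.I * ((ε : ℤ) : ℂ))) * initialValue ζ with ha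
  set b := initialValue ρ with hb
  have ha0 : constantCoeff a = 0 := by
    rw [ha, map_mul, constantCoeff_initialValue, hsys.constantCoeff_snd, mul_zero]
  have hb0 : constantCoeff b = 0 := by
    rw [hb, constantCoeff_initialValue, hsys.constantCoeff_fst]
  have ha' : pderiv ℂ 0 a = 0 := by
    rw [ha, Derivation.leibniz, pderiv_initialValue, pderiv_C]; simp
  have hb' : pderiv ℂ 0 b = 0 := pderiv_initialValue _
  have hab := constantCoeff_vec_two ha0 hb0
  have hXab := constantCoeff_vec_three (constantCoeff_X (R := ℂ) (0 : Fin (k + 1))) ha0 hb0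
  have hX12 := constantCoeff_vec_two (constantCoeff_X (R := ℂ) (1 : Fin 3)) (constantCoeff_X 2)
  have hXρ := constantCoeff_vec_two (constantCoeff_X (R := ℂ) (0 : Fin 3))
    S₁.constantCoeff_definingFunction
  have hpd : ∀ f : MvPowerSeries (Fin 2) ℂ, pderiv ℂ 0 (f.subst ![a, b]) = 0 := by
    intro f
    rw [pderiv_subst hab, Fin.sum_univ_two]
    simp [ha', hb']
  have hA0 : constantCoeff ((conj h.param.F).subst ![a, b]) = 0 := by
    rw [constantCoeff_subst_eq hab, constantCoeff_conj h.param.F_zero]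
  have hB0 : constantCoeff ((conj h.param.G).subst ![a, b]) = 0 := by
    rw [constantCoeff_subst_eq hab, constantCoeff_conj h.param.G_zero]
  have hF0 : constantCoeff (h.planar.F.subst ![X 0, S₁.definingFunction]) = 0 := by
    rw [constantCoeff_subst_eq hXρ, h.planar.F_zero]
  -- As `ρ` is the member of the first Segre family with parameters `(a, b)`, its image is the
  -- member of the second one with parameters `(Λ̄(a, b), Ω̄(a, b))`; these do not depend on `z`.
  refine ⟨S₂.definingFunction.subst ![X 0, (conj h.param.F).subst ![a, b],
    (conj h.param.G).subst ![a, b]],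
    ((S₂.isSystemSolution h₂).subst hA0 hB0 (hpd _) (hpd _)).isSolution, ?_⟩
  have hpl : ∀ f : MvPowerSeries (Fin 2) ℂ, (f.subst ![X 0, S₁.definingFunction]).subst ![X 0, a, b]
      = f.subst ![X 0, ρ] := by
    intro f
    rw [subst_subst_two (constantCoeff_X _) S₁.constantCoeff_definingFunction hXab,
      subst_X_eq hXab, ← hρ']
    rfl
  have hpa : ∀ f : MvPowerSeries (Fin 2) ℂ,
      (f.subst ![(X 1 : MvPowerSeries (Fin 3) ℂ), X 2]).subst ![X 0, a, b] = f.subst ![a, b] := by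
    intro f
    rw [subst_subst_two (constantCoeff_X _) (constantCoeff_X _) hXab,
      subst_X_eq hXab, subst_X_eq hXab]
    rfl
  have hmap := congrArg (MvPowerSeries.subst ![X 0, a, b]) h.maps_into
  rw [hpl, subst_subst_three hF0 (by rw [constantCoeff_subst_eq hX12,
      constantCoeff_conj h.param.F_zero]) (by rw [constantCoeff_subst_eq hX12,
      constantCoeff_conj h.param.G_zero]) hXab, hpl, hpa, hpa] at hmap
  have hFρ : constantCoeff (h.planar.F.subst ![X 0, ρ]) = 0 := by
    rw [constantCoeff_subst_eq (constantCoeff_vec_two (constantCoeff_X _) hρ.1), h.planar.F_zero]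
  have hcc := constantCoeff_cons_X hFρ
  have hcs := hasSubst_of_constantCoeff_zero hcc
  have hfix : ∀ f : MvPowerSeries (Fin 2) ℂ, (f.subst ![a, b]).subst
      (Fin.cons (h.planar.F.subst ![X 0, ρ]) fun i => X i.succ :
        Fin (k + 1) → MvPowerSeries (Fin (k + 1)) ℂ) = f.subst ![a, b] := by
    intro f
    rw [subst_subst_two ha0 hb0 hcc, hb, initialValue_subst_cons ρ hFρ, ha, subst_mul hcs,
      initialValue_subst_cons ζ hFρ]
    congr 2
    exact congrArg (· * initialValue ζ) (subst_C _)
  unfold NormalizedMap.TransformsGraph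
  rw [hmap, subst_subst_three (constantCoeff_X _) hA0 hB0 hcc, hfix, hfix, subst_X_eq hcc]
  rfl

namespace NormalizedMap

/-- The form of `G` enters here: `w^m` divides `G_z`, so the transformed derivative can be divided
by `ρ^m`, and the extra factor `w` in `g = O(zw)` gives `κ(0) = 0`. -/
theorem exists_G_factor (h : NormalizedMap m) (hm : m ≠ 0) : ∃ γ κ, h.G = X 1 * γ ∧
    pderiv ℂ 0 h.G = X 1 ^ m * κ ∧ constantCoeff γ = 1 ∧ constantCoeff κ = 0 := by
  obtain ⟨g₀, g, hG, hg₀, ⟨q, rfl⟩, -⟩ := h.G_normalized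
  have h1 : pderiv ℂ (0 : Fin 2) (X 1) = 0 := pderiv_X_of_ne (by decide)
  have hg₁ : pderiv ℂ (0 : Fin 2) (g₀.subst (X 1 : MvPowerSeries (Fin 2) ℂ)) = 0 := by
    have := pderiv_subst (σ := Unit) (a := fun _ => (X 1 : MvPowerSeries (Fin 2) ℂ))
      (fun _ => constantCoeff_X _) 0 g₀
    rw [Fintype.sum_unique, h1, mul_zero] at this
    exact this
  have hg₂ : constantCoeff (g₀.subst (X 1 : MvPowerSeries (Fin 2) ℂ)) = 0 :=
    PowerSeries.constantCoeff_subst_eq_zero (constantCoeff_X _) _ hg₀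
  refine ⟨1 + g₀.subst (X 1 : MvPowerSeries (Fin 2) ℂ) + X 1 ^ m * (X 0 * q),
    X 1 * pderiv ℂ 0 (X 0 * q), ?_, ?_, ?_, ?_⟩
  · rw [hG]; ring
  · rw [hG]
    have : X 1 ^ m * (X 0 * X 1 * q) = X 1 ^ (m + 1) * (X 0 * q) := by ring
    rw [this]
    generalize X 0 * q = Q
    simp only [map_add, Derivation.leibniz, h1, hg₁, pderiv_pow, smul_eq_mul]
    ring
  · simp [hg₂, hm]
  · simp

/-- The normalization leaves `c = F_w(0)` free, so `F - z` may have a linear term in `w`, which must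
be split off before the inversion result for maps tangent to the identity applies. -/
theorem exists_F_eq (h : NormalizedMap m) :
    ∃ (c : ℂ) (R : MvPowerSeries (Fin 2) ℂ), h.F = X 0 + C c * X 1 + R ∧ 2 ≤ R.order := by
  classical
  refine ⟨coeff (Finsupp.single 1 1) h.F, h.F - X 0 - C (coeff (Finsupp.single 1 1) h.F) * X 1,
    by ring, ?_⟩
  refine nat_le_order_iff (k := 2).2 fun d hd => ?_
  have hne : (Finsupp.single (1 : Fin 2) 1 : Fin 2 →₀ ℕ) ≠ Finsupp.single 0 1 := by
    intro h
    have := DFunLike.congr_fun h 0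
    simp at this
  by_cases h0 : d = 0
  · subst h0
    simp [h.F_zero]
  · obtain ⟨e, i, rfl⟩ := exists_eq_add_single h0
    rw [map_add, Finsupp.degree_single] at hd
    have he : e = 0 := by rw [← Finsupp.degree_eq_zero_iff]; omega
    subst he
    rw [zero_add, map_sub, map_sub, coeff_C_mul]
    fin_cases i
    · simp [coeff_X, h.F_z, hne.symm]
    · simp [coeff_X, hne]

variable [NeZero m]

theorem constantCoeff_F_subst (h : NormalizedMap m) (S : SegreFamily m ε) :
    constantCoeff (h.F.subst ![X 0, S.definingFunction]) = 0 := by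
  rw [constantCoeff_subst_eq (constantCoeff_vec_two (constantCoeff_X _)
    S.constantCoeff_definingFunction), h.F_zero]

/-- The parametrization `z = z(χ, τ)` of the points of a Segre family which are mapped to
the line `F = 0`. -/
theorem exists_zero (h : NormalizedMap m) (S : SegreFamily m ε) :
    ∃ z : MvPowerSeries (Fin 2) ℂ, constantCoeff z = 0 ∧
      (h.F.subst ![X 0, S.definingFunction]).subst ![z, X 0, X 1] = 0 ∧
      (IsConv S.φ → IsConv h.F → IsConv z) := by
  obtain ⟨c, R, hF, hR⟩ := h.exists_F_eq
  have hv := constantCoeff_vec_two (constantCoeff_X (R := ℂ) (0 : Fin 3))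
    S.constantCoeff_definingFunction
  have hvs := hasSubst_of_constantCoeff_zero hv
  set f := h.F.subst ![X 0, S.definingFunction] with hf
  have hf0 : constantCoeff f = 0 := h.constantCoeff_F_subst S
  have hsC : ∀ {n l : ℕ} (v : Fin n → MvPowerSeries (Fin l) ℂ),
    (C c : MvPowerSeries (Fin n) ℂ).subst v = C c := fun v => subst_C _
  have hfe : f = X 0 + C c * S.definingFunction + R.subst ![X 0, S.definingFunction] := by
    rw [hf, hF, subst_add hvs, subst_add hvs, subst_mul hvs, hsC, subst_X hvs, subst_X hvs]
    rfl
  -- Along the family `w = τ` to first order, so subtracting `c τ` makes the map tangent to the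
  -- identity. Its inverse turns `f` into `z + c τ`, whose zero set `z = -c τ` is parametrized by
  -- `V`.
  obtain ⟨B, hB0, hAB, -, hconv⟩ := exists_inverse ![f - C c * X 2, X 1, X 2]
    (forall_fin_three (by
      simp only [Matrix.cons_val_zero]
      have : f - C c * X 2 - X 0 = X 2 * (C c * (S.expUnit - 1)) +
          R.subst ![X 0, S.definingFunction] := by
        rw [hfe, S.definingFunction_eq]; ring
      rw [this]
      exact nat_le_order_add (k := 2)
        (nat_le_order_mul (one_le_order (constantCoeff_X _))
          (one_le_order (by simp [S.constantCoeff_expUnit])) le_rfl)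
        (nat_le_order_subst hR hv)) (by simp) (by simp))
  have hBs := hasSubst_of_constantCoeff_zero hB0
  have hB1 : B 1 = X 1 := by
    have := hAB 1
    simp only [Matrix.cons_val_one, Matrix.cons_val_zero] at this
    rwa [subst_X hBs] at this
  have hB2 : B 2 = X 2 := by
    have := hAB 2
    simp only [Matrix.cons_val] at this
    rwa [subst_X hBs] at this
  have hfB : f.subst B = X 0 + C c * X 2 := by
    have := hAB 0
    simp only [Matrix.cons_val_zero] at this
    rw [subst_sub hBs, subst_mul hBs, subst_X hBs, hsC, hB2] at this
    linear_combination this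
  let V : Fin 3 → MvPowerSeries (Fin 2) ℂ := ![-(C c * X 1), X 0, X 1]
  have hV : ∀ i, constantCoeff (V i) = 0 := forall_fin_three (by simp [V]) (by simp [V])
    (by simp [V])
  have hVs := hasSubst_of_constantCoeff_zero hV
  refine ⟨(B 0).subst V, by rw [constantCoeff_subst_eq hV, hB0], ?_, fun hS hh => ?_⟩
  · have h1 : ![(B 0).subst V, X 0, X 1] = fun i => (B i).subst V := by
      funext i
      revert i
      refine forall_fin_three rfl ?_ ?_
      · rw [hB1, subst_X hVs]; rfl
      · rw [hB2, subst_X hVs]; rfl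
    rw [h1, ← subst_comp_subst_apply hBs hVs, hfB, subst_add hVs, subst_mul hVs, subst_X hVs,
      subst_X hVs, hsC]
    simp [V]
  · refine (hconv (forall_fin_three ?_ (isConv_X _) (isConv_X _)) 0).subst hV
      (forall_fin_three ((isConv_C _).mul (isConv_X _)).neg (isConv_X _) (isConv_X _))
    refine (hh.subst hv ?_).sub ((isConv_C _).mul (isConv_X _))
    intro i; fin_cases i
    · exact isConv_X _
    · exact S.isConv_definingFunction hS

/-- The transformation rule for the quotient `ζ = ρ_z / ρ ^ m`. -/
theorem slope_transform (h : NormalizedMap m) (S : SegreFamily m ε)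
    {γ κ : MvPowerSeries (Fin 2) ℂ} (hγ : h.G = X 1 * γ) (hκ : pderiv ℂ 0 h.G = X 1 ^ m * κ)
    {ρ' ζ' : MvPowerSeries (Fin 3) ℂ} (hρ' : pderiv ℂ 0 ρ' = ρ' ^ m * ζ')
    (H : h.G.subst ![X 0, S.definingFunction] =
      ρ'.subst ![h.F.subst ![X 0, S.definingFunction], X 1, X 2]) :
    κ.subst ![X 0, S.definingFunction] +
        (pderiv ℂ 1 h.G).subst ![X 0, S.definingFunction] * S.slope =
      γ.subst ![X 0, S.definingFunction] ^ m *
        ((pderiv ℂ 0 h.F).subst ![X 0, S.definingFunction] +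
          (pderiv ℂ 1 h.F).subst ![X 0, S.definingFunction] *
            (S.definingFunction ^ m * S.slope)) *
        ζ'.subst ![h.F.subst ![X 0, S.definingFunction], X 1, X 2] := by
  have hv := constantCoeff_vec_two (constantCoeff_X (R := ℂ) (0 : Fin 3))
    S.constantCoeff_definingFunction
  have hvs := hasSubst_of_constantCoeff_zero hv
  have hw := constantCoeff_vec_three (h.constantCoeff_F_subst S)
    (constantCoeff_X (R := ℂ) (1 : Fin 3)) (constantCoeff_X 2)
  have hws := hasSubst_of_constantCoeff_zero hw
  have hd : ∀ f : MvPowerSeries (Fin 2) ℂ,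
      pderiv ℂ 0 (f.subst ![X 0, S.definingFunction]) =
        (pderiv ℂ 0 f).subst ![X 0, S.definingFunction] +
        (pderiv ℂ 1 f).subst ![X 0, S.definingFunction] *
          (S.definingFunction ^ m * S.slope) := by
    intro f
    rw [pderiv_subst hv, Fin.sum_univ_two]
    simp [S.pderiv_definingFunction]
  have h1 : pderiv ℂ (0 : Fin 3) (X 1) = 0 := pderiv_X_of_ne (by decide)
  have h2 : pderiv ℂ (0 : Fin 3) (X 2) = 0 := pderiv_X_of_ne (by decide)
  -- After differentiation in `z` every term contains `ρ^m`: on the left through `G_z = w^m κ` and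
  -- `ρ_z = ρ^m ζ`, on the right because `ρ'^m` becomes `G^m = ρ^m γ^m`. The factor is cancelled at
  -- the end.
  have hD := congrArg (pderiv ℂ 0) H
  rw [hd, pderiv_subst hw, Fin.sum_univ_three] at hD
  simp only [Matrix.cons_val, h1, h2, mul_zero, add_zero] at hD
  rw [hd, hκ, hρ', subst_mul hws, subst_pow hws, ← H, subst_mul hvs, subst_pow hvs,
    subst_X hvs] at hD
  have hG : h.G.subst ![X 0, S.definingFunction] =
      S.definingFunction * γ.subst ![X 0, S.definingFunction] := by
    rw [hγ, subst_mul hvs, subst_X hvs]; rfl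
  rw [hG] at hD
  simp only [Matrix.cons_val] at hD
  refine mul_left_cancel₀ (pow_ne_zero m S.definingFunction_ne_zero) ?_
  rw [mul_pow] at hD
  linear_combination hD

theorem constantCoeff_pderiv_G (h : NormalizedMap m) : constantCoeff (pderiv ℂ 1 h.G) = 1 := by
  obtain ⟨γ, κ, hγ, -, hγ1, -⟩ := h.exists_G_factor (NeZero.ne m)
  rw [hγ, Derivation.leibniz]
  simp [hγ1]

theorem constantCoeff_pderiv_F (h : NormalizedMap m) : constantCoeff (pderiv ℂ 0 h.F) = 1 := by
  rw [← coeff_single_zero_one, h.F_z]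

/-- The image of a Segre family under a normalized map has determined (and convergent, for
convergent data) initial values. -/
theorem exists_initialValues (h : NormalizedMap m) (S : SegreFamily m ε) :
    ∃ ω ν : MvPowerSeries (Fin 2) ℂ,
      (∀ ρ' ζ' : MvPowerSeries (Fin 3) ℂ, pderiv ℂ 0 ρ' = ρ' ^ m * ζ' →
        h.G.subst ![X 0, S.definingFunction] =
          ρ'.subst ![h.F.subst ![X 0, S.definingFunction], X 1, X 2] →
        ρ'.subst ![0, X 0, X 1] = ω ∧ ζ'.subst ![0, X 0, X 1] = ν) ∧
      (IsConv S.φ → h.Convergent → IsConv ω ∧ IsConv ν) := by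
  obtain ⟨γ, κ, hγ, hκ, hγ1, -⟩ := h.exists_G_factor (NeZero.ne m)
  obtain ⟨z, hz0, hz, hzconv⟩ := h.exists_zero S
  have hv := constantCoeff_vec_two (constantCoeff_X (R := ℂ) (0 : Fin 3))
    S.constantCoeff_definingFunction
  have hw := constantCoeff_vec_three (h.constantCoeff_F_subst S)
    (constantCoeff_X (R := ℂ) (1 : Fin 3)) (constantCoeff_X 2)
  have hu := constantCoeff_vec_three hz0
    (constantCoeff_X (R := ℂ) (0 : Fin 2)) (constantCoeff_X 1)
  have hus := hasSubst_of_constantCoeff_zero hu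
  set N := κ.subst ![X 0, S.definingFunction] +
    (pderiv ℂ 1 h.G).subst ![X 0, S.definingFunction] * S.slope with hN
  set D := γ.subst ![X 0, S.definingFunction] ^ m *
        ((pderiv ℂ 0 h.F).subst ![X 0, S.definingFunction] +
          (pderiv ℂ 1 h.F).subst ![X 0, S.definingFunction] *
            (S.definingFunction ^ m * S.slope)) with hD
  -- The constant term is `γ(0)^m F_z(0) = 1`, so the slope relation `N = D · ζ'` can be solved for
  -- `ζ'`.
  have hD1 : constantCoeff (D.subst ![z, X 0, X 1]) ≠ 0 := by
    rw [constantCoeff_subst_eq hu]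
    simp [hD, constantCoeff_subst_eq hv, hγ1, h.constantCoeff_pderiv_F, S.constantCoeff_slope]
  refine ⟨(h.G.subst ![X 0, S.definingFunction]).subst ![z, X 0, X 1],
    (D.subst ![z, X 0, X 1])⁻¹ * N.subst ![z, X 0, X 1], fun ρ' ζ' hρ' H => ?_,
    fun hS hh => ?_⟩
  -- On the zero set of `F` the first argument of `ρ'` and `ζ'` becomes zero, so the graph and slope
  -- relations express their initial values through `h` and `S` alone.
  · have hcomp : ∀ f : MvPowerSeries (Fin 3) ℂ,
        (f.subst ![h.F.subst ![X 0, S.definingFunction], X 1, X 2]).subst ![z, X 0, X 1] =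
          f.subst ![0, X 0, X 1] := by
      intro f
      rw [subst_subst_three (h.constantCoeff_F_subst S) (constantCoeff_X _) (constantCoeff_X _) hu,
        hz, subst_X_eq hu, subst_X_eq hu]
      rfl
    constructor
    · rw [H, hcomp]
    · have hT := h.slope_transform S hγ hκ hρ' H
      have := congrArg (MvPowerSeries.subst ![z, X 0, X 1]) hT
      rw [← hN, ← hD, subst_mul hus, hcomp] at this
      rw [this, ← mul_assoc, MvPowerSeries.inv_mul_cancel _ hD1, one_mul]
  · obtain ⟨hhF, hhG⟩ := hh
    rw [isConvergent_iff_isConv] at hhF hhG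
    have hvc : ∀ i, IsConv ((![X 0, S.definingFunction] : Fin 2 → MvPowerSeries (Fin 3) ℂ) i) := by
      intro i; fin_cases i
      · exact isConv_X _
      · exact S.isConv_definingFunction hS
    have huc : ∀ i, IsConv ((![z, X 0, X 1] : Fin 3 → MvPowerSeries (Fin 2) ℂ) i) :=
      forall_fin_three (hzconv hS hhF) (isConv_X _) (isConv_X _)
    have hγc : IsConv γ := by
      rw [hγ, ← pow_one (X 1)] at hhG
      exact hhG.of_X_pow_mul
    have hκc : IsConv κ := by
      have := hhG.pderiv 0
      rw [hκ] at this
      exact this.of_X_pow_mul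
    have hsl := S.isConv_slope hS
    have hNc : IsConv N := (hκc.subst hv hvc).add (((hhG.pderiv 1).subst hv hvc).mul hsl)
    have hDc : IsConv D := ((hγc.subst hv hvc).pow m).mul
      (((hhF.pderiv 0).subst hv hvc).add (((hhF.pderiv 1).subst hv hvc).mul
        (((S.isConv_definingFunction hS).pow m).mul hsl)))
    exact ⟨(hhG.subst hv hvc).subst hu huc,
      ((hDc.subst hu huc).inv hD1).mul (hNc.subst hu huc)⟩

end NormalizedMap

end Morphisms

end SegreODE

namespace SegreODE

open MvPowerSeries Filter Topology
open scoped ENNReal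

/-! ### Parameter maps: existence, normalization, uniqueness and convergence. -/

section Parameters

variable {m : ℕ} {ε : ℤˣ} {n : ℕ}

namespace SegreFamily

variable (S : SegreFamily m ε) {a b : MvPowerSeries (Fin n) ℂ}

theorem definingFunction_subst_zero (ha : constantCoeff a = 0) (hb : constantCoeff b = 0) :
    S.definingFunction.subst ![0, a, b] = b := by
  have hs := hasSubst_of_constantCoeff_zero (constantCoeff_vec_three (map_zero _) ha hb)
  obtain ⟨q, hq⟩ := S.X_dvd_definingFunction_sub
  rw [sub_eq_iff_eq_add] at hq
  rw [hq, subst_add hs, subst_mul hs, subst_X hs, subst_X hs]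
  simp

theorem slope_subst_zero (ha : constantCoeff a = 0) (hb : constantCoeff b = 0) :
    S.slope.subst ![0, a, b] = C (Complex.I * ((ε : ℤ) : ℂ)) * a := by
  have hs := hasSubst_of_constantCoeff_zero (constantCoeff_vec_three (map_zero _) ha hb)
  obtain ⟨q, hq⟩ := S.X_dvd_slope_sub
  rw [sub_eq_iff_eq_add] at hq
  have hC : (C (Complex.I * ((ε : ℤ) : ℂ)) : MvPowerSeries (Fin 3) ℂ).subst ![0, a, b] =
    C (Complex.I * ((ε : ℤ) : ℂ)) := subst_C _
  rw [hq, subst_add hs, subst_mul hs, subst_mul hs, subst_X hs, subst_X hs, hC]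
  simp

end SegreFamily

theorem subst_zero_zero (f : MvPowerSeries (Fin 2) ℂ) :
    f.subst ![(0 : MvPowerSeries (Fin n) ℂ), 0] = C (constantCoeff f) := by
  have h : ![(0 : MvPowerSeries (Fin n) ℂ), 0] = 0 := by
    funext i; fin_cases i <;> rfl
  rw [h]
  exact subst_zero_eq_C_constantCoeff

theorem aeval_X_subst {a b : MvPowerSeries (Fin n) ℂ} (ha : constantCoeff a = 0)
    (hb : constantCoeff b = 0) (r : Polynomial ℝ) :
    (Polynomial.aeval (X 1 : MvPowerSeries (Fin 2) ℂ) r).subst ![a, b] = Polynomial.aeval b r := by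
  have hs := hasSubst_of_constantCoeff_zero (constantCoeff_vec_two ha hb)
  have := Polynomial.aeval_algHom_apply ((substAlgHom (R := ℂ) hs).restrictScalars ℝ)
    (X 1 : MvPowerSeries (Fin 2) ℂ) r
  simp only [AlgHom.restrictScalars_apply, coe_substAlgHom] at this
  rw [← this, subst_X hs]
  rfl

theorem conj_conj (f : MvPowerSeries (Fin n) ℂ) : conj (conj f) = f := by
  ext d
  simp [conj]

/-- By `isNormalizedSnd_iff`, normalization is congruence modulo `w^(m+1)` to a real polynomial in
`w`, which conjugation fixes. -/
theorem IsNormalizedSnd.conj {G : MvPowerSeries (Fin 2) ℂ} (hm : m ≠ 0)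
    (h : IsNormalizedSnd m G) : IsNormalizedSnd m (conj G) := by
  rw [isNormalizedSnd_iff hm] at h ⊢
  obtain ⟨r, h0, h1, q, hq⟩ := h
  refine ⟨r, h0, h1, SegreODE.conj q, ?_⟩
  have hr : SegreODE.conj (Polynomial.aeval (X 1 : MvPowerSeries (Fin 2) ℂ) r) =
      Polynomial.aeval (X 1 : MvPowerSeries (Fin 2) ℂ) r := by
    ext d
    rw [SegreODE.conj, coeff_map, coeff_aeval_X_one]
    split_ifs <;> simp
  have := congrArg SegreODE.conj hq
  rw [← hr]
  simpa [SegreODE.conj] using this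

variable [NeZero m] {S₁ S₂ : SegreFamily m ε} {H : NormalizedMap m}
  {L O : MvPowerSeries (Fin 2) ℂ}

/-- The family `z ↦ ρ₂(z, L, O)` and the image of the first Segre family. -/
theorem NormalizedMap.pderiv_and_graph_of_mapsInto
    (hL : constantCoeff L = 0) (hO : constantCoeff O = 0)
    (hmap : H.G.subst ![X 0, S₁.definingFunction] = S₂.definingFunction.subst
      ![H.F.subst ![X 0, S₁.definingFunction],
        L.subst ![(X 1 : MvPowerSeries (Fin 3) ℂ), X 2],
        O.subst ![(X 1 : MvPowerSeries (Fin 3) ℂ), X 2]]) :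
    ∃ ρ' ζ' : MvPowerSeries (Fin 3) ℂ, pderiv ℂ 0 ρ' = ρ' ^ m * ζ' ∧
      H.G.subst ![X 0, S₁.definingFunction] =
        ρ'.subst ![H.F.subst ![X 0, S₁.definingFunction], X 1, X 2] ∧
      ∀ {l : ℕ} (a b c : MvPowerSeries (Fin l) ℂ), constantCoeff a = 0 → constantCoeff b = 0 →
        constantCoeff c = 0 →
        ρ'.subst ![a, b, c] = S₂.definingFunction.subst ![a, L.subst ![b, c], O.subst ![b, c]] ∧
        ζ'.subst ![a, b, c] = S₂.slope.subst ![a, L.subst ![b, c], O.subst ![b, c]] := by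
  have h12 := constantCoeff_vec_two (constantCoeff_X (R := ℂ) (1 : Fin 3)) (constantCoeff_X 2)
  have hL' : constantCoeff (L.subst ![(X 1 : MvPowerSeries (Fin 3) ℂ), X 2]) = 0 := by
    rw [constantCoeff_subst_eq h12, hL]
  have hO' : constantCoeff (O.subst ![(X 1 : MvPowerSeries (Fin 3) ℂ), X 2]) = 0 := by
    rw [constantCoeff_subst_eq h12, hO]
  have hpd : ∀ f : MvPowerSeries (Fin 2) ℂ,
      pderiv ℂ 0 (f.subst ![(X 1 : MvPowerSeries (Fin 3) ℂ), X 2]) = 0 := by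
    have h1 : pderiv ℂ (0 : Fin 3) (X 1) = 0 := pderiv_X_of_ne (by decide)
    have h2 : pderiv ℂ (0 : Fin 3) (X 2) = 0 := pderiv_X_of_ne (by decide)
    intro f
    rw [pderiv_subst h12, Fin.sum_univ_two]
    simp [h1, h2]
  -- The equation of `S₂` serves only to know that `ρ_z = ρ^m ζ` survives substituting
  -- `z`-independent series for the parameters.
  obtain ⟨E₂, hE₂, -⟩ := S₂.exists_ode
  have hsol := (S₂.isSystemSolution hE₂).subst (k := 2) hL' hO' (hpd L) (hpd O)
  have hcomp : ∀ {l : ℕ} (a b c : MvPowerSeries (Fin l) ℂ), constantCoeff a = 0 →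
      constantCoeff b = 0 → constantCoeff c = 0 → ∀ f : MvPowerSeries (Fin 3) ℂ,
      (f.subst ![X 0, L.subst ![(X 1 : MvPowerSeries (Fin 3) ℂ), X 2],
        O.subst ![(X 1 : MvPowerSeries (Fin 3) ℂ), X 2]]).subst ![a, b, c] =
      f.subst ![a, L.subst ![b, c], O.subst ![b, c]] := by
    intro l a b c ha hb hc f
    have habc := constantCoeff_vec_three ha hb hc
    rw [subst_subst_three (constantCoeff_X _) hL' hO' habc,
      subst_subst_two (constantCoeff_X _) (constantCoeff_X _) habc,
      subst_subst_two (constantCoeff_X _) (constantCoeff_X _) habc,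
      subst_X_eq habc, subst_X_eq habc, subst_X_eq habc]
    rfl
  refine ⟨_, _, hsol.pderiv_fst, ?_, fun a b c ha hb hc =>
    ⟨hcomp a b c ha hb hc _, hcomp a b c ha hb hc _⟩⟩
  rw [hcomp _ _ _ (H.constantCoeff_F_subst S₁) (constantCoeff_X _) (constantCoeff_X _), hmap]

/-- The image family starts at `z = 0` with value `O` and slope `i ε L`, and these initial values
are determined by `H` and `S₁`. This yields both the faithfulness of `(F, G, Λ, Ω) ↦ (F, G)` and the
convergence of the parameter map. -/
theorem NormalizedMap.exists_param_values (H : NormalizedMap m) (S₁ : SegreFamily m ε) :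
    ∃ l o : MvPowerSeries (Fin 2) ℂ, (∀ (S₂ : SegreFamily m ε) (L O : MvPowerSeries (Fin 2) ℂ),
      constantCoeff L = 0 → constantCoeff O = 0 →
      H.G.subst ![X 0, S₁.definingFunction] = S₂.definingFunction.subst
        ![H.F.subst ![X 0, S₁.definingFunction],
          L.subst ![(X 1 : MvPowerSeries (Fin 3) ℂ), X 2],
          O.subst ![(X 1 : MvPowerSeries (Fin 3) ℂ), X 2]] → L = l ∧ O = o) ∧
      (IsConv S₁.φ → H.Convergent → IsConv l ∧ IsConv o) := by
  obtain ⟨ω, ν, h, hconv⟩ := H.exists_initialValues S₁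
  refine ⟨C (-(Complex.I * ((ε : ℤ) : ℂ))) * ν, ω, fun S₂ L O hL hO hmap => ?_, fun hS hH =>
    ⟨(isConv_C _).mul (hconv hS hH).2, (hconv hS hH).1⟩⟩
  obtain ⟨ρ', ζ', hd, hg, hv⟩ := H.pderiv_and_graph_of_mapsInto hL hO hmap
  obtain ⟨h1, h2⟩ := h ρ' ζ' hd hg
  obtain ⟨h3, h4⟩ := hv (0 : MvPowerSeries (Fin 2) ℂ) (X 0) (X 1) (map_zero _)
    (constantCoeff_X _) (constantCoeff_X _)
  rw [subst_vec_X_two, subst_vec_X_two, S₂.definingFunction_subst_zero hL hO, h1] at h3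
  rw [subst_vec_X_two, subst_vec_X_two, S₂.slope_subst_zero hL hO, h2] at h4
  refine ⟨?_, h3.symm⟩
  rw [h4]
  linear_combination -L * C_mul_C_sign ε (σ := Fin 2)

/-- At `z = τ = 0` one has `ρ₁ = 0`, so the coefficients in the slope relation reduce to their
constant terms, and it reads `i ε χ = i ε L(χ, 0)`; hence even `L(χ, 0) = χ`. -/
theorem NormalizedMap.coeff_param_fst (hL : constantCoeff L = 0) (hO : constantCoeff O = 0)
    (hmap : H.G.subst ![X 0, S₁.definingFunction] = S₂.definingFunction.subst
      ![H.F.subst ![X 0, S₁.definingFunction],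
        L.subst ![(X 1 : MvPowerSeries (Fin 3) ℂ), X 2],
        O.subst ![(X 1 : MvPowerSeries (Fin 3) ℂ), X 2]]) :
    coeff (Finsupp.single 0 1) L = 1 := by
  obtain ⟨ρ', ζ', hd, hg, hv⟩ := H.pderiv_and_graph_of_mapsInto hL hO hmap
  obtain ⟨γ, κ, hγ, hκ, hγ1, hκ0⟩ := H.exists_G_factor (NeZero.ne m)
  have hT := H.slope_transform S₁ hγ hκ hd hg
  have hu := constantCoeff_vec_three (map_zero _) (constantCoeff_X (R := ℂ) (0 : Fin 2))
    (map_zero _)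
  have hus := hasSubst_of_constantCoeff_zero hu
  have hρ : S₁.definingFunction.subst ![(0 : MvPowerSeries (Fin 2) ℂ), X 0, 0] = 0 :=
    S₁.definingFunction_subst_zero (constantCoeff_X _) (map_zero _)
  have hp : ∀ f : MvPowerSeries (Fin 2) ℂ, (f.subst ![X 0, S₁.definingFunction]).subst
      ![(0 : MvPowerSeries (Fin 2) ℂ), X 0, 0] = C (constantCoeff f) := by
    intro f
    rw [subst_subst_two (constantCoeff_X _) S₁.constantCoeff_definingFunction hu,
      subst_X_eq hu, hρ]
    exact subst_zero_zero f
  have hX0 : constantCoeff (X 0 : MvPowerSeries (Fin 2) ℂ) = 0 := constantCoeff_X _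
  have h := congrArg (MvPowerSeries.subst ![(0 : MvPowerSeries (Fin 2) ℂ), X 0, 0]) hT
  rw [subst_add hus, subst_mul hus, subst_mul hus, subst_mul hus, subst_pow hus, subst_add hus,
    subst_mul hus, subst_mul hus, subst_pow hus, hp, hp, hp, hp, hp, hρ,
    subst_subst_three (H.constantCoeff_F_subst S₁) (constantCoeff_X _) (constantCoeff_X _) hu, hp,
    subst_X_eq hu, subst_X_eq hu, H.F_zero, hγ1, hκ0, H.constantCoeff_pderiv_G,
    H.constantCoeff_pderiv_F, S₁.slope_subst_zero hX0 (map_zero _)] at h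
  simp only [map_zero, map_one, Matrix.cons_val] at h
  have hLX : constantCoeff (L.subst ![(X 0 : MvPowerSeries (Fin 2) ℂ), 0]) = 0 := by
    rw [constantCoeff_subst_eq (constantCoeff_vec_two hX0 (map_zero _)), hL]
  have hOX : constantCoeff (O.subst ![(X 0 : MvPowerSeries (Fin 2) ℂ), 0]) = 0 := by
    rw [constantCoeff_subst_eq (constantCoeff_vec_two hX0 (map_zero _)), hO]
  rw [(hv (0 : MvPowerSeries (Fin 2) ℂ) (X 0) 0 (map_zero _) hX0 (map_zero _)).2,
    S₂.slope_subst_zero hLX hOX, zero_pow (NeZero.ne m)] at h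
  have hL1 : L.subst ![(X 0 : MvPowerSeries (Fin 2) ℂ), 0] = X 0 := by
    linear_combination -C (-(Complex.I * ((ε : ℤ) : ℂ))) * h +
      (X 0 - L.subst ![(X 0 : MvPowerSeries (Fin 2) ℂ), 0]) * C_mul_C_sign ε (σ := Fin 2)
  have h0 := congrArg (fun f => constantCoeff (pderiv ℂ (0 : Fin 2) f)) hL1
  simp only [pderiv_X_self, map_one] at h0
  rw [pderiv_subst (constantCoeff_vec_two hX0 (map_zero _)), Fin.sum_univ_two] at h0
  simp only [Matrix.cons_val_zero, Matrix.cons_val_one, pderiv_X_self, map_zero, mul_zero,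
    add_zero, mul_one] at h0
  rwa [constantCoeff_subst_eq (constantCoeff_vec_two hX0 (map_zero _)),
    ← coeff_single_zero_one] at h0

/-- At `z = 0` the mapping identity is `G(0, τ) = O exp(i O^(m-1) φ₂(f, L, O))` with `f = F(0, τ)`.
Since `τ` divides `O` and `f`, and `φ₂` is a multiple of its first argument, `G(0, τ) - O` is a
multiple of `O^m f`, hence of `τ^(m+1)`. So `O` is congruent to the same real polynomial as `G`. -/
theorem NormalizedMap.isNormalizedSnd_param_snd
    (hL : constantCoeff L = 0) (hO : constantCoeff O = 0)
    (hmap : H.G.subst ![X 0, S₁.definingFunction] = S₂.definingFunction.subst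
      ![H.F.subst ![X 0, S₁.definingFunction],
        L.subst ![(X 1 : MvPowerSeries (Fin 3) ℂ), X 2],
        O.subst ![(X 1 : MvPowerSeries (Fin 3) ℂ), X 2]]) :
    IsNormalizedSnd m O := by
  have hX0 : constantCoeff (X 0 : MvPowerSeries (Fin 2) ℂ) = 0 := constantCoeff_X _
  have hX1 : constantCoeff (X 1 : MvPowerSeries (Fin 2) ℂ) = 0 := constantCoeff_X _
  have hu := constantCoeff_vec_three (map_zero _) hX0 hX1
  have hus := hasSubst_of_constantCoeff_zero hu
  have h01 := constantCoeff_vec_two (map_zero _) hX1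
  have h01s := hasSubst_of_constantCoeff_zero h01
  have h12 := constantCoeff_vec_two (constantCoeff_X (R := ℂ) (1 : Fin 3)) (constantCoeff_X 2)
  have hp : ∀ f : MvPowerSeries (Fin 2) ℂ, (f.subst ![X 0, S₁.definingFunction]).subst
      ![(0 : MvPowerSeries (Fin 2) ℂ), X 0, X 1] = f.subst ![0, X 1] := by
    intro f
    rw [subst_subst_two (constantCoeff_X _) S₁.constantCoeff_definingFunction hu,
      subst_X_eq hu, S₁.definingFunction_subst_zero hX0 hX1]
    rfl
  have hq : ∀ f : MvPowerSeries (Fin 2) ℂ,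
      (f.subst ![(X 1 : MvPowerSeries (Fin 3) ℂ), X 2]).subst
        ![(0 : MvPowerSeries (Fin 2) ℂ), X 0, X 1] = f := by
    intro f
    rw [subst_subst_two (constantCoeff_X _) (constantCoeff_X _) hu, subst_X_eq hu, subst_X_eq hu]
    exact subst_vec_X_two f
  have hLc : constantCoeff (L.subst ![(X 1 : MvPowerSeries (Fin 3) ℂ), X 2]) = 0 := by
    rw [constantCoeff_subst_eq h12, hL]
  have hOc : constantCoeff (O.subst ![(X 1 : MvPowerSeries (Fin 3) ℂ), X 2]) = 0 := by
    rw [constantCoeff_subst_eq h12, hO]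
  have h := congrArg (MvPowerSeries.subst ![(0 : MvPowerSeries (Fin 2) ℂ), X 0, X 1]) hmap
  rw [hp, subst_subst_three (H.constantCoeff_F_subst S₁) hLc hOc hu, hp, hq, hq] at h
  set f := H.F.subst ![(0 : MvPowerSeries (Fin 2) ℂ), X 1] with hf
  have hf0 : constantCoeff f = 0 := by rw [hf, constantCoeff_subst_eq h01, H.F_zero]
  have hf1 : X 1 ∣ f := by
    obtain ⟨A, B, hAB, -⟩ := exists_decomposition H.F H.F_zero
    rw [hf, hAB, subst_add h01s, subst_mul h01s, subst_mul h01s, subst_X h01s, subst_X h01s]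
    simp
  have hw := constantCoeff_vec_three hf0 hL hO
  have hws := hasSubst_of_constantCoeff_zero hw
  rw [S₂.definingFunction_eq, subst_mul hws, subst_X hws] at h
  simp only [Matrix.cons_val] at h
  have hG1 : X 1 ∣ H.G.subst ![(0 : MvPowerSeries (Fin 2) ℂ), X 1] := by
    obtain ⟨k, hk⟩ := H.X_dvd_G
    rw [hk, subst_mul h01s, subst_X h01s]
    simp
  have hO1 : X 1 ∣ O := by
    have hv : S₂.expUnit.subst ![f, L, O] * (S₂.expUnit.subst ![f, L, O])⁻¹ = 1 :=
      MvPowerSeries.mul_inv_cancel _ (by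
        rw [constantCoeff_subst_eq hw, S₂.constantCoeff_expUnit]; exact one_ne_zero)
    have hO' : O = H.G.subst ![(0 : MvPowerSeries (Fin 2) ℂ), X 1] *
        (S₂.expUnit.subst ![f, L, O])⁻¹ := by
      rw [h]; linear_combination -O * hv
    rw [hO']
    exact hG1.mul_right _
  have hdiff : X 1 ^ (m + 1) ∣ H.G.subst ![(0 : MvPowerSeries (Fin 2) ℂ), X 1] - O := by
    obtain ⟨q, hq⟩ := dvd_exp_subst_sub_one S₂.constantCoeff_exponent
    obtain ⟨p, hp⟩ := S₂.X_dvd_φ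
    have he : S₂.expUnit = 1 + X 2 ^ (m - 1) * (X 0 * (X 1 * p * C Complex.I * q)) := by
      have : S₂.expUnit - 1 = S₂.exponent * q := hq
      rw [sub_eq_iff_eq_add] at this
      rw [this, SegreFamily.exponent, hp]
      ring
    have hone : (1 : MvPowerSeries (Fin 3) ℂ).subst ![f, L, O] = 1 := by
      rw [← coe_substAlgHom hws, map_one]
    rw [h, he, subst_add hws, subst_mul hws, subst_mul hws, subst_pow hws, subst_X hws,
      subst_X hws, hone]
    simp only [Matrix.cons_val]
    obtain ⟨n, hn⟩ := Nat.exists_eq_succ_of_ne_zero (NeZero.ne m)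
    generalize (X 1 * p * C Complex.I * q).subst ![f, L, O] = Q
    have e : O * (1 + O ^ (m - 1) * (f * Q)) - O = O ^ m * f * Q := by
      rw [hn]; simp only [Nat.succ_eq_add_one, Nat.add_sub_cancel]; ring
    rw [e, pow_succ]
    exact (mul_dvd_mul (pow_dvd_pow_of_dvd hO1 m) hf1).mul_right _
  obtain ⟨r, h0, h1, q, hq'⟩ := (isNormalizedSnd_iff (NeZero.ne m) _).1 H.G_normalized
  refine (isNormalizedSnd_iff (NeZero.ne m) _).2 ⟨r, h0, h1, ?_⟩
  have h2 := congrArg (MvPowerSeries.subst ![(0 : MvPowerSeries (Fin 2) ℂ), X 1]) hq'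
  rw [subst_sub h01s, aeval_X_subst (map_zero _) hX1, subst_mul h01s, subst_pow h01s,
    subst_X h01s] at h2
  have e : O - Polynomial.aeval (X 1 : MvPowerSeries (Fin 2) ℂ) r =
      X 1 ^ (m + 1) * q.subst ![(0 : MvPowerSeries (Fin 2) ℂ), X 1] -
        (H.G.subst ![(0 : MvPowerSeries (Fin 2) ℂ), X 1] - O) := by
    simp only [Matrix.cons_val_one, Matrix.cons_val_zero] at h2
    rw [← h2]; ring
  rw [e]
  exact dvd_sub (dvd_mul_right _ _) hdiff

/-- A morphism of equations induces a morphism of the associated Segre families. -/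
theorem SingularODE.Hom.exists_segreHom {E₁ E₂ : SingularODE m} (h : E₁.Hom E₂)
    (h₁ : E₁.IsSolution (k := 2) S₁.definingFunction)
    (h₂ : E₂.IsSolution (k := 2) S₂.definingFunction) :
    ∃ g : S₁.Hom S₂, g.planar = h.planar := by
  -- The morphism is applied to the Segre family itself, the universal solution with parameters `(χ,
  -- τ)`. The image is a family of solutions of `E₂`, hence a reparametrized `S₂`, with parameters
  -- `L` and `O` read off from its initial values.
  obtain ⟨ρ', hρ', hT⟩ := h.transforms 2 S₁.definingFunction h₁
  obtain ⟨ζ', hsys⟩ := hρ'.exists_isSystemSolution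
  obtain ⟨hρ'', -⟩ := S₂.eq_subst_of_isSystemSolution h₂ hsys
  unfold NormalizedMap.TransformsGraph at hT
  rw [cons_X_eq] at hT
  have hu := constantCoeff_vec_three (map_zero _) (constantCoeff_X (R := ℂ) (0 : Fin 2))
    (constantCoeff_X 1)
  have h12 := constantCoeff_vec_two (constantCoeff_X (R := ℂ) (1 : Fin 3)) (constantCoeff_X 2)
  have h12s := hasSubst_of_constantCoeff_zero h12
  let c : ℂ := -(Complex.I * ((ε : ℤ) : ℂ))
  let L : MvPowerSeries (Fin 2) ℂ := C c * ζ'.subst ![0, X 0, X 1]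
  let O : MvPowerSeries (Fin 2) ℂ := ρ'.subst ![0, X 0, X 1]
  have hL : constantCoeff L = 0 := by
    simp only [L]
    rw [map_mul, constantCoeff_subst_eq hu, hsys.constantCoeff_snd, mul_zero]
  have hO : constantCoeff O = 0 := by
    simp only [O]
    rw [constantCoeff_subst_eq hu, hsys.constantCoeff_fst]
  have hi : ∀ f : MvPowerSeries (Fin 3) ℂ, (f.subst ![(0 : MvPowerSeries (Fin 2) ℂ), X 0, X 1]).subst
      ![(X 1 : MvPowerSeries (Fin 3) ℂ), X 2] = initialValue f := by
    intro f
    rw [subst_subst_three (map_zero _) (constantCoeff_X _) (constantCoeff_X _) h12, subst_X_eq h12,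
      subst_X_eq h12, ← coe_substAlgHom h12s, map_zero, initialValue, cons_X_eq]
    rfl
  have hO' : O.subst ![(X 1 : MvPowerSeries (Fin 3) ℂ), X 2] = initialValue ρ' := hi ρ'
  have hL' : L.subst ![(X 1 : MvPowerSeries (Fin 3) ℂ), X 2] = C c * initialValue ζ' := by
    simp only [L]
    have hC : (C c : MvPowerSeries (Fin 2) ℂ).subst ![(X 1 : MvPowerSeries (Fin 3) ℂ), X 2] = C c :=
      subst_C _
    rw [subst_mul h12s, hi, hC]
  have hF := h.planar.constantCoeff_F_subst S₁
  have hw := constantCoeff_vec_three hF (constantCoeff_X (R := ℂ) (1 : Fin 3)) (constantCoeff_X 2)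
  have hws := hasSubst_of_constantCoeff_zero hw
  have hmap : h.planar.G.subst ![X 0, S₁.definingFunction] = S₂.definingFunction.subst
      ![h.planar.F.subst ![X 0, S₁.definingFunction],
        L.subst ![(X 1 : MvPowerSeries (Fin 3) ℂ), X 2],
        O.subst ![(X 1 : MvPowerSeries (Fin 3) ℂ), X 2]] := by
    have hLc : constantCoeff (C c * initialValue ζ') = 0 := by
      rw [map_mul, constantCoeff_initialValue, hsys.constantCoeff_snd, mul_zero]
    have hOc : constantCoeff (initialValue ρ') = 0 := by
      rw [constantCoeff_initialValue, hsys.constantCoeff_fst]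
    have hfix : ∀ f : MvPowerSeries (Fin 3) ℂ, (initialValue f).subst
        ![h.planar.F.subst ![X 0, S₁.definingFunction], X 1, X 2] = initialValue f := by
      intro f
      have := initialValue_subst_cons f hF
      rwa [cons_X_eq] at this
    have hC : (C c : MvPowerSeries (Fin 3) ℂ).subst
        ![h.planar.F.subst ![X 0, S₁.definingFunction], X 1, X 2] = C c := subst_C _
    rw [hT, hρ'', subst_subst_three (constantCoeff_X _) hLc hOc hw, subst_mul hws, hC, hfix, hfix,
      subst_X_eq hw, hL', hO']
    rfl
  -- `L` and `O` are the conjugated components `Λ̄` and `Ω̄`, while a morphism stores `Λ` and `Ω`.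
  refine ⟨⟨h.planar, ⟨conj L, conj O, constantCoeff_conj hL, ?_,
    (NormalizedMap.isNormalizedSnd_param_snd hL hO hmap).conj (NeZero.ne m)⟩, ?_⟩, rfl⟩
  · rw [conj, coeff_map, NormalizedMap.coeff_param_fst hL hO hmap, map_one]
  · rw [conj_conj, conj_conj, hmap]

/-- A morphism of Segre families is determined by its action on the variables `(z, w)`. -/
theorem SegreFamily.Hom.ext_planar {g g' : S₁.Hom S₂} (h : g.planar = g'.planar) : g = g' := by
  obtain ⟨l, o, huniq, -⟩ := g.planar.exists_param_values S₁
  obtain ⟨h1, h2⟩ := huniq S₂ _ _ (constantCoeff_conj g.param.F_zero)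
    (constantCoeff_conj g.param.G_zero) g.maps_into
  obtain ⟨h3, h4⟩ := huniq S₂ _ _ (constantCoeff_conj g'.param.F_zero)
    (constantCoeff_conj g'.param.G_zero) (by rw [h]; exact g'.maps_into)
  refine SegreFamily.Hom.ext h (NormalizedMap.ext ?_ ?_)
  · rw [← conj_conj g.param.F, h1, ← h3, conj_conj]
  · rw [← conj_conj g.param.G, h2, ← h4, conj_conj]

theorem SegreFamily.Hom.param_convergent (g : S₁.Hom S₂) (hS : S₁.Convergent)
    (hg : g.planar.Convergent) : g.param.Convergent := by
  obtain ⟨l, o, huniq, hconv⟩ := g.planar.exists_param_values S₁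
  obtain ⟨h1, h2⟩ := huniq S₂ _ _ (constantCoeff_conj g.param.F_zero)
    (constantCoeff_conj g.param.G_zero) g.maps_into
  obtain ⟨h3, h4⟩ := hconv ((isConvergent_iff_isConv _).1 hS) hg
  rw [← h1, isConv_conj_iff, ← isConvergent_iff_isConv] at h3
  rw [← h2, isConv_conj_iff, ← isConvergent_iff_isConv] at h4
  exact ⟨h3, h4⟩

end Parameters

end SegreODE

namespace SegreODE

open MvPowerSeries Filter Topology

/-! ### The two functors and their mutual inversion. -/

section Functors

variable {m : ℕ} [NeZero m] {ε : ℤˣ}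

/-- The singular ordinary differential equation satisfied by a Segre family. -/
def SegreFamily.toODE (S : SegreFamily m ε) : SingularODE m := S.exists_ode.choose

theorem SegreFamily.isSolution_toODE (S : SegreFamily m ε) :
    S.toODE.IsSolution (k := 2) S.definingFunction := S.exists_ode.choose_spec.1

theorem SegreFamily.toODE_eq_iff (S : SegreFamily m ε) (E : SingularODE m) :
    S.toODE = E ↔ E.IsSolution (k := 2) S.definingFunction :=
  ⟨fun h => h ▸ S.isSolution_toODE, S.exists_ode.choose_spec.2.1 E⟩

variable (ε) in
/-- The Segre family of solutions of a singular ordinary differential equation. -/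
def SingularODE.toSegre (E : SingularODE m) : SegreFamily m ε := (E.exists_segre ε).choose

theorem SingularODE.isSolution_toSegre (E : SingularODE m) :
    E.IsSolution (k := 2) (E.toSegre ε).definingFunction := (E.exists_segre ε).choose_spec.1

theorem SingularODE.toSegre_eq_iff (E : SingularODE m) (S : SegreFamily m ε) :
    E.toSegre ε = S ↔ E.IsSolution (k := 2) S.definingFunction :=
  ⟨fun h => h ▸ E.isSolution_toSegre, fun h => SegreFamily.eq_of_isSolution E.isSolution_toSegre h⟩

/-- The functor from Segre families to singular ordinary differential equations. -/
def odeFunctor (m : ℕ) [NeZero m] (ε : ℤˣ) : SegreFamily m ε ⥤ SingularODE m where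
  obj S := S.toODE
  map {S₁ S₂} g := (⟨SegreFamily.Hom.planar g, fun _ ρ hρ =>
    SegreFamily.Hom.transforms g S₁.isSolution_toODE S₂.isSolution_toODE ρ hρ⟩ :
      SingularODE.Hom S₁.toODE S₂.toODE)
  map_id _ := SingularODE.Hom.ext rfl
  map_comp _ _ := SingularODE.Hom.ext rfl

/-- The morphism of Segre families induced by a morphism of equations. -/
def SingularODE.Hom.toSegreHom (ε : ℤˣ) {E₁ E₂ : SingularODE m} (h : E₁.Hom E₂) :
    (E₁.toSegre ε).Hom (E₂.toSegre ε) :=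
  (h.exists_segreHom E₁.isSolution_toSegre E₂.isSolution_toSegre).choose

theorem SingularODE.Hom.planar_toSegreHom {E₁ E₂ : SingularODE m} (h : E₁.Hom E₂) :
    (h.toSegreHom ε).planar = h.planar :=
  (h.exists_segreHom E₁.isSolution_toSegre E₂.isSolution_toSegre).choose_spec

/-- The functor from singular ordinary differential equations to Segre families. -/
def segreFunctor (m : ℕ) [NeZero m] (ε : ℤˣ) : SingularODE m ⥤ SegreFamily m ε where
  obj E := E.toSegre ε
  map h := SingularODE.Hom.toSegreHom ε h
  -- The parameter maps come from a choice, but `(F, G)` determines them, so functoriality is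
  -- checked on `(F, G)` only.
  map_id _ := SegreFamily.Hom.ext_planar (SingularODE.Hom.planar_toSegreHom _)
  map_comp {_ E₂ _} g h := SegreFamily.Hom.ext_planar (by
    refine (SingularODE.Hom.planar_toSegreHom _).trans ?_
    change (SingularODE.Hom.planar h).comp (SingularODE.Hom.planar g) =
      NormalizedMap.comp (SingularODE.Hom.toSegreHom ε h).planar
        (SingularODE.Hom.toSegreHom ε g).planar
    rw [SingularODE.Hom.planar_toSegreHom, SingularODE.Hom.planar_toSegreHom])

theorem SingularODE.planar_comp {E₁ E₂ E₃ : SingularODE m} (g : E₁ ⟶ E₂) (h : E₂ ⟶ E₃) :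
    SingularODE.Hom.planar (g ≫ h) =
      (SingularODE.Hom.planar h).comp (SingularODE.Hom.planar g) := rfl

theorem SegreFamily.planar_comp {S₁ S₂ S₃ : SegreFamily m ε} (g : S₁ ⟶ S₂) (h : S₂ ⟶ S₃) :
    SegreFamily.Hom.planar (g ≫ h) =
      (SegreFamily.Hom.planar h).comp (SegreFamily.Hom.planar g) := rfl

theorem SingularODE.planar_eqToHom {E₁ E₂ : SingularODE m} (h : E₁ = E₂) :
    SingularODE.Hom.planar (eqToHom h) = NormalizedMap.id m := by
  subst h; rfl

theorem SegreFamily.planar_eqToHom {S₁ S₂ : SegreFamily m ε} (h : S₁ = S₂) :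
    SegreFamily.Hom.planar (eqToHom h) = NormalizedMap.id m := by
  subst h; rfl

/-- Equality of functors compares morphisms up to transport along equalities of objects. Transport
has the identity as its planar part, so it disappears after passing to `(F, G)`. -/
theorem SingularODE.planar_conj {E₁ E₂ E₃ E₄ : SingularODE m} (p : E₁ = E₂) (h : E₂ ⟶ E₃)
    (q : E₃ = E₄) : SingularODE.Hom.planar (eqToHom p ≫ h ≫ eqToHom q) =
      SingularODE.Hom.planar h := by
  rw [SingularODE.planar_comp, SingularODE.planar_comp, SingularODE.planar_eqToHom,
    SingularODE.planar_eqToHom, NormalizedMap.comp_id, NormalizedMap.id_comp]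

theorem SegreFamily.planar_conj {S₁ S₂ S₃ S₄ : SegreFamily m ε} (p : S₁ = S₂) (h : S₂ ⟶ S₃)
    (q : S₃ = S₄) : SegreFamily.Hom.planar (eqToHom p ≫ h ≫ eqToHom q) =
      SegreFamily.Hom.planar h := by
  rw [SegreFamily.planar_comp, SegreFamily.planar_comp, SegreFamily.planar_eqToHom,
    SegreFamily.planar_eqToHom, NormalizedMap.comp_id, NormalizedMap.id_comp]

theorem segreFunctor_comp_odeFunctor :
    (segreFunctor m ε).comp (odeFunctor m ε) = Functor.id (SingularODE m) := by
  refine CategoryTheory.Functor.ext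
    (fun E => ((E.toSegre ε).toODE_eq_iff E).2 E.isSolution_toSegre) ?_
  intro E₁ E₂ h
  exact SingularODE.Hom.ext ((SingularODE.Hom.planar_toSegreHom (ε := ε) h).trans
    (SingularODE.planar_conj _ _ _).symm)

theorem odeFunctor_comp_segreFunctor :
    (odeFunctor m ε).comp (segreFunctor m ε) = Functor.id (SegreFamily m ε) := by
  refine CategoryTheory.Functor.ext (fun S => (S.toODE.toSegre_eq_iff S).2 S.isSolution_toODE) ?_
  intro S₁ S₂ h
  exact SegreFamily.Hom.ext_planar ((SingularODE.Hom.planar_toSegreHom (ε := ε) _).trans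
    (SegreFamily.planar_conj _ _ _).symm)

theorem SegreFamily.Convergent.toODE {S : SegreFamily m ε} (h : S.Convergent) :
    S.toODE.Convergent :=
  (isConvergent_iff_isConv _).2
    (S.exists_ode.choose_spec.2.2 ((isConvergent_iff_isConv _).1 h))

theorem SingularODE.Convergent.toSegre {E : SingularODE m} (h : E.Convergent) :
    (E.toSegre ε).Convergent :=
  (isConvergent_iff_isConv _).2
    ((E.exists_segre ε).choose_spec.2 ((isConvergent_iff_isConv _).1 h))

end Functors

end SegreODE

end

theorem mainTheorem12 (m : ℕ) [NeZero m] (ε : ℤˣ) :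
    ∃ (𝓔 : CategoryTheory.Functor (SegreODE.SegreFamily m ε) (SegreODE.SingularODE m))
      (𝓢 : CategoryTheory.Functor (SegreODE.SingularODE m) (SegreODE.SegreFamily m ε)),
      -- the functors are mutually inverse
      (𝓢.comp 𝓔 = CategoryTheory.Functor.id (SegreODE.SingularODE m)) ∧
      (𝓔.comp 𝓢 = CategoryTheory.Functor.id (SegreODE.SegreFamily m ε)) ∧
      -- the values on objects are determined by the solution property
      (∀ (S : SegreODE.SegreFamily m ε) (E : SegreODE.SingularODE m),
        𝓔.obj S = E ↔ E.IsSolution (k := 2) S.definingFunction) ∧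
      (∀ (E : SegreODE.SingularODE m) (S : SegreODE.SegreFamily m ε),
        𝓢.obj E = S ↔ E.IsSolution (k := 2) S.definingFunction) ∧
      -- both functors keep the map `(F, G)` of the `(z, w)`-space
      (∀ {S₁ S₂ : SegreODE.SegreFamily m ε} (h : S₁ ⟶ S₂),
        (SegreODE.SingularODE.Hom.planar (𝓔.map h)) = SegreODE.SegreFamily.Hom.planar h) ∧
      (∀ {E₁ E₂ : SegreODE.SingularODE m} (h : E₁ ⟶ E₂),
        (SegreODE.SegreFamily.Hom.planar (𝓢.map h)) = SegreODE.SingularODE.Hom.planar h) ∧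
      -- preservation of convergence of objects and of morphisms between convergent objects
      (∀ S : SegreODE.SegreFamily m ε, S.Convergent → (𝓔.obj S).Convergent) ∧
      (∀ E : SegreODE.SingularODE m, E.Convergent → (𝓢.obj E).Convergent) ∧
      (∀ {S₁ S₂ : SegreODE.SegreFamily m ε} (h : S₁ ⟶ S₂), S₁.Convergent → S₂.Convergent →
        (SegreODE.SegreFamily.Hom.planar h).Convergent →
        (SegreODE.SegreFamily.Hom.param h).Convergent →
        (SegreODE.SingularODE.Hom.planar (𝓔.map h)).Convergent) ∧
      (∀ {E₁ E₂ : SegreODE.SingularODE m} (h : E₁ ⟶ E₂), E₁.Convergent → E₂.Convergent →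
        (SegreODE.SingularODE.Hom.planar h).Convergent →
        (SegreODE.SegreFamily.Hom.planar (𝓢.map h)).Convergent ∧
          (SegreODE.SegreFamily.Hom.param (𝓢.map h)).Convergent) := by
  refine ⟨SegreODE.odeFunctor m ε, SegreODE.segreFunctor m ε,
    SegreODE.segreFunctor_comp_odeFunctor, SegreODE.odeFunctor_comp_segreFunctor,
    fun S E => S.toODE_eq_iff E, fun E S => E.toSegre_eq_iff S, fun _ => rfl,
    fun h => SegreODE.SingularODE.Hom.planar_toSegreHom h, fun _ h => h.toODE,
    fun _ h => h.toSegre, fun _ _ _ h _ => h, fun h h₁ _ hh => ?_⟩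
  have hp : (SegreODE.SegreFamily.Hom.planar
      ((SegreODE.segreFunctor m ε).map h)).Convergent := by
    rw [show SegreODE.SegreFamily.Hom.planar ((SegreODE.segreFunctor m ε).map h) =
      SegreODE.SingularODE.Hom.planar h from SegreODE.SingularODE.Hom.planar_toSegreHom h]
    exact hh
  exact ⟨hp, SegreODE.SegreFamily.Hom.param_convergent _ h₁.toSegre hp⟩
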